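/- Packets $n=0,1,2,\dots$ are generated at times $r_0<r_1<\cdots$ by a Poisson process of rate $\lambda>0$ on $[0,\infty)$ and reach a single server at once. Their service times $H_n$ are positive, i.i.d. copies of $H$ and independent of the arrivals. Let $H^*(s)=\boldsymbol E[e^{-sH}]$, and let $H^{*(n)}(s)$ be its $n$-th derivative on $[0,\infty)$ (one-sided at $s=0$). Consider three systems, empty at time $0$: * **M/G/1/1**: a packet that arrives while the server is busy is rejected; * **M/G/1/2\***: there is one waiting place, a packet that arrives while the server is busy takes it and replaces the packet that was there, and at a service completion the server starts at once on the waiting packet, if any; * **M/G/1/1/preemptive**: an arriving packet always starts service at once, and the packet in service, if any, is discarded. Let $r_{\{l\}}$ and $C_{\{l\}}$ be the generation and completion time of the $l$-th packet whose service is completed. The age is $\Delta(t)=t-\max\{r_{\{l\}}: C_{\{l\}}\le t\}$ (and $\Delta(t)=t$ before the first completion), and the $l$-th peak $A_{\{l\}}$ is the value of the age just before $C_{\{l\}}$. The AoI $\boldsymbol E[\Delta]$ is the number such that $\frac1\tau\int_0^\tau\Delta(t)\,dt\to\boldsymbol E[\Delta]$ almost surely and $\frac1\tau\int_0^\tau\boldsymbol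 E[\Delta(t)]\,dt\to\boldsymbol E[\Delta]$ as $\tau\to\infty$ (so that $\lim_{t\to\infty}\boldsymbol E[\Delta(t)]=\boldsymbol E[\Delta]$ if this limit exists). The PAoI and the variance of peak age are the mean $\boldsymbol E[A]=\lim_l\boldsymbol E[A_{\{l\}}]=\lim_k\frac1k\sum_{l\le k}A_{\{l\}}$ (almost surely) and the variance $Var(A)=\lim_l Var(A_{\{l\}})$ of the limit distribution $A$ of the peaks. Then all these limits exist, all peaks have finite second moments, and the values are as follows. **M/G/1/1**, if $\boldsymbol E[H^2]<\infty$: $$\boldsymbol E[\Delta]=\frac{\frac{2}{\lambda^2}-\frac2\lambda H^{*(1)}(0)+H^{*(2)}(0)}{2\big(\frac1\lambda-H^{*(1)}(0)\big)}-H^{*(1)}(0),\quad \boldsymbol E[A]=\frac1\lambda-2H^{*(1)}(0),$$ $$Var(A)=\frac1{\lambda^2}+2H^{*(2)}(0)-2\{H^{*(1)}(0)\}^2 .$$ **M/G/1/2\***, if $\boldsymbol E[H^2]<\infty$: $$\boldsymbol E[\Delta]=\frac{\frac12H^{*(2)}(0)+\frac1{\lambda^2}H^*(\lambda)-\frac1\lambda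 H^{*(1)}(\lambda)}{-H^{*(1)}(0)+\frac{H^*(\lambda)}{\lambda}}+\frac1\lambda-\frac1\lambda H^*(\lambda)+H^{*(1)}(\lambda)-H^{*(1)}(0),$$ $$\boldsymbol E[A]=-2H^{*(1)}(0)+\frac1\lambda+H^{*(1)}(\lambda),$$ $$Var(A)=2H^{*(2)}(0)-2\{H^{*(1)}(0)\}^2+\frac{2H^*(\lambda)(1-H^*(\lambda))}{\lambda^2}+\frac{2H^*(\lambda)}{\lambda}\big[H^{*(1)}(0)+H^{*(1)}(\lambda)\big]+\frac1{\lambda^2}-H^{*(2)}(\lambda)-\frac2\lambda H^{*(1)}(\lambda)-\{H^{*(1)}(\lambda)\}^2 .$$ **M/G/1/1/preemptive**, for every $H$: $$\boldsymbol E[\Delta]=\frac1{\lambda H^*(\lambda)},\quad \boldsymbol E[A]=\frac{-H^{*(1)}(\lambda)}{H^*(\lambda)}+\frac1{\lambda H^*(\lambda)},$$ $$Var(A)=\frac{H^{*(2)}(\lambda)}{H^*(\lambda)}-\frac{\{H^{*(1)}(\lambda)\}^2}{H^*(\lambda)^2}+\frac1{\lambda^2H^*(\lambda)^2}+\frac{2H^{*(1)}(\lambda)}{\lambda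 H^*(\lambda)^2}.$$ If $H$ is exponential with rate $\mu>0$, then $\big(\boldsymbol E[\Delta],\boldsymbol E[A],Var(A)\big)$ are * M/M/1/1: $\frac1\lambda+\frac2\mu-\frac1{\lambda+\mu}$, $\ \frac1\lambda+\frac2\mu$, $\ \frac1{\lambda^2}+\frac2{\mu^2}$; * M/M/1/2\*: $\frac1\lambda+\frac2\mu+\frac\lambda{(\lambda+\mu)^2}+\frac1{\lambda+\mu}-\frac{2(\lambda+\mu)}{\lambda^2+\lambda\mu+\mu^2}$, $\ \frac1\mu+\frac1\lambda+\frac\lambda{(\mu+\lambda)^2}+\frac\lambda{\mu(\mu+\lambda)}$, $\ \frac1{\lambda^2}+\frac2{\mu^2}-\frac{2\lambda^2+4\lambda\mu+3\mu^2}{(\lambda+\mu)^4}$; * M/M/1/1/preemptive: $\frac1\mu+\frac1\lambda$, $\ \frac1{\mu+\lambda}+\frac1\mu+\frac1\lambda$, $\ \frac1{(\lambda+\mu)^2}+\frac1{\lambda^2}+\frac1{\mu^2}$. -/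

import Mathlib

open MeasureTheory ProbabilityTheory Filter Topology

namespace AgeOfInformation

noncomputable section

/-! ### Input: Poisson arrivals and i.i.d. service times -/

/-- The input of the queues on the probability space `(Ω, P)`. Packets `0, 1, 2, …` are generated by
a Poisson process of rate `lam`, given by its i.i.d. exponential inter-arrival times `T n` (`T 0` is
the time of the first arrival). Packet `n` has service time `H n`; the service times are positive,
i.i.d., and independent of the arrival process. -/
structure IsQueueInput {Ω : Type*} [MeasurableSpace Ω] (P : Measure Ω) (lam : ℝ)
    (T H : ℕ → Ω → ℝ) : Prop where
  measurable_interarrival : ∀ n, Measurable (T n)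
  measurable_service : ∀ n, Measurable (H n)
  indep : iIndepFun (Sum.elim T H) P
  law_interarrival : ∀ n, P.map (T n) = expMeasure lam
  identDistrib_service : ∀ n, IdentDistrib (H n) (H 0) P P
  service_pos : ∀ᵐ ω ∂P, 0 < H 0 ω

/-- The `n`-th derivative `X^{*(n)}(s)` of the Laplace-Stieltjes transform `X^*(s) = E[exp (-s X)]`
on the half-line `[0, ∞)`, on which the transform of a nonnegative variable is defined
(one-sided at `s = 0`); `n = 0` is the transform itself. -/
def lstDeriv {Ω : Type*} [MeasurableSpace Ω] (P : Measure Ω) (X : Ω → ℝ) (n : ℕ) (s : ℝ) : ℝ :=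
  iteratedDerivWithin n (fun u : ℝ => ∫ ω, Real.exp (-u * X ω) ∂P) (Set.Ici 0) s

/-! ### The three queues, along one realization `T H : ℕ → ℝ` -/

/-- The three single-server systems: `blocking` is M/G/1/1 (a packet that finds the server busy is
rejected), `replacement` is M/G/1/2* (one waiting place, which always holds the most recent packet),
`preemptive` is M/G/1/1/preemptive (a new packet takes over the server, the packet in service is
discarded). All systems are empty at time `0`. -/
inductive System
  | blocking
  | replacement
  | preemptive

/-- Generation (= arrival) time of packet `n`. -/
def arrival (T : ℕ → ℝ) (n : ℕ) : ℝ := ∑ i ∈ Finset.range (n + 1), T i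

/-- M/G/1/1: the time at which the server is done with all the packets it has accepted among
`0, …, n - 1`. Packet `n` is accepted if it does not arrive before that time, and then its service
starts at once. -/
def freeTimeBlocking (T H : ℕ → ℝ) : ℕ → ℝ
  | 0 => 0
  | n + 1 =>
    if freeTimeBlocking T H n ≤ arrival T n then arrival T n + H n else freeTimeBlocking T H n

/-- M/G/1/2*: the time from which the server is available to packet `n`, that is, the end of the
last service that starts before the arrival of packet `n` (`0` if there is none). If packet `n`
arrives before that time, it waits in the buffer; it is replaced, and never served, if packet
`n + 1` also arrives before that time. Otherwise its service starts at the later one of its arrival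
and that time. -/
def freeTimeReplacement (T H : ℕ → ℝ) : ℕ → ℝ
  | 0 => 0
  | n + 1 =>
    if freeTimeReplacement T H n ≤ arrival T (n + 1) then
      max (arrival T n) (freeTimeReplacement T H n) + H n
    else freeTimeReplacement T H n

/-- Packet `n` is informative: its service gets completed. -/
def Informative : System → (T H : ℕ → ℝ) → ℕ → Prop
  | .blocking, T, H, n => freeTimeBlocking T H n ≤ arrival T n
  | .replacement, T, H, n => freeTimeReplacement T H n ≤ arrival T (n + 1)
  | .preemptive, T, H, n => arrival T n + H n ≤ arrival T (n + 1)

/-- Completion time of packet `n` (used for informative packets only). -/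
def completion : System → (T H : ℕ → ℝ) → ℕ → ℝ
  | .blocking, T, H, n => arrival T n + H n
  | .replacement, T, H, n => max (arrival T n) (freeTimeReplacement T H n) + H n
  | .preemptive, T, H, n => arrival T n + H n

/-- The age `Δ(t)`: the time elapsed since the generation of the most recently generated packet
whose service is completed by time `t`. Before the first completion the age is counted from
time `0`. -/
def age (S : System) (T H : ℕ → ℝ) (t : ℝ) : ℝ :=
  t - sSup (insert 0 {r : ℝ | ∃ n, Informative S T H n ∧ completion S T H n ≤ t ∧ r = arrival T n})

/-- The `l`-th peak of the age (`l = 0, 1, 2, …`): the value of the age just before the completion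
of the `l`-th informative packet. -/
def peak (S : System) (T H : ℕ → ℝ) (l : ℕ) : ℝ :=
  Function.leftLim (age S T H) (completion S T H (Nat.nth (Informative S T H) l))

/-! ### Information freshness metrics -/

/-- The age process `Δ` and the sequence `A` of its peaks have AoI `aoi = E[Δ]`, PAoI `paoi = E[A]`
and variance of peak age `var = Var(A)`. -/
structure HasMetrics {Ω : Type*} [MeasurableSpace Ω] (P : Measure Ω) [IsProbabilityMeasure P]
    (Δ : ℝ → Ω → ℝ) (A : ℕ → Ω → ℝ) (aoi paoi var : ℝ) : Prop where
  integrable_age : ∀ t, 0 ≤ t → Integrable (Δ t) P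
  /-- the time-average age is almost surely `aoi` -/
  aoi_timeAverage : ∀ᵐ ω ∂P,
    Tendsto (fun τ : ℝ => τ⁻¹ * ∫ t in (0 : ℝ)..τ, Δ t ω) atTop (𝓝 aoi)
  /-- the time average of the expected age is `aoi` -/
  aoi_meanAverage :
    Tendsto (fun τ : ℝ => τ⁻¹ * ∫ t in (0 : ℝ)..τ, (∫ ω, Δ t ω ∂P)) atTop (𝓝 aoi)
  /-- the limit of the expected age, where it exists (ergodicity), is `aoi` -/
  aoi_limit : ∀ a : ℝ, Tendsto (fun t : ℝ => ∫ ω, Δ t ω ∂P) atTop (𝓝 a) → a = aoi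
  memLp_peak : ∀ l, MemLp (A l) 2 P
  /-- the average peak is almost surely `paoi` -/
  paoi_average : ∀ᵐ ω ∂P,
    Tendsto (fun k : ℕ => (k : ℝ)⁻¹ * ∑ l ∈ Finset.range k, A l ω) atTop (𝓝 paoi)
  paoi_limit : Tendsto (fun l => ∫ ω, A l ω ∂P) atTop (𝓝 paoi)
  var_limit : Tendsto (fun l => variance (A l) P) atTop (𝓝 var)
  /-- the peaks have a limit distribution, with mean `paoi` and variance `var` -/
  peak_limit : ∃ ν : ProbabilityMeasure ℝ,
    TendstoInDistribution A atTop (fun x : ℝ => x) (fun _ => P) (ν : Measure ℝ) ∧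
    MemLp (fun x : ℝ => x) 2 (ν : Measure ℝ) ∧
    ∫ x, x ∂(ν : Measure ℝ) = paoi ∧ variance (fun x : ℝ => x) (ν : Measure ℝ) = var

/-- System `S` with input `T`, `H` has AoI `aoi`, PAoI `paoi` and variance of peak age `var`. -/
def SystemHasMetrics {Ω : Type*} [MeasurableSpace Ω] (P : Measure Ω) [IsProbabilityMeasure P]
    (T H : ℕ → Ω → ℝ) (S : System) (aoi paoi var : ℝ) : Prop :=
  HasMetrics P (fun t ω => age S (fun n => T n ω) (fun n => H n ω) t)
    (fun l ω => peak S (fun n => T n ω) (fun n => H n ω) l) aoi paoi var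

end

end AgeOfInformation

namespace AgeOfInformation

open scoped ENNReal

set_option linter.unusedSectionVars false

/-! All three systems share one mechanism. Between two completions the age grows with slope one,
starting from the system time `B` of the packet just completed. A gap of length `G` therefore
contributes the area `B * G + G ^ 2 / 2` and ends in a peak `B + G`. By a renewal-reward argument
the AoI is the mean area divided by the mean gap, and all metrics reduce to moments of a few
variables.

`IsBlockSystem` isolates what is needed of a system: i.i.d. blocks `Z l` such that system times and
gaps are sums of one function of `Z l` and one of `Z (l + 1)`. Areas and peaks then depend on three
consecutive blocks, and the strong law holds along each residue class modulo 3
(`tendsto_sum_div_of_three`). `tendsto_inv_mul_of_tendsto_div` passes from completion times to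
continuous time. For the averaged expectation, the area up to `τ` is dominated by the area up to a
completion whose index is proportional to `τ`, except when that many completions occur by `τ`; since
completions are not faster than arrivals, `measureReal_arrival_le` makes this exponentially
unlikely. The outcome is `systemHasMetrics_of_moments`.

The blocks are i.i.d. because the exponential law is memoryless. Each system runs races of
inter-arrival times against a threshold (a residual or a full service time). The state at the first
won race is independent of the remaining input, whose first inter-arrival time is cut by the
threshold, and that remaining input has the original law (`iidLaw_finalState_restInput`). Iterating
gives i.i.d. blocks (`IsRegeneration.measurePreserving_blocks`). The lemmas `blocking_path`,
`replacement_path` and `preemptive_path` match the queue recursions with these races.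

It remains to compute moments. For M/G/1/1 a block is a fresh pair of inter-arrival and service
time. For M/G/1/2* the waiting time has the law of `T` on `T < H` and `0` elsewhere
(`map_replacementBlock_wait`): the last arrival before `h` precedes `h - d` exactly when no arrival
falls in `[h - d, h)`. For the preemptive system a first-step decomposition
(`measurePreserving_preemptionStep`) gives renewal equations with factor `1 - H*(λ) < 1`; truncation
shows that their solutions are integrable without moment assumptions on `H`
(`integrable_preemptionLaw`). Finally the moments `E[H ^ k * exp (-s H)]` are, up to sign, the
derivatives of the transform. -/

/-! ### The age along one realization -/

/-- `I` enumerates the informative packets of `S` in increasing order, and these are completed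
one after the other. -/
structure IsEnumeration (S : System) (T H : ℕ → ℝ) (I : ℕ → ℕ) : Prop where
  strictMono : StrictMono I
  range_eq : Set.range I = {n | Informative S T H n}
  interarrival_pos : ∀ n, 0 < T n
  arrival_le : ∀ l, arrival T (I l) ≤ completion S T H (I l)
  completion_lt : ∀ l, completion S T H (I l) < completion S T H (I (l + 1))

lemma arrival_succ (T : ℕ → ℝ) (n : ℕ) : arrival T (n + 1) = arrival T n + T (n + 1) := by
  simp [arrival, Finset.sum_range_succ]

lemma arrival_strictMono {T : ℕ → ℝ} (hT : ∀ n, 0 < T n) : StrictMono (arrival T) :=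
  strictMono_nat_of_lt_succ fun n => by rw [arrival_succ]; linarith [hT (n + 1)]

lemma arrival_pos {T : ℕ → ℝ} (hT : ∀ n, 0 < T n) (n : ℕ) : 0 < arrival T n :=
  Finset.sum_pos (fun i _ => hT i) ⟨0, by simp⟩

namespace IsEnumeration

variable {S : System} {T H : ℕ → ℝ} {I : ℕ → ℕ}

/-- A strictly increasing sequence of naturals is determined by its range. This turns the `Nat.nth`
in `peak` into the explicit index. -/
lemma nth_eq (h : IsEnumeration S T H I) (l : ℕ) : Nat.nth (Informative S T H) l = I l := by
  have hinf : {n | Informative S T H n}.Infinite := by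
    have := Set.infinite_range_of_injective h.strictMono.injective
    rwa [h.range_eq] at this
  have h1 : StrictMono (Nat.nth (Informative S T H)) := Nat.nth_strictMono hinf
  have h2 : Set.range (Nat.nth (Informative S T H)) = Set.range I := by
    rw [Nat.range_nth_of_infinite hinf, h.range_eq]
  exact congrFun ((h1.range_inj h.strictMono).1 h2) l

lemma completion_strictMono (h : IsEnumeration S T H I) :
    StrictMono fun l => completion S T H (I l) :=
  strictMono_nat_of_lt_succ h.completion_lt

/-- Strict monotonicity forces `l ≤ I l`. This comparison lets a tail bound on arrivals control the
number of completions. -/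
lemma arrival_le_completion (h : IsEnumeration S T H I) (l : ℕ) :
    arrival T l ≤ completion S T H (I l) :=
  ((arrival_strictMono h.interarrival_pos).monotone h.strictMono.le_apply).trans (h.arrival_le l)

lemma completion_pos (h : IsEnumeration S T H I) (l : ℕ) : 0 < completion S T H (I l) :=
  (arrival_pos h.interarrival_pos _).trans_le (h.arrival_le l)

/-- The generation times of the packets completed by time `t`. -/
lemma generation_set_eq (h : IsEnumeration S T H I) (t : ℝ) :
    {r : ℝ | ∃ n, Informative S T H n ∧ completion S T H n ≤ t ∧ r = arrival T n} =
      {r : ℝ | ∃ l, completion S T H (I l) ≤ t ∧ r = arrival T (I l)} := by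
  ext r
  constructor
  · rintro ⟨n, hn, hc, hr⟩
    have : n ∈ Set.range I := by rw [h.range_eq]; exact hn
    obtain ⟨l, rfl⟩ := this
    exact ⟨l, hc, hr⟩
  · rintro ⟨l, hc, hr⟩
    have : I l ∈ {n | Informative S T H n} := by rw [← h.range_eq]; exact ⟨l, rfl⟩
    exact ⟨I l, this, hc, hr⟩

lemma age_of_lt (h : IsEnumeration S T H I) {t : ℝ} (ht : t < completion S T H (I 0)) :
    age S T H t = t := by
  have : {r : ℝ | ∃ l, completion S T H (I l) ≤ t ∧ r = arrival T (I l)} = ∅ := by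
    ext r
    simp only [Set.mem_ofPred_eq, Set.mem_empty_iff_false, iff_false, not_exists, not_and]
    intro l hl
    have := h.completion_strictMono.monotone (Nat.zero_le l)
    exact absurd (this.trans hl) (not_le.2 ht)
  rw [age, h.generation_set_eq, this]
  simp

lemma age_of_mem (h : IsEnumeration S T H I) {t : ℝ} {l : ℕ} (ht : completion S T H (I l) ≤ t)
    (ht' : t < completion S T H (I (l + 1))) : age S T H t = t - arrival T (I l) := by
  rw [age, h.generation_set_eq]
  congr 1
  apply IsGreatest.csSup_eq
  refine ⟨Or.inr ⟨l, ht, rfl⟩, ?_⟩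
  rintro r (rfl | ⟨k, hk, rfl⟩)
  · exact (arrival_pos h.interarrival_pos _).le
  · have : k < l + 1 := h.completion_strictMono.lt_iff_lt.1 (hk.trans_lt ht')
    exact (arrival_strictMono h.interarrival_pos).monotone (h.strictMono.monotone (by omega))

lemma bddAbove_generation (h : IsEnumeration S T H I) (t : ℝ) : max t 0 ∈ upperBounds
    (insert 0 {r : ℝ | ∃ l, completion S T H (I l) ≤ t ∧ r = arrival T (I l)}) := by
  rintro r (rfl | ⟨k, hk, rfl⟩)
  · exact le_max_right _ _
  · exact ((h.arrival_le k).trans hk).trans (le_max_left _ _)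

lemma age_nonneg (h : IsEnumeration S T H I) {t : ℝ} (ht : 0 ≤ t) : 0 ≤ age S T H t := by
  rw [age, h.generation_set_eq, sub_nonneg]
  have := csSup_le ⟨0, Set.mem_insert _ _⟩ (h.bddAbove_generation t)
  rwa [max_eq_left ht] at this

lemma age_le (h : IsEnumeration S T H I) (t : ℝ) : age S T H t ≤ t := by
  rw [age, h.generation_set_eq, sub_le_self_iff]
  exact le_csSup ⟨_, h.bddAbove_generation t⟩ (Set.mem_insert _ _)

/-- More packets are completed as time goes on, so the supremum is over a larger set. Monotonicity
yields interval integrability of the age without examining its jumps. -/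
lemma monotone_sub_age (h : IsEnumeration S T H I) : Monotone fun t => t - age S T H t := by
  intro s t hst
  simp only [age, h.generation_set_eq, sub_sub_cancel]
  refine csSup_le_csSup ⟨_, h.bddAbove_generation t⟩ ⟨0, Set.mem_insert _ _⟩
    (Set.insert_subset_insert ?_)
  rintro r ⟨l, hl, hr⟩
  exact ⟨l, hl.trans hst, hr⟩

lemma intervalIntegrable_age (h : IsEnumeration S T H I) (a b : ℝ) :
    IntervalIntegrable (age S T H) volume a b := by
  have h1 : IntervalIntegrable (fun t => t - age S T H t) volume a b :=
    h.monotone_sub_age.intervalIntegrable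
  have h2 : IntervalIntegrable (fun t : ℝ => t) volume a b := continuous_id.intervalIntegrable a b
  simpa using h2.sub h1

lemma peak_zero (h : IsEnumeration S T H I) : peak S T H 0 = completion S T H (I 0) := by
  rw [peak, h.nth_eq]
  refine leftLim_eq_of_tendsto ?_
  refine (tendsto_nhdsWithin_of_tendsto_nhds tendsto_id).congr' ?_
  filter_upwards [self_mem_nhdsWithin] with t ht
  exact (h.age_of_lt ht).symm

lemma peak_succ (h : IsEnumeration S T H I) (l : ℕ) :
    peak S T H (l + 1) = completion S T H (I (l + 1)) - arrival T (I l) := by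
  rw [peak, h.nth_eq]
  refine leftLim_eq_of_tendsto ?_
  have : Tendsto (fun t => t - arrival T (I l)) (𝓝[<] completion S T H (I (l + 1)))
      (𝓝 (completion S T H (I (l + 1)) - arrival T (I l))) :=
    tendsto_nhdsWithin_of_tendsto_nhds ((continuous_id.sub continuous_const).tendsto _)
  refine this.congr' ?_
  filter_upwards [Ioo_mem_nhdsLT (h.completion_lt l)] with t ht
  exact (h.age_of_mem ht.1.le ht.2).symm

lemma integral_age_zero (h : IsEnumeration S T H I) :
    ∫ t in (0 : ℝ)..completion S T H (I 0), age S T H t = completion S T H (I 0) ^ 2 / 2 := by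
  rw [intervalIntegral.integral_congr_ae (g := fun t => t)]
  · simp
  · have : ∀ᵐ t : ℝ, t ≠ completion S T H (I 0) := by simp [ae_iff]
    filter_upwards [this] with t ht hmem
    rw [Set.uIoc_of_le (h.completion_pos 0).le] at hmem
    exact h.age_of_lt (lt_of_le_of_ne hmem.2 ht)

/-- The region under the age is a rectangle whose height is the system time, topped by a triangle of
slope one. -/
lemma integral_age_succ (h : IsEnumeration S T H I) (l : ℕ) :
    ∫ t in completion S T H (I l)..completion S T H (I (l + 1)), age S T H t =
      (completion S T H (I l) - arrival T (I l)) *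
        (completion S T H (I (l + 1)) - completion S T H (I l)) +
      (completion S T H (I (l + 1)) - completion S T H (I l)) ^ 2 / 2 := by
  rw [intervalIntegral.integral_congr_ae (g := fun t => t - arrival T (I l))]
  · rw [intervalIntegral.integral_sub (f := fun t => t) intervalIntegral.intervalIntegrable_id
      _root_.intervalIntegrable_const, integral_id, intervalIntegral.integral_const, smul_eq_mul]
    ring
  · have : ∀ᵐ t : ℝ, t ≠ completion S T H (I (l + 1)) := by simp [ae_iff]
    filter_upwards [this] with t ht hmem
    rw [Set.uIoc_of_le (h.completion_lt l).le] at hmem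
    exact h.age_of_mem hmem.1.le (lt_of_le_of_ne hmem.2 ht)

/-- The area under the age up to the `l`-th completion. -/
lemma integral_age (h : IsEnumeration S T H I) (l : ℕ) :
    ∫ t in (0 : ℝ)..completion S T H (I l), age S T H t =
      completion S T H (I 0) ^ 2 / 2 + ∑ k ∈ Finset.range l,
        ((completion S T H (I k) - arrival T (I k)) *
          (completion S T H (I (k + 1)) - completion S T H (I k)) +
        (completion S T H (I (k + 1)) - completion S T H (I k)) ^ 2 / 2) := by
  induction l with
  | zero => simp [h.integral_age_zero]
  | succ l ih =>
    rw [Finset.sum_range_succ, ← add_assoc, ← ih, ← h.integral_age_succ]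
    exact (intervalIntegral.integral_add_adjacent_intervals (h.intervalIntegrable_age _ _)
      (h.intervalIntegrable_age _ _)).symm

/-- The age in terms of a countable supremum. -/
lemma age_eq_iSup (h : IsEnumeration S T H I) (t : ℝ) :
    age S T H t = t - ⨆ l, if completion S T H (I l) ≤ t then arrival T (I l) else 0 := by
  rw [age, h.generation_set_eq]
  congr 1
  have hb := h.bddAbove_generation t
  have hmem : ∀ l, (if completion S T H (I l) ≤ t then arrival T (I l) else 0) ∈
      insert 0 {r : ℝ | ∃ l, completion S T H (I l) ≤ t ∧ r = arrival T (I l)} := by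
    intro l
    split_ifs with hl
    · exact Or.inr ⟨l, hl, rfl⟩
    · exact Or.inl rfl
  have hbdd : BddAbove (Set.range fun l =>
      if completion S T H (I l) ≤ t then arrival T (I l) else 0) := by
    refine ⟨max t 0, ?_⟩
    rintro _ ⟨l, rfl⟩
    exact hb (hmem l)
  have hpos := fun l => (arrival_pos h.interarrival_pos (I l)).le
  apply le_antisymm
  · refine csSup_le ⟨0, Set.mem_insert _ _⟩ ?_
    rintro r (rfl | ⟨l, hl, rfl⟩)
    · refine le_trans ?_ (le_ciSup hbdd 0)
      split_ifs
      exacts [hpos 0, le_rfl]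
    · exact le_trans (by simp [hl]) (le_ciSup hbdd l)
  · exact ciSup_le fun l => le_csSup ⟨_, hb⟩ (hmem l)

end IsEnumeration

/-! ### Averages of sequences -/

/-- One term does not affect the limit of averages. This removes the initial terms, which do not
follow the stationary block formula. -/
lemma tendsto_sum_div_of_succ {a : ℕ → ℝ} {c : ℝ}
    (h : Tendsto (fun n : ℕ => (∑ k ∈ Finset.range n, a (k + 1)) / n) atTop (𝓝 c)) :
    Tendsto (fun n : ℕ => (∑ k ∈ Finset.range n, a k) / n) atTop (𝓝 c) := by
  rw [← tendsto_add_atTop_iff_nat 1]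
  have h1 : Tendsto (fun n : ℕ => (n : ℝ) / (n + 1)) atTop (𝓝 1) :=
    tendsto_natCast_div_add_atTop 1
  have h2 : Tendsto (fun n : ℕ => a 0 / ((n : ℝ) + 1)) atTop (𝓝 0) :=
    tendsto_const_nhds.div_atTop (tendsto_natCast_atTop_atTop.atTop_add tendsto_const_nhds)
  have h3 := (h.mul h1).add h2
  rw [mul_one, add_zero] at h3
  refine h3.congr' ?_
  filter_upwards [eventually_gt_atTop 0] with n hn
  have : (n : ℝ) ≠ 0 := by positivity
  rw [Finset.sum_range_succ', Nat.cast_succ]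
  field_simp

/-- The number of `l < n` with `l ≡ j` modulo 3 is `(n + 2 - j) / 3` for `j < 3`. -/
lemma sum_range_eq_sum_residues (a : ℕ → ℝ) (n : ℕ) :
    ∑ l ∈ Finset.range n, a l = ∑ j ∈ Finset.range 3,
      ∑ k ∈ Finset.range ((n + 2 - j) / 3), a (3 * k + j) := by
  induction n with
  | zero => simp [Finset.sum_range_succ]
  | succ n ih =>
    rw [Finset.sum_range_succ, ih]
    obtain ⟨m, hm⟩ : ∃ m, n = 3 * m ∨ n = 3 * m + 1 ∨ n = 3 * m + 2 := ⟨n / 3, by omega⟩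
    simp only [Finset.sum_range_succ, Finset.sum_range_zero]
    rcases hm with rfl | rfl | rfl
    · rw [show (3 * m + 2 - 0) / 3 = m by omega, show (3 * m + 2 - 1) / 3 = m by omega,
        show (3 * m + 2 - 2) / 3 = m by omega, show (3 * m + 1 + 2 - 0) / 3 = m + 1 by omega,
        show (3 * m + 1 + 2 - 1) / 3 = m by omega, show (3 * m + 1 + 2 - 2) / 3 = m by omega,
        Finset.sum_range_succ]
      simp only [add_zero]
      ring
    · rw [show (3 * m + 1 + 2 - 0) / 3 = m + 1 by omega, show (3 * m + 1 + 2 - 1) / 3 = m by omega,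
        show (3 * m + 1 + 2 - 2) / 3 = m by omega,
        show (3 * m + 1 + 1 + 2 - 0) / 3 = m + 1 by omega,
        show (3 * m + 1 + 1 + 2 - 1) / 3 = m + 1 by omega,
        show (3 * m + 1 + 1 + 2 - 2) / 3 = m by omega,
        Finset.sum_range_succ (fun k => a (3 * k + 1))]
      ring
    · rw [show (3 * m + 2 + 2 - 0) / 3 = m + 1 by omega,
        show (3 * m + 2 + 2 - 1) / 3 = m + 1 by omega,
        show (3 * m + 2 + 2 - 2) / 3 = m by omega,
        show (3 * m + 2 + 1 + 2 - 0) / 3 = m + 1 by omega,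
        show (3 * m + 2 + 1 + 2 - 1) / 3 = m + 1 by omega,
        show (3 * m + 2 + 1 + 2 - 2) / 3 = m + 1 by omega,
        Finset.sum_range_succ (fun k => a (3 * k + 2))]
      ring

lemma tendsto_div_three (j : ℕ) (hj : j < 3) :
    Tendsto (fun n : ℕ => (((n + 2 - j) / 3 : ℕ) : ℝ) / n) atTop (𝓝 (1 / 3)) := by
  have h1 : Tendsto (fun n : ℕ => (1 : ℝ) / 3 - 1 / n) atTop (𝓝 (1 / 3)) := by
    simpa using tendsto_const_nhds.sub (tendsto_one_div_atTop_nhds_zero_nat (𝕜 := ℝ))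
  have h2 : Tendsto (fun n : ℕ => (1 : ℝ) / 3 + 1 / n) atTop (𝓝 (1 / 3)) := by
    simpa using tendsto_const_nhds.add (tendsto_one_div_atTop_nhds_zero_nat (𝕜 := ℝ))
  refine tendsto_of_tendsto_of_tendsto_of_le_of_le' h1 h2 ?_ ?_
  · filter_upwards [eventually_gt_atTop 0] with n hn
    have hn' : (0 : ℝ) < n := by exact_mod_cast hn
    have : n ≤ 3 * ((n + 2 - j) / 3) + 3 := by omega
    have : (n : ℝ) ≤ 3 * (((n + 2 - j) / 3 : ℕ) : ℝ) + 3 := by exact_mod_cast this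
    rw [le_div_iff₀ hn', sub_mul, one_div_mul_cancel hn'.ne']
    linarith
  · filter_upwards [eventually_gt_atTop 0] with n hn
    have hn' : (0 : ℝ) < n := by exact_mod_cast hn
    have : 3 * ((n + 2 - j) / 3) ≤ n + 3 := by omega
    have : 3 * (((n + 2 - j) / 3 : ℕ) : ℝ) ≤ n + 3 := by exact_mod_cast this
    rw [div_le_iff₀ hn', add_mul, one_div_mul_cancel hn'.ne']
    linarith

lemma tendsto_sum_div_of_residues {a : ℕ → ℝ} {c : ℝ}
    (h : ∀ j < 3, Tendsto (fun n : ℕ => (∑ k ∈ Finset.range n, a (3 * k + j)) / n) atTop (𝓝 c)) :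
    Tendsto (fun n : ℕ => (∑ k ∈ Finset.range n, a k) / n) atTop (𝓝 c) := by
  have key : ∀ j ∈ Finset.range 3, Tendsto (fun n : ℕ =>
      (∑ k ∈ Finset.range ((n + 2 - j) / 3), a (3 * k + j)) / n) atTop (𝓝 (c * (1 / 3))) := by
    intro j hj
    have hj' := Finset.mem_range.1 hj
    have hinf : Tendsto (fun n : ℕ => (n + 2 - j) / 3) atTop atTop :=
      tendsto_atTop.2 fun b => by
        filter_upwards [eventually_ge_atTop (3 * b)] with n hn
        omega
    refine (((h j hj').comp hinf).mul (tendsto_div_three j hj')).congr' ?_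
    filter_upwards [eventually_ge_atTop 3] with n hn
    have : (((n + 2 - j) / 3 : ℕ) : ℝ) ≠ 0 := by
      have : 0 < (n + 2 - j) / 3 := by omega
      positivity
    simp only [Function.comp_apply]
    field_simp
  have := tendsto_finsetSum _ key
  have hc : ∑ _j ∈ Finset.range 3, c * (1 / 3) = c := by simp; ring
  rw [hc] at this
  refine this.congr fun n => ?_
  rw [sum_range_eq_sum_residues a n, Finset.sum_div]

/-- The time average of a nonnegative function with integral `F` is determined along a sequence
of times of linear growth. -/
lemma tendsto_inv_mul_of_tendsto_div {F : ℝ → ℝ} {C : ℕ → ℝ} {g q : ℝ}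
    (hF : ∀ s t, 0 ≤ s → s ≤ t → F s ≤ F t) (hF0 : 0 ≤ F 0) (hC : StrictMono C) (hC0 : 0 < C 0)
    (hg : 0 < g) (hCg : Tendsto (fun n : ℕ => C n / n) atTop (𝓝 g))
    (hFq : Tendsto (fun n : ℕ => F (C n) / n) atTop (𝓝 q)) :
    Tendsto (fun τ : ℝ => τ⁻¹ * F τ) atTop (𝓝 (q / g)) := by
  have hCtop : Tendsto C atTop atTop := by
    have := hCg.pos_mul_atTop hg tendsto_natCast_atTop_atTop
    refine this.congr' ?_
    filter_upwards [eventually_gt_atTop 0] with n hn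
    field_simp
  have hCpos : ∀ n, 0 < C n := fun n => hC0.trans_le (hC.monotone (Nat.zero_le n))
  -- `N τ` counts the last completion by time `τ`; before `C 0` its value is irrelevant.
  -- Monotonicity then brackets `F τ / τ` between `F (C N) / C (N + 1)` and `F (C (N + 1)) / C N`.
  have hex : ∀ τ : ℝ, ∃ n, C 0 ≤ τ → C n ≤ τ ∧ τ < C (n + 1) := by
    intro τ
    by_cases h0 : C 0 ≤ τ
    · classical
      have hne : ∃ n, τ < C n := ((hCtop.eventually_gt_atTop τ).exists)
      have hpos : Nat.find hne ≠ 0 := by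
        intro h
        have := Nat.find_spec hne
        rw [h] at this
        linarith
      obtain ⟨n, hn⟩ := Nat.exists_eq_succ_of_ne_zero hpos
      refine ⟨n, fun _ => ⟨?_, ?_⟩⟩
      · exact not_lt.1 (Nat.find_min hne (by omega))
      · have := Nat.find_spec hne
        rwa [hn] at this
    · exact ⟨0, fun h => absurd h h0⟩
  choose N hN using hex
  have hNtop : Tendsto N atTop atTop := tendsto_atTop.2 fun b => by
    filter_upwards [eventually_ge_atTop (C b)] with τ hτ
    have := hN τ ((hC.monotone (Nat.zero_le b)).trans hτ)
    have := hC.lt_iff_lt.1 (hτ.trans_lt this.2)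
    omega
  have hCg' : Tendsto (fun n : ℕ => C (n + 1) / n) atTop (𝓝 g) := by
    have h1 : Tendsto (fun n : ℕ => C (n + 1) / ((n + 1 : ℕ) : ℝ)) atTop (𝓝 g) :=
      hCg.comp (tendsto_add_atTop_nat 1)
    have h2 : Tendsto (fun n : ℕ => ((n : ℝ) / (n + 1))⁻¹) atTop (𝓝 1⁻¹) :=
      (tendsto_natCast_div_add_atTop (1 : ℝ)).inv₀ one_ne_zero
    have h3 := h1.mul h2
    rw [inv_one, mul_one] at h3
    refine h3.congr' ?_
    filter_upwards [eventually_gt_atTop 0] with n hn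
    push_cast
    field_simp
  have hFq' : Tendsto (fun n : ℕ => F (C (n + 1)) / n) atTop (𝓝 q) := by
    have h1 : Tendsto (fun n : ℕ => F (C (n + 1)) / ((n + 1 : ℕ) : ℝ)) atTop (𝓝 q) :=
      hFq.comp (tendsto_add_atTop_nat 1)
    have h2 : Tendsto (fun n : ℕ => ((n : ℝ) / (n + 1))⁻¹) atTop (𝓝 1⁻¹) :=
      (tendsto_natCast_div_add_atTop (1 : ℝ)).inv₀ one_ne_zero
    have h3 := h1.mul h2
    rw [inv_one, mul_one] at h3
    refine h3.congr' ?_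
    filter_upwards [eventually_gt_atTop 0] with n hn
    push_cast
    field_simp
  have hlow := ((hFq.div hCg' hg.ne').comp hNtop)
  have hup := ((hFq'.div hCg hg.ne').comp hNtop)
  have hFnonneg : ∀ t, 0 ≤ t → 0 ≤ F t := fun t ht => hF0.trans (hF 0 t le_rfl ht)
  refine tendsto_of_tendsto_of_tendsto_of_le_of_le' hlow hup ?_ ?_
  · filter_upwards [eventually_ge_atTop (C 0), hNtop.eventually_gt_atTop 0] with τ hτ hn
    have hnpos : (0 : ℝ) < N τ := by exact_mod_cast hn
    obtain ⟨h1, h2⟩ := hN τ hτ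
    have hτ0 : 0 < τ := hC0.trans_le hτ
    simp only [Function.comp_apply, Pi.div_apply]
    rw [div_div_div_cancel_right₀ hnpos.ne', inv_mul_eq_div]
    exact div_le_div₀ (hFnonneg _ hτ0.le) (hF _ _ (hCpos _).le h1) hτ0 h2.le
  · filter_upwards [eventually_ge_atTop (C 0), hNtop.eventually_gt_atTop 0] with τ hτ hn
    have hnpos : (0 : ℝ) < N τ := by exact_mod_cast hn
    obtain ⟨h1, h2⟩ := hN τ hτ
    have hτ0 : 0 < τ := hC0.trans_le hτ
    simp only [Function.comp_apply, Pi.div_apply]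
    rw [div_div_div_cancel_right₀ hnpos.ne', inv_mul_eq_div]
    exact div_le_div₀ (hFnonneg _ (hCpos _).le) (hF _ _ hτ0.le h2.le) (hCpos _) h1

/-- Continuous Cesàro averages of a converging function. -/
lemma tendsto_inv_mul_integral {f : ℝ → ℝ} {a : ℝ}
    (hf : ∀ τ : ℝ, 0 ≤ τ → IntervalIntegrable f volume 0 τ) (h : Tendsto f atTop (𝓝 a)) :
    Tendsto (fun τ : ℝ => τ⁻¹ * ∫ t in (0 : ℝ)..τ, f t) atTop (𝓝 a) := by
  rw [Metric.tendsto_atTop]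
  intro ε hε
  obtain ⟨M, hM⟩ := Metric.tendsto_atTop.1 h (ε / 2) (by positivity)
  set M' := max M 1
  set K := |∫ t in (0 : ℝ)..M', (f t - a)|
  -- The second bound keeps the initial part `K` below `τ * ε / 4`, while the remaining part
  -- contributes at most `τ * ε / 2`.
  refine ⟨max M' (4 * K / ε), fun τ hτ => ?_⟩
  have hτM : M' ≤ τ := (le_max_left _ _).trans hτ
  have hτ0 : 0 < τ := lt_of_lt_of_le (lt_of_lt_of_le one_pos (le_max_right M 1)) hτM
  have hτK : 4 * K ≤ τ * ε := by
    rw [← div_le_iff₀ hε]; exact (le_max_right _ _).trans hτ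
  have hM'pos : 0 < M' := lt_of_lt_of_le one_pos (le_max_right M 1)
  have hi : IntervalIntegrable f volume M' τ := (hf M' hM'pos.le).symm.trans (hf τ hτ0.le)
  have hc : ∀ s t, IntervalIntegrable (fun _ : ℝ => a) volume s t :=
    fun _ _ => _root_.intervalIntegrable_const
  have hsplit : ∫ t in (0 : ℝ)..τ, (f t - a) =
      (∫ t in (0 : ℝ)..M', (f t - a)) + ∫ t in M'..τ, (f t - a) :=
    (intervalIntegral.integral_add_adjacent_intervals ((hf _ hM'pos.le).sub (hc _ _))
      (hi.sub (hc _ _))).symm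
  have h2 : |∫ t in M'..τ, (f t - a)| ≤ ε / 2 * |τ - M'| := by
    rw [← Real.norm_eq_abs]
    refine intervalIntegral.norm_integral_le_of_norm_le_const fun t ht => ?_
    rw [Set.uIoc_of_le hτM] at ht
    exact (hM t ((le_max_left _ _).trans ht.1.le)).le
  rw [abs_of_nonneg (sub_nonneg.2 hτM)] at h2
  have h3 : τ⁻¹ * ∫ t in (0 : ℝ)..τ, f t = a + τ⁻¹ * ∫ t in (0 : ℝ)..τ, (f t - a) := by
    rw [intervalIntegral.integral_sub (hf _ hτ0.le) (hc _ _), intervalIntegral.integral_const,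
      smul_eq_mul]
    field_simp
    ring
  rw [h3, Real.dist_eq, add_sub_cancel_left, abs_mul, abs_of_pos (inv_pos.2 hτ0),
    inv_mul_lt_iff₀ hτ0, hsplit]
  calc _ ≤ K + ε / 2 * (τ - M') := (abs_add_le _ _).trans (by gcongr)
    _ < τ * ε := by nlinarith

/-- A version of dominated convergence with converging bounds. -/
lemma tendsto_integral_of_le {Ω : Type*} [MeasurableSpace Ω] {P : Measure Ω}
    [IsProbabilityMeasure P] {X Y : ℝ → Ω → ℝ} {c c' : ℝ}
    (hX : ∀ᶠ τ in atTop, AEStronglyMeasurable (X τ) P) (hY : ∀ᶠ τ in atTop, Integrable (Y τ) P)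
    (h0 : ∀ᶠ τ in atTop, ∀ᵐ ω ∂P, 0 ≤ X τ ω) (hXY : ∀ᶠ τ in atTop, ∀ᵐ ω ∂P, X τ ω ≤ Y τ ω)
    (hXc : ∀ᵐ ω ∂P, Tendsto (fun τ => X τ ω) atTop (𝓝 c))
    (hYc : ∀ᵐ ω ∂P, Tendsto (fun τ => Y τ ω) atTop (𝓝 c'))
    (hYi : Tendsto (fun τ => ∫ ω, Y τ ω ∂P) atTop (𝓝 c')) :
    Tendsto (fun τ => ∫ ω, X τ ω ∂P) atTop (𝓝 c) := by
  -- The truncation level lies above both limits, so truncating at `M` changes neither of them.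
  set M := max (max c c') 0 + 1
  have hM0 : 0 ≤ M := by positivity
  have hcM : c ≤ M := by
    have := le_max_left c c'; have := le_max_left (max c c') 0; simp only [M]; linarith
  have hcM' : c' ≤ M := by
    have := le_max_right c c'; have := le_max_left (max c c') 0; simp only [M]; linarith
  have trunc : ∀ {W : ℝ → Ω → ℝ} {w : ℝ}, w ≤ M →
      (∀ᶠ τ in atTop, AEStronglyMeasurable (W τ) P) → (∀ᶠ τ in atTop, ∀ᵐ ω ∂P, 0 ≤ W τ ω) →
      (∀ᵐ ω ∂P, Tendsto (fun τ => W τ ω) atTop (𝓝 w)) →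
      Tendsto (fun τ => ∫ ω, min (W τ ω) M ∂P) atTop (𝓝 w) := by
    intro W w hw hm hp hlim
    have : w = ∫ _ω : Ω, w ∂P := by simp
    conv => rhs; rw [this]
    refine tendsto_integral_filter_of_dominated_convergence (fun _ => M) ?_ ?_ (by simp) ?_
    · filter_upwards [hm] with τ h using h.inf aestronglyMeasurable_const
    · filter_upwards [hp] with τ h
      filter_upwards [h] with ω hω
      rw [Real.norm_eq_abs, abs_of_nonneg (le_min hω hM0)]
      exact min_le_right _ _
    · filter_upwards [hlim] with ω hω
      have := hω.min (tendsto_const_nhds (x := M))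
      rwa [min_eq_left hw] at this
  have hY0 : ∀ᶠ τ in atTop, ∀ᵐ ω ∂P, 0 ≤ Y τ ω := by
    filter_upwards [h0, hXY] with τ h1 h2
    filter_upwards [h1, h2] with ω h3 h4 using h3.trans h4
  have h1 := trunc hcM hX h0 hXc
  have h2 := trunc hcM' (hY.mono fun τ h => h.1) hY0 hYc
  -- Since `x - min x M` is monotone in `x`, the bound `X ≤ Y` gives `X ≤ min X M + (Y - min Y M)`,
  -- and the mean of the correction tends to `c' - c' = 0`.
  have h3 : Tendsto (fun τ => (∫ ω, min (X τ ω) M ∂P) +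
      ((∫ ω, Y τ ω ∂P) - ∫ ω, min (Y τ ω) M ∂P)) atTop (𝓝 c) := by
    have := h1.add (hYi.sub h2)
    simpa using this
  have hXint : ∀ᶠ τ in atTop, Integrable (X τ) P := by
    filter_upwards [hX, hY, h0, hXY] with τ m i p l
    refine i.mono' m ?_
    filter_upwards [p, l] with ω p l
    rwa [Real.norm_eq_abs, abs_of_nonneg p]
  have hmin : ∀ {W : Ω → ℝ}, Integrable W P → Integrable (fun ω => min (W ω) M) P :=
    fun hW => hW.inf (integrable_const M)
  refine tendsto_of_tendsto_of_tendsto_of_le_of_le' h1 h3 ?_ ?_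
  · filter_upwards [hXint] with τ hi
    exact integral_mono (hmin hi) hi fun ω => min_le_left _ _
  · filter_upwards [hXint, hY, hXY] with τ hi hy hle
    have hsub : Integrable (fun ω => Y τ ω - min (Y τ ω) M) P := hy.sub (hmin hy)
    rw [← integral_sub hy (hmin hy), ← integral_add (hmin hi) hsub]
    refine integral_mono_ae hi ((hmin hi).add hsub) ?_
    filter_upwards [hle] with ω h
    rcases le_total (X τ ω) M with h4 | h4 <;> rcases le_total (Y τ ω) M with h5 | h5 <;>
      simp only [min_eq_left, min_eq_right, h4, h5] <;> linarith

/-! ### Sequences of i.i.d. blocks -/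

lemma integral_comp_of_measurable {α β : Type*} [MeasurableSpace α] [MeasurableSpace β]
    {μ : Measure α} {ν : Measure β} {f : α → β} (hf : MeasurePreserving f μ ν) {g : β → ℝ}
    (hg : Measurable g) : ∫ x, g (f x) ∂μ = ∫ y, g y ∂ν := by
  rw [← hf.map_eq, integral_map hf.measurable.aemeasurable hg.aestronglyMeasurable]

section Blocks

variable {E : Type*} [MeasurableSpace E] (ρ : Measure E) [IsProbabilityMeasure ρ]

/-- The law of a sequence of i.i.d. random elements with law `ρ`. -/
noncomputable abbrev iidLaw : Measure (ℕ → E) := Measure.infinitePi fun _ : ℕ => ρ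

lemma measurePreserving_reindex {f : ℕ → ℕ} (hf : Function.Injective f) :
    MeasurePreserving (fun (z : ℕ → E) k => z (f k)) (iidLaw ρ) (iidLaw ρ) :=
  ⟨by fun_prop, Measure.map_infinitePi_infinitePi_of_inj hf⟩

lemma measurePreserving_shift (l : ℕ) :
    MeasurePreserving (fun (z : ℕ → E) k => z (l + k)) (iidLaw ρ) (iidLaw ρ) :=
  measurePreserving_reindex ρ (add_right_injective l)

lemma iIndepFun_eval : iIndepFun (fun (l : ℕ) (z : ℕ → E) => z l) (iidLaw ρ) :=
  iIndepFun_infinitePi (P := fun _ : ℕ => ρ) (X := fun _ x => x) (by fun_prop)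

/-- The strong law of large numbers for functions of three consecutive terms. -/
lemma tendsto_sum_div_of_three {F : E × E × E → ℝ} (hF : Measurable F)
    (hi : Integrable (fun z : ℕ → E => F (z 0, z 1, z 2)) (iidLaw ρ)) :
    ∀ᵐ z ∂iidLaw ρ, Tendsto (fun n : ℕ =>
      (∑ l ∈ Finset.range n, F (z l, z (l + 1), z (l + 2))) / n) atTop
      (𝓝 (∫ z, F (z 0, z 1, z 2) ∂iidLaw ρ)) := by
  have key : ∀ j < 3, ∀ᵐ z ∂iidLaw ρ, Tendsto (fun n : ℕ => (∑ k ∈ Finset.range n,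
      F (z (3 * k + j), z (3 * k + j + 1), z (3 * k + j + 2))) / n) atTop
      (𝓝 (∫ z, F (z 0, z 1, z 2) ∂iidLaw ρ)) := by
    intro j _
    have hlaw : ∀ l, MeasurePreserving (fun (z : ℕ → E) k => z (l + k)) (iidLaw ρ) (iidLaw ρ) :=
      measurePreserving_shift ρ
    have hF' : Measurable fun z : ℕ → E => F (z 0, z 1, z 2) := by fun_prop
    have h := strong_law_ae_real (μ := iidLaw ρ)
      (fun k z => F (z (3 * k + j), z (3 * k + j + 1), z (3 * k + j + 2)))
      ((hlaw (3 * 0 + j)).integrable_comp_of_integrable hi) ?_ ?_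
    · have he : (∫ z : ℕ → E, F (z (3 * 0 + j), z (3 * 0 + j + 1), z (3 * 0 + j + 2)) ∂iidLaw ρ)
          = ∫ z, F (z 0, z 1, z 2) ∂iidLaw ρ := by
        exact integral_comp_of_measurable (hlaw (3 * 0 + j)) hF'
      rwa [he] at h
    · intro a b hab
      -- With stride 3 the index triples for distinct `a` and `b` are disjoint, which makes the
      -- summands independent.
      have hind := (iIndepFun_eval ρ).indepFun_finset
        {3 * a + j, 3 * a + j + 1, 3 * a + j + 2} {3 * b + j, 3 * b + j + 1, 3 * b + j + 2} (by
          simp only [Finset.disjoint_insert_left, Finset.mem_insert, Finset.mem_singleton,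
            Finset.disjoint_singleton_left]
          omega) (by fun_prop)
      have hc : ∀ a, Measurable (fun y : ({3 * a + j, 3 * a + j + 1, 3 * a + j + 2} : Finset ℕ) → E
          => F (y ⟨3 * a + j, by simp⟩, y ⟨3 * a + j + 1, by simp⟩,
            y ⟨3 * a + j + 2, by simp⟩)) := fun a => by fun_prop
      exact hind.comp (hc a) (hc b)
    · intro k
      have h1 : ∀ k, MeasurePreserving (fun (z : ℕ → E) => F (z (3 * k + j), z (3 * k + j + 1),
          z (3 * k + j + 2))) (iidLaw ρ) ((iidLaw ρ).map fun z => F (z 0, z 1, z 2)) :=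
        fun k => (⟨hF', rfl⟩ : MeasurePreserving (fun z : ℕ → E => F (z 0, z 1, z 2)) (iidLaw ρ)
          _).comp (hlaw (3 * k + j))
      exact ⟨(h1 k).measurable.aemeasurable, (h1 0).measurable.aemeasurable,
        (h1 k).map_eq.trans (h1 0).map_eq.symm⟩
  have h3 : ∀ᵐ z ∂iidLaw ρ, ∀ j, j < 3 → Tendsto (fun n : ℕ => (∑ k ∈ Finset.range n,
      F (z (3 * k + j), z (3 * k + j + 1), z (3 * k + j + 2))) / n) atTop
      (𝓝 (∫ z, F (z 0, z 1, z 2) ∂iidLaw ρ)) := by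
    rw [ae_all_iff]
    intro j
    by_cases hj : j < 3
    · filter_upwards [key j hj] with z hz _ using hz
    · exact Eventually.of_forall fun z h => absurd h hj
  filter_upwards [h3] with z hz
  exact tendsto_sum_div_of_residues (a := fun l => F (z l, z (l + 1), z (l + 2))) hz

end Blocks

/-! ### Systems driven by i.i.d. blocks, and their time-average age. -/

/-- The block decomposition of the system `S`. The blocks `Z l` are i.i.d. with law `ρ`; the system
time of the packet completed at the end of block `l + 1` is `d (Z l) + s (Z (l + 1))`, and the time
between the completions `l` and `l + 1` is `i (Z l) + j (Z (l + 1))`. -/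
structure IsBlockSystem {Ω E : Type*} [MeasurableSpace Ω] [MeasurableSpace E] (P : Measure Ω)
    (T H : ℕ → Ω → ℝ) (S : System) (ρ : Measure E) [IsProbabilityMeasure ρ] (Z : Ω → ℕ → E)
    (d s i j : E → ℝ) (B₀ C₀ : Ω → ℝ) : Prop where
  measurePreserving : MeasurePreserving Z P (iidLaw ρ)
  measurable_d : Measurable d
  measurable_s : Measurable s
  measurable_i : Measurable i
  measurable_j : Measurable j
  measurable_B₀ : Measurable B₀
  measurable_C₀ : Measurable C₀
  memLp_d : MemLp d 2 ρ
  memLp_s : MemLp s 2 ρ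
  memLp_i : MemLp i 2 ρ
  memLp_j : MemLp j 2 ρ
  memLp_B₀ : MemLp B₀ 2 P
  memLp_C₀ : MemLp C₀ 2 P
  path : ∀ᵐ ω ∂P, ∃ I : ℕ → ℕ, IsEnumeration S (fun n => T n ω) (fun n => H n ω) I ∧
    completion S (fun n => T n ω) (fun n => H n ω) (I 0) = C₀ ω ∧
    completion S (fun n => T n ω) (fun n => H n ω) (I 0) - arrival (fun n => T n ω) (I 0) = B₀ ω ∧
    ∀ l, completion S (fun n => T n ω) (fun n => H n ω) (I (l + 1)) -
        arrival (fun n => T n ω) (I (l + 1)) = d (Z ω l) + s (Z ω (l + 1)) ∧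
      completion S (fun n => T n ω) (fun n => H n ω) (I (l + 1)) -
        completion S (fun n => T n ω) (fun n => H n ω) (I l) = i (Z ω l) + j (Z ω (l + 1))

namespace IsBlockSystem

variable {Ω E : Type*} [MeasurableSpace Ω] [MeasurableSpace E] {P : Measure Ω}
  {T H : ℕ → Ω → ℝ} {S : System} {ρ : Measure E} [IsProbabilityMeasure ρ] {Z : Ω → ℕ → E}
  {d s i j : E → ℝ} {B₀ C₀ : Ω → ℝ}

/-- The time between the completions `l` and `l + 1`. -/
def gap (Z : Ω → ℕ → E) (i j : E → ℝ) (l : ℕ) (ω : Ω) : ℝ := i (Z ω l) + j (Z ω (l + 1))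

/-- The system time of the `l`-th informative packet. -/
def systemTime (Z : Ω → ℕ → E) (d s : E → ℝ) (B₀ : Ω → ℝ) : ℕ → Ω → ℝ
  | 0, ω => B₀ ω
  | l + 1, ω => d (Z ω l) + s (Z ω (l + 1))

/-- The `l`-th completion time. -/
def completionTime (Z : Ω → ℕ → E) (i j : E → ℝ) (C₀ : Ω → ℝ) (l : ℕ) (ω : Ω) : ℝ :=
  C₀ ω + ∑ k ∈ Finset.range l, gap Z i j k ω

/-- The area under the age between two completions. -/
noncomputable def area (Z : Ω → ℕ → E) (d s i j : E → ℝ) (B₀ : Ω → ℝ) (l : ℕ) (ω : Ω) : ℝ :=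
  systemTime Z d s B₀ l ω * gap Z i j l ω + gap Z i j l ω ^ 2 / 2

/-- The area under the age up to the `l`-th completion. -/
noncomputable def totalArea (Z : Ω → ℕ → E) (d s i j : E → ℝ) (B₀ C₀ : Ω → ℝ) (l : ℕ) (ω : Ω) : ℝ :=
  C₀ ω ^ 2 / 2 + ∑ k ∈ Finset.range l, area Z d s i j B₀ k ω

/-- The stationary time between completions. -/
def gapFun (i j : E → ℝ) (z : ℕ → E) : ℝ := i (z 0) + j (z 1)

/-- The stationary area between completions. -/
noncomputable def areaFun (d s i j : E → ℝ) (z : ℕ → E) : ℝ :=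
  (d (z 0) + s (z 1)) * (i (z 1) + j (z 2)) + (i (z 1) + j (z 2)) ^ 2 / 2

/-- The stationary peak. -/
def peakFun (d s i j : E → ℝ) (z : ℕ → E) : ℝ :=
  d (z 0) + s (z 1) + (i (z 1) + j (z 2))

/-- The gaps telescope, so completion and arrival times become explicit functions of the blocks. All
later almost sure arguments start from this form. -/
lemma ae_path (h : IsBlockSystem P T H S ρ Z d s i j B₀ C₀) :
    ∀ᵐ ω ∂P, ∃ I : ℕ → ℕ, IsEnumeration S (fun n => T n ω) (fun n => H n ω) I ∧
      (∀ l, completion S (fun n => T n ω) (fun n => H n ω) (I l) = completionTime Z i j C₀ l ω) ∧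
      ∀ l, arrival (fun n => T n ω) (I l) =
        completionTime Z i j C₀ l ω - systemTime Z d s B₀ l ω := by
  filter_upwards [h.path] with ω ⟨I, hI, h0, hB, hs⟩
  have hC : ∀ l, completion S (fun n => T n ω) (fun n => H n ω) (I l) =
      completionTime Z i j C₀ l ω := by
    intro l
    induction l with
    | zero => simp [completionTime, h0]
    | succ l ih =>
      have := (hs l).2
      rw [completionTime, Finset.sum_range_succ, ← add_assoc]
      rw [completionTime] at ih
      rw [← ih, gap]
      linarith
  refine ⟨I, hI, hC, fun l => ?_⟩
  rw [← hC]
  cases l with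
  | zero => rw [systemTime, ← hB]; ring
  | succ l => rw [systemTime, ← (hs l).1]; ring

section Measurability

lemma measurable_coord (h : IsBlockSystem P T H S ρ Z d s i j B₀ C₀) (l : ℕ) :
    Measurable fun ω => Z ω l := (measurable_pi_apply l).comp h.measurePreserving.measurable

lemma measurable_gap (h : IsBlockSystem P T H S ρ Z d s i j B₀ C₀) (l : ℕ) :
    Measurable (gap Z i j l) :=
  (h.measurable_i.comp (h.measurable_coord l)).add (h.measurable_j.comp (h.measurable_coord _))

lemma measurable_systemTime (h : IsBlockSystem P T H S ρ Z d s i j B₀ C₀) (l : ℕ) :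
    Measurable (systemTime Z d s B₀ l) := by
  cases l with
  | zero => exact h.measurable_B₀
  | succ l =>
    exact (h.measurable_d.comp (h.measurable_coord l)).add
      (h.measurable_s.comp (h.measurable_coord _))

lemma measurable_completionTime (h : IsBlockSystem P T H S ρ Z d s i j B₀ C₀) (l : ℕ) :
    Measurable (completionTime Z i j C₀ l) :=
  h.measurable_C₀.add (Finset.measurable_sum _ fun k _ => h.measurable_gap k)

end Measurability

lemma memLp_coord (h : IsBlockSystem P T H S ρ Z d s i j B₀ C₀) {f : E → ℝ}
    (hf : MemLp f 2 ρ) (l : ℕ) : MemLp (fun ω => f (Z ω l)) 2 P :=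
  hf.comp_measurePreserving
    ((measurePreserving_eval_infinitePi (fun _ => ρ) l).comp h.measurePreserving)

lemma memLp_gap (h : IsBlockSystem P T H S ρ Z d s i j B₀ C₀) (l : ℕ) :
    MemLp (gap Z i j l) 2 P :=
  (h.memLp_coord h.memLp_i l).add (h.memLp_coord h.memLp_j (l + 1))

lemma memLp_systemTime (h : IsBlockSystem P T H S ρ Z d s i j B₀ C₀) (l : ℕ) :
    MemLp (systemTime Z d s B₀ l) 2 P := by
  cases l with
  | zero => exact h.memLp_B₀
  | succ l => exact (h.memLp_coord h.memLp_d l).add (h.memLp_coord h.memLp_s (l + 1))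

lemma integrable_area (h : IsBlockSystem P T H S ρ Z d s i j B₀ C₀) (l : ℕ) :
    Integrable (area Z d s i j B₀ l) P :=
  ((h.memLp_systemTime l).integrable_mul (h.memLp_gap l)).add
    ((h.memLp_gap l).integrable_sq.div_const 2)

lemma integrable_totalArea (h : IsBlockSystem P T H S ρ Z d s i j B₀ C₀) (l : ℕ) :
    Integrable (totalArea Z d s i j B₀ C₀ l) P :=
  (h.memLp_C₀.integrable_sq.div_const 2).add
    (integrable_finsetSum _ fun k _ => h.integrable_area k)

lemma memLp_eval {f : E → ℝ} (hf : MemLp f 2 ρ) (l : ℕ) :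
    MemLp (fun z : ℕ → E => f (z l)) 2 (iidLaw ρ) :=
  hf.comp_measurePreserving (measurePreserving_eval_infinitePi (fun _ => ρ) l)

lemma measurePreserving_shift_comp (h : IsBlockSystem P T H S ρ Z d s i j B₀ C₀) (l : ℕ) :
    MeasurePreserving (fun ω k => Z ω (l + k)) P (iidLaw ρ) :=
  (measurePreserving_shift ρ l).comp h.measurePreserving

lemma measurable_areaFun (h : IsBlockSystem P T H S ρ Z d s i j B₀ C₀) :
    Measurable (areaFun d s i j) := by
  have := h.measurable_d; have := h.measurable_s; have := h.measurable_i; have := h.measurable_j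
  unfold areaFun
  fun_prop

lemma measurable_peakFun (h : IsBlockSystem P T H S ρ Z d s i j B₀ C₀) :
    Measurable (peakFun d s i j) := by
  have := h.measurable_d; have := h.measurable_s; have := h.measurable_i; have := h.measurable_j
  unfold peakFun
  fun_prop

lemma integral_area_succ (h : IsBlockSystem P T H S ρ Z d s i j B₀ C₀) (l : ℕ) :
    ∫ ω, area Z d s i j B₀ (l + 1) ω ∂P = ∫ z, areaFun d s i j z ∂iidLaw ρ :=
  integral_comp_of_measurable (h.measurePreserving_shift_comp l) h.measurable_areaFun

lemma memLp_gapFun (h : IsBlockSystem P T H S ρ Z d s i j B₀ C₀) :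
    MemLp (gapFun i j) 2 (iidLaw ρ) := (memLp_eval h.memLp_i 0).add (memLp_eval h.memLp_j 1)

lemma integrable_areaFun (h : IsBlockSystem P T H S ρ Z d s i j B₀ C₀) :
    Integrable (areaFun d s i j) (iidLaw ρ) := by
  have h1 : MemLp (fun z : ℕ → E => d (z 0) + s (z 1)) 2 (iidLaw ρ) :=
    (memLp_eval h.memLp_d 0).add (memLp_eval h.memLp_s 1)
  have h2 : MemLp (fun z : ℕ → E => i (z 1) + j (z 2)) 2 (iidLaw ρ) :=
    (memLp_eval h.memLp_i 1).add (memLp_eval h.memLp_j 2)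
  exact (h1.integrable_mul h2).add (h2.integrable_sq.div_const 2)

lemma memLp_peakFun (h : IsBlockSystem P T H S ρ Z d s i j B₀ C₀) :
    MemLp (peakFun d s i j) 2 (iidLaw ρ) :=
  ((memLp_eval h.memLp_d 0).add (memLp_eval h.memLp_s 1)).add
    ((memLp_eval h.memLp_i 1).add (memLp_eval h.memLp_j 2))

lemma tendsto_completionTime_div (h : IsBlockSystem P T H S ρ Z d s i j B₀ C₀) :
    ∀ᵐ ω ∂P, Tendsto (fun n : ℕ => completionTime Z i j C₀ n ω / n) atTop
      (𝓝 (∫ z, gapFun i j z ∂iidLaw ρ)) := by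
  have := h.measurable_i; have := h.measurable_j
  have h1 := tendsto_sum_div_of_three ρ (F := fun x => i x.1 + j x.2.1) (by fun_prop)
    (h.memLp_gapFun.integrable one_le_two)
  filter_upwards [h.measurePreserving.quasiMeasurePreserving.ae h1] with ω hω
  have h2 := (tendsto_const_nhds (x := C₀ ω)).div_atTop tendsto_natCast_atTop_atTop
  have h3 := h2.add hω
  rw [zero_add] at h3
  exact h3.congr fun n => (add_div _ _ _).symm

lemma tendsto_totalArea_div (h : IsBlockSystem P T H S ρ Z d s i j B₀ C₀) :
    ∀ᵐ ω ∂P, Tendsto (fun n : ℕ => totalArea Z d s i j B₀ C₀ n ω / n) atTop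
      (𝓝 (∫ z, areaFun d s i j z ∂iidLaw ρ)) := by
  have := h.measurable_d; have := h.measurable_s; have := h.measurable_i; have := h.measurable_j
  have h1 := tendsto_sum_div_of_three ρ (F := fun x => (d x.1 + s x.2.1) * (i x.2.1 + j x.2.2) +
    (i x.2.1 + j x.2.2) ^ 2 / 2) (by fun_prop) h.integrable_areaFun
  filter_upwards [h.measurePreserving.quasiMeasurePreserving.ae h1] with ω hω
  have h2 := (tendsto_const_nhds (x := C₀ ω ^ 2 / 2)).div_atTop tendsto_natCast_atTop_atTop
  have h3 := h2.add (tendsto_sum_div_of_succ (a := fun l => area Z d s i j B₀ l ω) hω)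
  rw [zero_add] at h3
  exact h3.congr fun n => (add_div _ _ _).symm

lemma tendsto_integral_totalArea_div (h : IsBlockSystem P T H S ρ Z d s i j B₀ C₀) :
    Tendsto (fun n : ℕ => (∫ ω, totalArea Z d s i j B₀ C₀ n ω ∂P) / n) atTop
      (𝓝 (∫ z, areaFun d s i j z ∂iidLaw ρ)) := by
  have h2 := (tendsto_const_nhds (x := ∫ ω, C₀ ω ^ 2 / 2 ∂P)).div_atTop
    (tendsto_natCast_atTop_atTop (R := ℝ))
  have h1 : Tendsto (fun n : ℕ => (∑ k ∈ Finset.range n,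
      ∫ ω, area Z d s i j B₀ (k + 1) ω ∂P) / n) atTop
      (𝓝 (∫ z, areaFun d s i j z ∂iidLaw ρ)) := by
    simp only [h.integral_area_succ, Finset.sum_const, Finset.card_range, nsmul_eq_mul]
    refine tendsto_const_nhds.congr' ?_
    filter_upwards [eventually_gt_atTop 0] with n hn
    have : (n : ℝ) ≠ 0 := by positivity
    field_simp
  have h3 := h2.add (tendsto_sum_div_of_succ (a := fun l => ∫ ω, area Z d s i j B₀ l ω ∂P) h1)
  rw [zero_add] at h3
  refine h3.congr fun n => ?_
  rw [show (∫ ω, totalArea Z d s i j B₀ C₀ n ω ∂P) = ∫ ω, (C₀ ω ^ 2 / 2 +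
    ∑ k ∈ Finset.range n, area Z d s i j B₀ k ω) ∂P from rfl]
  rw [integral_add (h.memLp_C₀.integrable_sq.div_const 2)
    (integrable_finsetSum _ fun k _ => h.integrable_area k),
    integral_finsetSum _ fun k _ => h.integrable_area k, add_div]

/-- Successive completions are strictly ordered along almost every path, so the stationary gap is
almost surely positive. This licenses dividing by the mean gap. -/
lemma integral_gapFun_pos [IsProbabilityMeasure P] (h : IsBlockSystem P T H S ρ Z d s i j B₀ C₀) :
    0 < ∫ z, gapFun i j z ∂iidLaw ρ := by
  have := h.measurable_i; have := h.measurable_j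
  have hm : Measurable (gapFun i j) := by unfold gapFun; fun_prop
  rw [← integral_comp_of_measurable h.measurePreserving hm]
  have hpos : ∀ᵐ ω ∂P, 0 < gapFun i j (Z ω) := by
    filter_upwards [h.path] with ω ⟨I, hI, _, _, hs⟩
    have := (hs 0).2
    have := hI.completion_lt 0
    simp only [gapFun]
    simp only [zero_add] at *
    linarith
  rw [integral_pos_iff_support_of_nonneg_ae (hpos.mono fun ω h => h.le)
    (h.measurePreserving.integrable_comp_of_integrable (h.memLp_gapFun.integrable one_le_two))]
  have : Function.support (fun ω => gapFun i j (Z ω)) =ᵐ[P] Set.univ := by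
    filter_upwards [hpos] with ω hω
    exact propext ⟨fun _ => trivial, fun _ => hω.ne'⟩
  rw [measure_congr this]
  simp

lemma ae_integral_age_eq (h : IsBlockSystem P T H S ρ Z d s i j B₀ C₀) :
    ∀ᵐ ω ∂P, ∀ l, ∫ t in (0 : ℝ)..completionTime Z i j C₀ l ω,
      age S (fun n => T n ω) (fun n => H n ω) t = totalArea Z d s i j B₀ C₀ l ω := by
  filter_upwards [h.ae_path] with ω ⟨I, hI, hC, hr⟩ l
  rw [← hC, hI.integral_age]
  simp only [totalArea, area, hC, hr]
  congr 1
  · simp [completionTime]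
  · refine Finset.sum_congr rfl fun k _ => ?_
    rw [completionTime, completionTime, Finset.sum_range_succ]
    ring

/-- The time-average age. -/
lemma tendsto_timeAverage [IsProbabilityMeasure P] (h : IsBlockSystem P T H S ρ Z d s i j B₀ C₀) :
    ∀ᵐ ω ∂P, Tendsto (fun τ : ℝ => τ⁻¹ * ∫ t in (0 : ℝ)..τ,
      age S (fun n => T n ω) (fun n => H n ω) t) atTop
      (𝓝 ((∫ z, areaFun d s i j z ∂iidLaw ρ) / ∫ z, gapFun i j z ∂iidLaw ρ)) := by
  filter_upwards [h.ae_path, h.ae_integral_age_eq, h.tendsto_completionTime_div,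
    h.tendsto_totalArea_div] with ω ⟨I, hI, hC, hr⟩ htot h1 h2
  have hCeq : (fun l => completionTime Z i j C₀ l ω) =
      fun l => completion S (fun n => T n ω) (fun n => H n ω) (I l) := funext fun l => (hC l).symm
  refine tendsto_inv_mul_of_tendsto_div (C := fun l => completionTime Z i j C₀ l ω) ?_ (by simp)
    (hCeq ▸ hI.completion_strictMono) (by rw [← hC]; exact hI.completion_pos 0)
    h.integral_gapFun_pos h1 ?_
  · intro a b ha hab
    rw [← intervalIntegral.integral_add_adjacent_intervals (hI.intervalIntegrable_age 0 a)
      (hI.intervalIntegrable_age a b), le_add_iff_nonneg_right]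
    exact intervalIntegral.integral_nonneg hab fun t ht => hI.age_nonneg (ha.trans ht.1)
  · refine h2.congr fun n => ?_
    rw [htot]

end IsBlockSystem

/-! ### Expected age, peaks and metrics of a block system. -/

namespace IsBlockSystem

variable {Ω E : Type*} [MeasurableSpace Ω] [MeasurableSpace E] {P : Measure Ω}
  [IsProbabilityMeasure P]
  {T H : ℕ → Ω → ℝ} {S : System} {ρ : Measure E} [IsProbabilityMeasure ρ] {Z : Ω → ℕ → E}
  {d s i j : E → ℝ} {B₀ C₀ : Ω → ℝ}

/-- A jointly measurable version of the age. -/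
noncomputable def measurableAge (Z : Ω → ℕ → E) (d s i j : E → ℝ) (B₀ C₀ : Ω → ℝ) (t : ℝ) (ω : Ω) :
    ℝ :=
  t - ⨆ l, if completionTime Z i j C₀ l ω ≤ t then
    completionTime Z i j C₀ l ω - systemTime Z d s B₀ l ω else 0

lemma measurable_uncurry_age (h : IsBlockSystem P T H S ρ Z d s i j B₀ C₀) :
    Measurable (Function.uncurry (measurableAge Z d s i j B₀ C₀)) := by
  have h1 := h.measurable_completionTime
  have h2 := h.measurable_systemTime
  refine measurable_fst.sub (Measurable.iSup fun l => ?_)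
  exact Measurable.ite (measurableSet_le ((h1 l).comp measurable_snd) measurable_fst)
    (((h1 l).comp measurable_snd).sub ((h2 l).comp measurable_snd)) measurable_const

lemma ae_age_eq (h : IsBlockSystem P T H S ρ Z d s i j B₀ C₀) :
    ∀ᵐ ω ∂P, ∀ t, age S (fun n => T n ω) (fun n => H n ω) t =
      measurableAge Z d s i j B₀ C₀ t ω := by
  filter_upwards [h.ae_path] with ω ⟨I, hI, hC, hr⟩ t
  rw [hI.age_eq_iSup, measurableAge]
  simp only [hC, hr]

lemma ae_age_mem (h : IsBlockSystem P T H S ρ Z d s i j B₀ C₀) :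
    ∀ᵐ ω ∂P, ∀ t, 0 ≤ t → 0 ≤ measurableAge Z d s i j B₀ C₀ t ω ∧
      measurableAge Z d s i j B₀ C₀ t ω ≤ t := by
  filter_upwards [h.ae_path, h.ae_age_eq] with ω ⟨I, hI, hC, hr⟩ heq t ht
  rw [← heq]
  exact ⟨hI.age_nonneg ht, hI.age_le t⟩

lemma integrable_age (h : IsBlockSystem P T H S ρ Z d s i j B₀ C₀) {t : ℝ} (ht : 0 ≤ t) :
    Integrable (fun ω => age S (fun n => T n ω) (fun n => H n ω) t) P := by
  have hm : Measurable fun ω => measurableAge Z d s i j B₀ C₀ t ω :=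
    h.measurable_uncurry_age.comp (measurable_const.prodMk measurable_id)
  have : Integrable (fun ω => measurableAge Z d s i j B₀ C₀ t ω) P := by
    refine Integrable.mono' (integrable_const t) hm.aestronglyMeasurable ?_
    filter_upwards [h.ae_age_mem] with ω hω
    rw [Real.norm_eq_abs, abs_of_nonneg (hω t ht).1]
    exact (hω t ht).2
  refine this.congr ?_
  filter_upwards [h.ae_age_eq] with ω hω using (hω t).symm

/-- On `(0, τ]` the age lies between `0` and `τ`, hence is bounded on a finite measure space. It
justifies Fubini for exchanging the time average and the expectation. -/
lemma integrable_uncurry_age (h : IsBlockSystem P T H S ρ Z d s i j B₀ C₀) (τ : ℝ) :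
    Integrable (Function.uncurry (measurableAge Z d s i j B₀ C₀))
      ((volume.restrict (Set.Ioc 0 τ)).prod P) := by
  refine Integrable.mono' (integrable_const τ) h.measurable_uncurry_age.aestronglyMeasurable ?_
  have h1 : ∀ᵐ x ∂(volume.restrict (Set.Ioc 0 τ)).prod P, ∀ t, 0 ≤ t →
      0 ≤ measurableAge Z d s i j B₀ C₀ t x.2 ∧ measurableAge Z d s i j B₀ C₀ t x.2 ≤ t :=
    Measure.quasiMeasurePreserving_snd.ae h.ae_age_mem
  have h2 : ∀ᵐ x ∂(volume.restrict (Set.Ioc 0 τ)).prod P, x.1 ∈ Set.Ioc 0 τ :=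
    Measure.quasiMeasurePreserving_fst.ae (ae_restrict_mem measurableSet_Ioc)
  filter_upwards [h1, h2] with x hx hx'
  have := hx x.1 hx'.1.le
  rw [Real.norm_eq_abs, Function.uncurry_def, abs_of_nonneg this.1]
  exact this.2.trans hx'.2

lemma integral_age_swap (h : IsBlockSystem P T H S ρ Z d s i j B₀ C₀) {τ : ℝ} (hτ : 0 ≤ τ) :
    ∫ t in (0 : ℝ)..τ, (∫ ω, age S (fun n => T n ω) (fun n => H n ω) t ∂P) =
      ∫ ω, (∫ t in (0 : ℝ)..τ, age S (fun n => T n ω) (fun n => H n ω) t) ∂P := by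
  have h1 : ∀ t, ∫ ω, age S (fun n => T n ω) (fun n => H n ω) t ∂P =
      ∫ ω, measurableAge Z d s i j B₀ C₀ t ω ∂P := fun t =>
    integral_congr_ae (by filter_upwards [h.ae_age_eq] with ω hω using hω t)
  have h2 : ∫ ω, (∫ t in (0 : ℝ)..τ, age S (fun n => T n ω) (fun n => H n ω) t) ∂P =
      ∫ ω, (∫ t in (0 : ℝ)..τ, measurableAge Z d s i j B₀ C₀ t ω) ∂P :=
    integral_congr_ae (by
      filter_upwards [h.ae_age_eq] with ω hω
      simp only [hω])
  rw [h2]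
  simp only [h1, intervalIntegral.integral_of_le hτ]
  exact integral_integral_swap (h.integrable_uncurry_age τ)

lemma aestronglyMeasurable_integral_age (h : IsBlockSystem P T H S ρ Z d s i j B₀ C₀) {τ : ℝ}
    (hτ : 0 ≤ τ) : AEStronglyMeasurable
      (fun ω => ∫ t in (0 : ℝ)..τ, age S (fun n => T n ω) (fun n => H n ω) t) P := by
  refine (h.integrable_uncurry_age τ).integral_prod_right.aestronglyMeasurable.congr ?_
  filter_upwards [h.ae_age_eq] with ω hω
  simp only [intervalIntegral.integral_of_le hτ, hω, Function.uncurry]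

lemma tendsto_mul_exp_neg {lam : ℝ} (hlam : 0 < lam) :
    Tendsto (fun τ : ℝ => τ * Real.exp (-(lam * τ))) atTop (𝓝 0) := by
  have h1 := (Real.tendsto_pow_mul_exp_neg_atTop_nhds_zero 1).comp
    (tendsto_id.const_mul_atTop hlam)
  have h2 := h1.const_mul lam⁻¹
  rw [mul_zero] at h2
  refine h2.congr fun τ => ?_
  simp only [Function.comp_apply, id, pow_one]
  field_simp

/-- The time average of the expected age. -/
lemma tendsto_meanAverage (h : IsBlockSystem P T H S ρ Z d s i j B₀ C₀) {lam : ℝ} (hlam : 0 < lam)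
    (harr : ∀ (k : ℕ) (τ : ℝ), P.real {ω | arrival (fun n => T n ω) k ≤ τ} ≤
      Real.exp (lam * τ) * (1 / 2) ^ k) :
    Tendsto (fun τ : ℝ => τ⁻¹ * ∫ t in (0 : ℝ)..τ,
      (∫ ω, age S (fun n => T n ω) (fun n => H n ω) t ∂P)) atTop
      (𝓝 ((∫ z, areaFun d s i j z ∂iidLaw ρ) / ∫ z, gapFun i j z ∂iidLaw ρ)) := by
  set γ := ∫ z, gapFun i j z ∂iidLaw ρ with hγ
  set κ := ∫ z, areaFun d s i j z ∂iidLaw ρ with hκ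
  have hγpos : 0 < γ := h.integral_gapFun_pos
  -- The term `2 / γ` puts completion `k τ`, which grows like `γ * k τ`, eventually beyond `τ` on
  -- almost every path. The term `4 * lam` makes `exp (lam * τ) * (1 / 2) ^ k τ` at most `exp (-(lam
  -- * τ))`.
  set A := 4 * lam + 2 / γ with hA
  have hApos : 0 < A := by positivity
  let k : ℝ → ℕ := fun τ => ⌈A * τ⌉₊
  have hkA : ∀ τ, A * τ ≤ k τ := fun τ => Nat.le_ceil _
  have hktop : Tendsto k atTop atTop :=
    tendsto_nat_ceil_atTop.comp (tendsto_id.const_mul_atTop hApos)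
  have hkdiv : Tendsto (fun τ : ℝ => (k τ : ℝ) / τ) atTop (𝓝 A) :=
    tendsto_nat_ceil_mul_div_atTop hApos.le
  let late : ℝ → Set Ω := fun τ => {ω | completionTime Z i j C₀ (k τ) ω ≤ τ}
  have hlate : ∀ τ, MeasurableSet (late τ) := fun τ =>
    measurableSet_le (h.measurable_completionTime _) measurable_const
  -- If completion `k τ` comes after `τ`, the area up to it dominates the area up to `τ`. On the
  -- rare event `late`, the trivial bound that the average age is at most `τ` is used.
  let Y : ℝ → Ω → ℝ := fun τ ω =>
    τ⁻¹ * totalArea Z d s i j B₀ C₀ (k τ) ω + (late τ).indicator (fun _ => τ) ω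
  have hYint : ∀ τ, Integrable (Y τ) P := fun τ =>
    ((h.integrable_totalArea _).const_mul _).add ((integrable_const τ).indicator (hlate τ))
  have hmain : Tendsto (fun τ : ℝ => ∫ ω, τ⁻¹ * (∫ t in (0 : ℝ)..τ,
      age S (fun n => T n ω) (fun n => H n ω) t) ∂P) atTop (𝓝 (κ / γ)) := by
    refine tendsto_integral_of_le (Y := Y) (c' := κ * A) ?_ (.of_forall hYint) ?_ ?_
      h.tendsto_timeAverage ?_ ?_
    · filter_upwards [eventually_ge_atTop 0] with τ hτ
      exact (h.aestronglyMeasurable_integral_age hτ).const_mul _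
    · filter_upwards [eventually_ge_atTop 0] with τ hτ
      filter_upwards [h.ae_path] with ω ⟨I, hI, _⟩
      exact mul_nonneg (inv_nonneg.2 hτ)
        (intervalIntegral.integral_nonneg hτ fun t ht => hI.age_nonneg ht.1)
    · filter_upwards [eventually_gt_atTop 0] with τ hτ
      filter_upwards [h.ae_path, h.ae_integral_age_eq] with ω ⟨I, hI, hC, hr⟩ htot
      have hCpos : 0 < completionTime Z i j C₀ (k τ) ω := by rw [← hC]; exact hI.completion_pos _
      by_cases hω : ω ∈ late τ
      · simp only [Y, Set.indicator_of_mem hω, ← htot]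
        have h1 : 0 ≤ ∫ t in (0 : ℝ)..completionTime Z i j C₀ (k τ) ω,
            age S (fun n => T n ω) (fun n => H n ω) t :=
          intervalIntegral.integral_nonneg hCpos.le fun t ht => hI.age_nonneg ht.1
        have h2 : ∫ t in (0 : ℝ)..τ, age S (fun n => T n ω) (fun n => H n ω) t ≤
            ∫ t in (0 : ℝ)..τ, τ :=
          intervalIntegral.integral_mono_on hτ.le (hI.intervalIntegrable_age _ _)
            _root_.intervalIntegrable_const fun t ht => (hI.age_le t).trans ht.2
        rw [intervalIntegral.integral_const, sub_zero, smul_eq_mul] at h2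
        have h3 := mul_le_mul_of_nonneg_left h2 (inv_nonneg.2 hτ.le)
        rw [inv_mul_cancel_left₀ hτ.ne'] at h3
        have h4 := mul_nonneg (inv_nonneg.2 hτ.le) h1
        linarith
      · simp only [Y, Set.indicator_of_notMem hω, add_zero, ← htot]
        have hle : τ ≤ completionTime Z i j C₀ (k τ) ω := (not_le.1 hω).le
        refine mul_le_mul_of_nonneg_left ?_ (inv_nonneg.2 hτ.le)
        rw [← intervalIntegral.integral_add_adjacent_intervals (hI.intervalIntegrable_age 0 τ)
          (hI.intervalIntegrable_age τ (completionTime Z i j C₀ (k τ) ω)), le_add_iff_nonneg_right]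
        exact intervalIntegral.integral_nonneg hle fun t ht => hI.age_nonneg (hτ.le.trans ht.1)
    · filter_upwards [h.tendsto_completionTime_div, h.tendsto_totalArea_div] with ω h1 h2
      have h3 : Tendsto (fun τ : ℝ => τ⁻¹ * totalArea Z d s i j B₀ C₀ (k τ) ω) atTop
          (𝓝 (κ * A)) := by
        refine ((h2.comp hktop).mul hkdiv).congr' ?_
        filter_upwards [hktop.eventually_gt_atTop 0] with τ hk
        have : (k τ : ℝ) ≠ 0 := by positivity
        simp only [Function.comp_apply]
        field_simp
      have h4 : Tendsto (fun τ => (late τ).indicator (fun _ => τ) ω) atTop (𝓝 0) := by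
        have h5 := (h1.comp hktop).eventually (eventually_gt_nhds (half_lt_self hγpos))
        refine tendsto_const_nhds.congr' ?_
        filter_upwards [h5, hktop.eventually_gt_atTop 0, eventually_gt_atTop 0] with τ h6 hk hτ
        rw [Set.indicator_of_notMem]
        simp only [late, Set.mem_ofPred_eq, not_le]
        have hk' : (0 : ℝ) < k τ := by positivity
        simp only [Function.comp_apply] at h6
        rw [lt_div_iff₀ hk'] at h6
        refine lt_of_le_of_lt ?_ h6
        have h7 := hkA τ
        have h8 : 2 / γ * τ ≤ k τ := by
          have : 0 ≤ 4 * lam * τ := by positivity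
          rw [hA, add_mul] at h7
          linarith
        rw [div_mul_eq_mul_div, div_le_iff₀ hγpos] at h8
        linarith
      simpa using h3.add h4
    · have h1 : Tendsto (fun τ : ℝ => τ⁻¹ * ∫ ω, totalArea Z d s i j B₀ C₀ (k τ) ω ∂P) atTop
          (𝓝 (κ * A)) := by
        refine ((h.tendsto_integral_totalArea_div.comp hktop).mul hkdiv).congr' ?_
        filter_upwards [hktop.eventually_gt_atTop 0] with τ hk
        have : (k τ : ℝ) ≠ 0 := by positivity
        simp only [Function.comp_apply]
        field_simp
      have h2 : Tendsto (fun τ : ℝ => P.real (late τ) * τ) atTop (𝓝 0) := by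
        refine squeeze_zero' ?_ ?_ (tendsto_mul_exp_neg hlam)
        · filter_upwards [eventually_ge_atTop 0] with τ hτ
          exact mul_nonneg measureReal_nonneg hτ
        · filter_upwards [eventually_ge_atTop 0] with τ hτ
          rw [mul_comm]
          refine mul_le_mul_of_nonneg_left ?_ hτ
          -- Completion `k` is not earlier than arrival `k`, so a late event forces unusually many
          -- arrivals by time `τ`.
          have h3 : P.real (late τ) ≤ P.real {ω | arrival (fun n => T n ω) (k τ) ≤ τ} := by
            refine ENNReal.toReal_mono (measure_ne_top _ _) (measure_mono_ae ?_)
            filter_upwards [h.ae_path] with ω ⟨I, hI, hC, hr⟩ hω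
            exact (hI.arrival_le_completion (k τ)).trans ((hC _).trans_le hω)
          refine (h3.trans (harr _ _)).trans ?_
          have h4 : (1 / 2 : ℝ) ≤ Real.exp (-(1 / 2)) := by
            have := Real.add_one_le_exp (-(1 / 2) : ℝ)
            linarith
          have h5 : (1 / 2 : ℝ) ^ k τ ≤ Real.exp (-(1 / 2)) ^ k τ := by gcongr
          rw [← Real.exp_nat_mul] at h5
          refine (mul_le_mul_of_nonneg_left h5 (Real.exp_pos _).le).trans ?_
          rw [← Real.exp_add, Real.exp_le_exp]
          have h7 := hkA τ
          have : 0 ≤ 2 / γ * τ := by positivity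
          rw [hA, add_mul] at h7
          linarith
      have h3 := h1.add h2
      rw [add_zero] at h3
      refine h3.congr fun τ => ?_
      rw [integral_add ((h.integrable_totalArea _).const_mul _)
        ((integrable_const τ).indicator (hlate τ)), integral_const_mul,
        integral_indicator_const _ (hlate τ), smul_eq_mul]
  refine hmain.congr' ?_
  filter_upwards [eventually_ge_atTop 0] with τ hτ
  rw [h.integral_age_swap hτ, integral_const_mul]

lemma intervalIntegrable_integral_age (h : IsBlockSystem P T H S ρ Z d s i j B₀ C₀) (τ : ℝ)
    (hτ : 0 ≤ τ) : IntervalIntegrable (fun t => ∫ ω, age S (fun n => T n ω) (fun n => H n ω) t ∂P)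
      volume 0 τ := by
  have h1 : ∀ t, ∫ ω, age S (fun n => T n ω) (fun n => H n ω) t ∂P =
      ∫ ω, measurableAge Z d s i j B₀ C₀ t ω ∂P := fun t =>
    integral_congr_ae (by filter_upwards [h.ae_age_eq] with ω hω using hω t)
  simp only [h1]
  rw [intervalIntegrable_iff_integrableOn_Ioc_of_le hτ]
  exact (h.integrable_uncurry_age τ).integral_prod_left

/-- The `l`-th peak. -/
def peakRV (Z : Ω → ℕ → E) (d s i j : E → ℝ) (B₀ C₀ : Ω → ℝ) : ℕ → Ω → ℝ
  | 0, ω => C₀ ω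
  | l + 1, ω => systemTime Z d s B₀ l ω + gap Z i j l ω

lemma ae_peak_eq (h : IsBlockSystem P T H S ρ Z d s i j B₀ C₀) :
    ∀ᵐ ω ∂P, ∀ l, peak S (fun n => T n ω) (fun n => H n ω) l = peakRV Z d s i j B₀ C₀ l ω := by
  filter_upwards [h.ae_path] with ω ⟨I, hI, hC, hr⟩ l
  cases l with
  | zero => rw [hI.peak_zero, hC]; simp [peakRV, completionTime]
  | succ l =>
    rw [hI.peak_succ, hC, hr, peakRV]
    simp only [completionTime, Finset.sum_range_succ]
    ring

lemma memLp_peakRV (h : IsBlockSystem P T H S ρ Z d s i j B₀ C₀) (l : ℕ) :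
    MemLp (peakRV Z d s i j B₀ C₀ l) 2 P := by
  cases l with
  | zero => exact h.memLp_C₀
  | succ l => exact (h.memLp_systemTime l).add (h.memLp_gap l)

lemma tendsto_peakAverage (h : IsBlockSystem P T H S ρ Z d s i j B₀ C₀) :
    ∀ᵐ ω ∂P, Tendsto (fun k : ℕ => (k : ℝ)⁻¹ * ∑ l ∈ Finset.range k,
      peak S (fun n => T n ω) (fun n => H n ω) l) atTop (𝓝 (∫ z, peakFun d s i j z ∂iidLaw ρ)) := by
  have := h.measurable_d; have := h.measurable_s; have := h.measurable_i; have := h.measurable_j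
  have h1 := tendsto_sum_div_of_three ρ (F := fun x => d x.1 + s x.2.1 + (i x.2.1 + j x.2.2))
    (by fun_prop) (h.memLp_peakFun.integrable one_le_two)
  filter_upwards [h.measurePreserving.quasiMeasurePreserving.ae h1, h.ae_peak_eq] with ω hω hp
  have h2 := tendsto_sum_div_of_succ (a := fun l => peakRV Z d s i j B₀ C₀ (l + 1) ω) hω
  have h3 := tendsto_sum_div_of_succ (a := fun l => peakRV Z d s i j B₀ C₀ l ω) h2
  refine h3.congr fun n => ?_
  simp only [hp]
  rw [inv_mul_eq_div]

/-- Peak `0` is `C₀` and peak `1` involves `B₀`; from index `2` on, a peak is the same function of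
three shifted i.i.d. blocks. The sequence of laws is thus eventually constant, and no genuine limit
is needed. -/
lemma map_peak (h : IsBlockSystem P T H S ρ Z d s i j B₀ C₀) (l : ℕ) :
    P.map (fun ω => peak S (fun n => T n ω) (fun n => H n ω) (l + 2)) =
      (iidLaw ρ).map (peakFun d s i j) := by
  have h1 : (fun ω => peak S (fun n => T n ω) (fun n => H n ω) (l + 2)) =ᵐ[P]
      peakFun d s i j ∘ fun ω k => Z ω (l + k) := by
    filter_upwards [h.ae_peak_eq] with ω hω
    rw [hω]
    rfl
  rw [Measure.map_congr h1, ← Measure.map_map h.measurable_peakFun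
    (h.measurePreserving_shift_comp l).measurable, (h.measurePreserving_shift_comp l).map_eq]

lemma identDistrib_peak (h : IsBlockSystem P T H S ρ Z d s i j B₀ C₀) (l : ℕ) :
    IdentDistrib (fun ω => peak S (fun n => T n ω) (fun n => H n ω) (l + 2)) (peakFun d s i j)
      P (iidLaw ρ) where
  aemeasurable_fst := (h.memLp_peakRV (l + 2)).aemeasurable.congr
    (h.ae_peak_eq.mono fun _ h => (h _).symm)
  aemeasurable_snd := h.measurable_peakFun.aemeasurable
  map_eq := h.map_peak l

/-- The metrics of a system with i.i.d. blocks. -/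
theorem systemHasMetrics (h : IsBlockSystem P T H S ρ Z d s i j B₀ C₀) {lam : ℝ} (hlam : 0 < lam)
    (harr : ∀ (k : ℕ) (τ : ℝ), P.real {ω | arrival (fun n => T n ω) k ≤ τ} ≤
      Real.exp (lam * τ) * (1 / 2) ^ k) :
    SystemHasMetrics P T H S
      ((∫ z, areaFun d s i j z ∂iidLaw ρ) / ∫ z, gapFun i j z ∂iidLaw ρ)
      (∫ z, peakFun d s i j z ∂iidLaw ρ) (variance (peakFun d s i j) (iidLaw ρ)) where
  integrable_age t ht := h.integrable_age ht
  aoi_timeAverage := h.tendsto_timeAverage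
  aoi_meanAverage := h.tendsto_meanAverage hlam harr
  -- A limit of the expected age is also the limit of its Cesàro averages, which is already known.
  aoi_limit a ha := tendsto_nhds_unique
    (tendsto_inv_mul_integral h.intervalIntegrable_integral_age ha) (h.tendsto_meanAverage hlam harr)
  memLp_peak l := (h.memLp_peakRV l).ae_eq (h.ae_peak_eq.mono fun _ h => (h l).symm)
  paoi_average := h.tendsto_peakAverage
  paoi_limit := by
    rw [← tendsto_add_atTop_iff_nat 2]
    exact tendsto_const_nhds.congr fun l => (h.identDistrib_peak l).integral_eq.symm
  var_limit := by
    rw [← tendsto_add_atTop_iff_nat 2]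
    exact tendsto_const_nhds.congr fun l => (h.identDistrib_peak l).variance_eq.symm
  peak_limit := by
    have hm := h.measurable_peakFun
    have hprob : IsProbabilityMeasure ((iidLaw ρ).map (peakFun d s i j)) :=
      Measure.isProbabilityMeasure_map hm.aemeasurable
    let ν : ProbabilityMeasure ℝ := ⟨(iidLaw ρ).map (peakFun d s i j), hprob⟩
    refine ⟨ν, ?_, ?_, ?_, ?_⟩
    · have hae : ∀ l, AEMeasurable (fun ω => peak S (fun n => T n ω) (fun n => H n ω) l) P :=
        fun l => (h.memLp_peakRV l).aemeasurable.congr (h.ae_peak_eq.mono fun _ h => (h l).symm)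
      refine ⟨hae, measurable_id.aemeasurable, (tendsto_add_atTop_iff_nat 2).1 ?_⟩
      refine tendsto_const_nhds.congr fun l => Subtype.ext ?_
      simp only
      rw [h.map_peak l]
      exact Measure.map_id
    · exact (memLp_map_measure_iff measurable_id.aestronglyMeasurable hm.aemeasurable).2
        h.memLp_peakFun
    · exact integral_map hm.aemeasurable measurable_id.aestronglyMeasurable
    · exact variance_map measurable_id.aemeasurable hm.aemeasurable

end IsBlockSystem

/-! ### Metrics of a block system in terms of the moments of one block. -/

namespace IsBlockSystem

variable {Ω E : Type*} [MeasurableSpace Ω] [MeasurableSpace E] {P : Measure Ω}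
  {T H : ℕ → Ω → ℝ} {S : System} {ρ : Measure E} [IsProbabilityMeasure ρ] {Z : Ω → ℕ → E}
  {d s i j : E → ℝ} {B₀ C₀ : Ω → ℝ}

lemma integral_eval {f : E → ℝ} (hf : Measurable f) (l : ℕ) :
    ∫ z, f (z l) ∂iidLaw ρ = ∫ x, f x ∂ρ :=
  integral_comp_of_measurable (measurePreserving_eval_infinitePi (fun _ => ρ) l) hf

lemma indepFun_eval {f g : E → ℝ} (hf : Measurable f) (hg : Measurable g) {k l : ℕ} (hkl : k ≠ l) :
    IndepFun (fun z : ℕ → E => f (z k)) (fun z => g (z l)) (iidLaw ρ) :=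
  ((iIndepFun_eval ρ).indepFun hkl).comp hf hg

lemma integral_eval_mul {f g : E → ℝ} (hf : Measurable f) (hg : Measurable g) {k l : ℕ}
    (hkl : k ≠ l) :
    ∫ z, f (z k) * g (z l) ∂iidLaw ρ = (∫ x, f x ∂ρ) * ∫ x, g x ∂ρ := by
  rw [(indepFun_eval hf hg hkl).integral_fun_mul_eq_mul_integral 
    (hf.comp (measurable_pi_apply k)).aestronglyMeasurable
    (hg.comp (measurable_pi_apply l)).aestronglyMeasurable,
    integral_eval hf, integral_eval hg]

lemma integral_gapFun (h : IsBlockSystem P T H S ρ Z d s i j B₀ C₀) :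
    ∫ z, gapFun i j z ∂iidLaw ρ = (∫ x, i x ∂ρ) + ∫ x, j x ∂ρ := by
  simp only [gapFun]
  rw [integral_add ((memLp_eval h.memLp_i 0).integrable one_le_two)
    ((memLp_eval h.memLp_j 1).integrable one_le_two), integral_eval h.measurable_i,
    integral_eval h.measurable_j]

lemma integral_peakFun (h : IsBlockSystem P T H S ρ Z d s i j B₀ C₀) :
    ∫ z, peakFun d s i j z ∂iidLaw ρ =
      (∫ x, d x ∂ρ) + (∫ x, s x ∂ρ) + ((∫ x, i x ∂ρ) + ∫ x, j x ∂ρ) := by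
  have hd := (memLp_eval (ρ := ρ) h.memLp_d 0).integrable one_le_two
  have hs := (memLp_eval (ρ := ρ) h.memLp_s 1).integrable one_le_two
  have hi := (memLp_eval (ρ := ρ) h.memLp_i 1).integrable one_le_two
  have hj := (memLp_eval (ρ := ρ) h.memLp_j 2).integrable one_le_two
  simp only [peakFun]
  rw [integral_add (hd.fun_add hs) (hi.fun_add hj), integral_add hd hs, integral_add hi hj,
    integral_eval h.measurable_d, integral_eval h.measurable_s, integral_eval h.measurable_i,
    integral_eval h.measurable_j]

/-- Here `d` is taken at block `0`, `s` and `i` at block `1`, and `j` at block `2`. Hence `s * i` is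
the only product within a block; every other mixed product factors by independence. In particular
the joint law of `d` and `i` never matters. -/
lemma integral_areaFun (h : IsBlockSystem P T H S ρ Z d s i j B₀ C₀) :
    ∫ z, areaFun d s i j z ∂iidLaw ρ =
      (∫ x, d x ∂ρ) * ((∫ x, i x ∂ρ) + ∫ x, j x ∂ρ) + (∫ x, s x * i x ∂ρ) +
      (∫ x, s x ∂ρ) * (∫ x, j x ∂ρ) + ((∫ x, i x ^ 2 ∂ρ) +
      2 * ((∫ x, i x ∂ρ) * ∫ x, j x ∂ρ) + ∫ x, j x ^ 2 ∂ρ) / 2 := by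
  have hd := memLp_eval (ρ := ρ) h.memLp_d 0
  have hs := memLp_eval (ρ := ρ) h.memLp_s 1
  have hi := memLp_eval (ρ := ρ) h.memLp_i 1
  have hj := memLp_eval (ρ := ρ) h.memLp_j 2
  have e : ∀ z, areaFun d s i j z = d (z 0) * i (z 1) + d (z 0) * j (z 2) + s (z 1) * i (z 1) +
      s (z 1) * j (z 2) + i (z 1) ^ 2 / 2 + i (z 1) * j (z 2) + j (z 2) ^ 2 / 2 := fun z => by
    simp only [areaFun]; ring
  have i1 : Integrable (fun z : ℕ → E => d (z 0) * i (z 1)) (iidLaw ρ) := hd.integrable_mul hi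
  have i2 : Integrable (fun z : ℕ → E => d (z 0) * j (z 2)) (iidLaw ρ) := hd.integrable_mul hj
  have i3 : Integrable (fun z : ℕ → E => s (z 1) * i (z 1)) (iidLaw ρ) := hs.integrable_mul hi
  have i4 : Integrable (fun z : ℕ → E => s (z 1) * j (z 2)) (iidLaw ρ) := hs.integrable_mul hj
  have i5 : Integrable (fun z : ℕ → E => i (z 1) ^ 2 / 2) (iidLaw ρ) :=
    hi.integrable_sq.div_const 2
  have i6 : Integrable (fun z : ℕ → E => i (z 1) * j (z 2)) (iidLaw ρ) := hi.integrable_mul hj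
  have i7 : Integrable (fun z : ℕ → E => j (z 2) ^ 2 / 2) (iidLaw ρ) :=
    hj.integrable_sq.div_const 2
  simp only [e]
  rw [integral_add (((((i1.fun_add i2).fun_add i3).fun_add i4).fun_add i5).fun_add i6) i7,
    integral_add ((((i1.fun_add i2).fun_add i3).fun_add i4).fun_add i5) i6,
    integral_add (((i1.fun_add i2).fun_add i3).fun_add i4) i5, integral_add ((i1.fun_add i2).fun_add i3) i4,
    integral_add (i1.fun_add i2) i3, integral_add i1 i2, integral_div, integral_div,
    integral_eval_mul h.measurable_d h.measurable_i (by decide),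
    integral_eval_mul h.measurable_d h.measurable_j (by decide),
    integral_eval_mul h.measurable_s h.measurable_j (by decide),
    integral_eval_mul h.measurable_i h.measurable_j (by decide),
    integral_eval (f := fun x => s x * i x) (h.measurable_s.mul h.measurable_i),
    integral_eval (f := fun x => i x ^ 2) (h.measurable_i.pow_const 2),
    integral_eval (f := fun x => j x ^ 2) (h.measurable_j.pow_const 2)]
  ring

lemma variance_eval {f : E → ℝ} (hf : MemLp f 2 ρ) (l : ℕ) :
    variance (fun z : ℕ → E => f (z l)) (iidLaw ρ) = variance f ρ := by
  have hmp := measurePreserving_eval_infinitePi (fun _ : ℕ => ρ) l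
  conv_rhs => rw [← hmp.map_eq]
  refine (variance_map ?_ hmp.measurable.aemeasurable).symm
  rw [hmp.map_eq]
  exact hf.aemeasurable

/-- The peak is the sum of three independent terms, `d` of block `0`, `s + i` of block `1` and `j`
of block `2`, so their variances add. -/
lemma variance_peakFun (h : IsBlockSystem P T H S ρ Z d s i j B₀ C₀) :
    variance (peakFun d s i j) (iidLaw ρ) =
      (∫ x, d x ^ 2 ∂ρ) - (∫ x, d x ∂ρ) ^ 2 +
      ((∫ x, s x ^ 2 ∂ρ) + 2 * (∫ x, s x * i x ∂ρ) + (∫ x, i x ^ 2 ∂ρ) -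
        ((∫ x, s x ∂ρ) + ∫ x, i x ∂ρ) ^ 2) +
      ((∫ x, j x ^ 2 ∂ρ) - (∫ x, j x ∂ρ) ^ 2) := by
  have hd := h.measurable_d; have hs := h.measurable_s
  have hi := h.measurable_i; have hj := h.measurable_j
  have hsi : MemLp (fun x => s x + i x) 2 ρ := h.memLp_s.add h.memLp_i
  have e : peakFun d s i j =
      ((fun z : ℕ → E => d (z 0)) + fun z => (s (z 1) + i (z 1))) + fun z => j (z 2) := by
    ext z; simp only [peakFun, Pi.add_apply]; ring
  have hind : IndepFun ((fun z : ℕ → E => d (z 0)) + fun z => (s (z 1) + i (z 1)))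
      (fun z => j (z 2)) (iidLaw ρ) := by
    have h1 := (iIndepFun_eval ρ).indepFun_prodMk (fun l => measurable_pi_apply l) 0 1 2
      (by decide) (by decide)
    exact h1.comp (φ := fun x : E × E => d x.1 + (s x.2 + i x.2)) (ψ := j) (by fun_prop) hj
  have hv : ∀ {f : E → ℝ}, MemLp f 2 ρ → variance f ρ = (∫ x, f x ^ 2 ∂ρ) - (∫ x, f x ∂ρ) ^ 2 :=
    fun hf => variance_eq_sub hf
  rw [e, hind.variance_add ((memLp_eval h.memLp_d 0).add (memLp_eval hsi 1))
    (memLp_eval h.memLp_j 2), (indepFun_eval (g := fun x => s x + i x) hd (by fun_prop)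
      (by decide)).variance_add (memLp_eval h.memLp_d 0) (memLp_eval hsi 1),
    variance_eval h.memLp_d, variance_eval hsi, variance_eval h.memLp_j, hv h.memLp_d, hv hsi,
    hv h.memLp_j, integral_add (h.memLp_s.integrable one_le_two) (h.memLp_i.integrable one_le_two)]
  have hq : ∫ x, (s x + i x) ^ 2 ∂ρ =
      (∫ x, s x ^ 2 ∂ρ) + 2 * (∫ x, s x * i x ∂ρ) + ∫ x, i x ^ 2 ∂ρ := by
    have i1 := h.memLp_s.integrable_sq
    have i2 : Integrable (fun x => 2 * (s x * i x)) ρ :=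
      (h.memLp_s.integrable_mul h.memLp_i).const_mul 2
    have i3 := h.memLp_i.integrable_sq
    rw [← integral_const_mul, ← integral_add i1 i2, ← integral_add (i1.fun_add i2) i3]
    exact integral_congr_ae (Eventually.of_forall fun x => by ring)
  rw [hq]

/-- The metrics of a system with i.i.d. blocks in terms of the moments of a block. -/
theorem systemHasMetrics_of_moments [IsProbabilityMeasure P]
    (h : IsBlockSystem P T H S ρ Z d s i j B₀ C₀) {lam : ℝ} (hlam : 0 < lam)
    (harr : ∀ (k : ℕ) (τ : ℝ), P.real {ω | arrival (fun n => T n ω) k ≤ τ} ≤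
      Real.exp (lam * τ) * (1 / 2) ^ k) {d₁ d₂ s₁ s₂ si i₁ i₂ j₁ j₂ : ℝ}
    (hd₁ : ∫ x, d x ∂ρ = d₁) (hd₂ : ∫ x, d x ^ 2 ∂ρ = d₂) (hs₁ : ∫ x, s x ∂ρ = s₁)
    (hs₂ : ∫ x, s x ^ 2 ∂ρ = s₂) (hsi : ∫ x, s x * i x ∂ρ = si) (hi₁ : ∫ x, i x ∂ρ = i₁)
    (hi₂ : ∫ x, i x ^ 2 ∂ρ = i₂) (hj₁ : ∫ x, j x ∂ρ = j₁) (hj₂ : ∫ x, j x ^ 2 ∂ρ = j₂) :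
    SystemHasMetrics P T H S (d₁ + (si + s₁ * j₁ + (i₂ + 2 * (i₁ * j₁) + j₂) / 2) / (i₁ + j₁))
      (d₁ + s₁ + (i₁ + j₁)) (d₂ - d₁ ^ 2 + (s₂ + 2 * si + i₂ - (s₁ + i₁) ^ 2) + (j₂ - j₁ ^ 2)) := by
  have hmain := h.systemHasMetrics hlam harr
  have hpos := h.integral_gapFun_pos
  rw [h.integral_gapFun, hi₁, hj₁] at hpos
  rw [h.integral_gapFun, h.integral_areaFun, h.integral_peakFun, h.variance_peakFun, hd₁, hd₂, hs₁,
    hs₂, hsi, hi₁, hi₂, hj₁, hj₂] at hmain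
  convert hmain using 1
  field_simp
  ring

end IsBlockSystem

/-! ### Regeneration -/

section Sequences

variable {E : Type*}

/-- The sequence with first term `e` and further terms `w`. -/
def cons (e : E) (w : ℕ → E) : ℕ → E
  | 0 => e
  | n + 1 => w n

/-- The sequence without its first term. -/
def tail (w : ℕ → E) : ℕ → E := fun n => w (n + 1)

@[simp] lemma cons_zero (e : E) (w : ℕ → E) : cons e w 0 = e := rfl
@[simp] lemma cons_succ (e : E) (w : ℕ → E) (n : ℕ) : cons e w (n + 1) = w n := rfl
@[simp] lemma tail_cons (e : E) (w : ℕ → E) : tail (cons e w) = w := rfl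
lemma tail_apply (w : ℕ → E) (n : ℕ) : tail w n = w (n + 1) := rfl

end Sequences

section Regeneration

variable {E : Type*} [MeasurableSpace E] (ρ : Measure E) [IsProbabilityMeasure ρ]

/-- Every finite index set sits in an initial segment, so rectangles over initial segments already
determine the product measure. This form suits inductions on the number of blocks. -/
lemma eq_iidLaw {q : Measure (ℕ → E)}
    (h : ∀ (n : ℕ) (t : ℕ → Set E), (∀ i, MeasurableSet (t i)) →
      q {z | ∀ i < n, z i ∈ t i} = ∏ i ∈ Finset.range n, ρ (t i)) : q = iidLaw ρ := by
  classical
  refine Measure.eq_infinitePi _ fun s t ht => ?_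
  obtain ⟨n, hn⟩ := s.exists_nat_subset_range
  -- Unconstrained coordinates of the initial segment receive the whole space, of measure one.
  have h1 := h n (fun i => if i ∈ s then t i else Set.univ) fun i => by
    split_ifs
    exacts [ht i, MeasurableSet.univ]
  have h2 : {z : ℕ → E | ∀ i < n, z i ∈ (if i ∈ s then t i else Set.univ)} =
      Set.pi (s : Set ℕ) t := by
    ext z
    simp only [Set.mem_ofPred_eq, Set.mem_pi, Finset.mem_coe]
    constructor
    · intro hz i hi
      have := hz i (Finset.mem_range.1 (hn hi))
      rwa [if_pos hi] at this
    · intro hz i _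
      split_ifs with hi
      exacts [hz i hi, trivial]
  rw [h2] at h1
  rw [h1]
  have h3 : ∀ i, ρ (if i ∈ s then t i else Set.univ) = if i ∈ s then ρ (t i) else 1 := by
    intro i
    split_ifs <;> simp
  simp only [h3]
  rw [← Finset.prod_filter, Finset.filter_mem_eq_inter, Finset.inter_eq_right.2 hn]

lemma measurable_cons : Measurable fun x : E × (ℕ → E) => cons x.1 x.2 := by
  refine measurable_pi_iff.2 fun n => ?_
  cases n with
  | zero => exact measurable_fst
  | succ n => exact (measurable_pi_apply n).comp measurable_snd

lemma measurable_tail : Measurable (tail : (ℕ → E) → ℕ → E) :=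
  measurable_pi_iff.2 fun n => measurable_pi_apply (n + 1)

lemma iidLaw_pi (n : ℕ) {t : ℕ → Set E} (ht : ∀ i, MeasurableSet (t i)) :
    iidLaw ρ {z | ∀ i < n, z i ∈ t i} = ∏ i ∈ Finset.range n, ρ (t i) := by
  have h := Measure.infinitePi_pi (μ := fun _ : ℕ => ρ) (s := Finset.range n) (t := t)
    fun i _ => ht i
  rw [← h]
  congr 1
  ext z
  simp

lemma measurePreserving_cons :
    MeasurePreserving (fun x : E × (ℕ → E) => cons x.1 x.2) (ρ.prod (iidLaw ρ)) (iidLaw ρ) := by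
  refine ⟨measurable_cons, eq_iidLaw ρ fun n t ht => ?_⟩
  have hm : MeasurableSet {z : ℕ → E | ∀ i < n, z i ∈ t i} := by
    simp only [Set.ofPred_forall]
    exact MeasurableSet.iInter fun i => MeasurableSet.iInter fun _ => measurable_pi_apply i (ht i)
  rw [Measure.map_apply measurable_cons hm]
  cases n with
  | zero => simp
  | succ n =>
    have : (fun x : E × (ℕ → E) => cons x.1 x.2) ⁻¹' {z | ∀ i < n + 1, z i ∈ t i} =
        t 0 ×ˢ {z | ∀ i < n, z i ∈ t (i + 1)} := by
      ext ⟨e, w⟩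
      simp only [Set.mem_preimage, Set.mem_ofPred_eq, Set.mem_prod]
      constructor
      · intro h
        exact ⟨h 0 (by omega), fun i hi => h (i + 1) (by omega)⟩
      · rintro ⟨h0, h⟩ i hi
        cases i with
        | zero => exact h0
        | succ i => exact h i (by omega)
    rw [this, Measure.prod_prod, iidLaw_pi ρ n fun i => ht (i + 1), Finset.prod_range_succ', mul_comm]

/-- This is conditioning on the first input: an i.i.d. sequence is a first term followed by an
independent i.i.d. sequence. -/
lemma lintegral_iidLaw {f : (ℕ → E) → ℝ≥0∞} (hf : Measurable f) :
    ∫⁻ w, f w ∂iidLaw ρ = ∫⁻ e, ∫⁻ w, f (cons e w) ∂iidLaw ρ ∂ρ := by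
  rw [← (measurePreserving_cons ρ).lintegral_comp hf, lintegral_prod]
  exact (hf.comp measurable_cons).aemeasurable

lemma iidLaw_apply {A : Set (ℕ → E)} (hA : MeasurableSet A) :
    iidLaw ρ A = ∫⁻ e, iidLaw ρ {w | cons e w ∈ A} ∂ρ := by
  rw [← lintegral_indicator_one hA, lintegral_iidLaw ρ (measurable_one.indicator hA)]
  refine lintegral_congr fun e => ?_
  rw [← lintegral_indicator_one (s := {w | cons e w ∈ A})]
  · rfl
  · exact (measurable_cons.comp measurable_prodMk_left) hA

variable {ρ}

/-- `Φ` is a block and `R` the fresh input after it. -/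
structure IsRegeneration {X F : Type*} [MeasurableSpace X] [MeasurableSpace F] (q : Measure X)
    (Φ : X → F) (R : X → X) : Prop where
  measurable_block : Measurable Φ
  measurable_rest : Measurable R
  indep : ∀ (s : Set F) (t : Set X), MeasurableSet s → MeasurableSet t →
    q (Φ ⁻¹' s ∩ R ⁻¹' t) = q (Φ ⁻¹' s) * q t

namespace IsRegeneration

variable {X F : Type*} [MeasurableSpace X] [MeasurableSpace F] {q : Measure X}
  {Φ : X → F} {R : X → X}

lemma measurable_iterate (h : IsRegeneration q Φ R) (l : ℕ) : Measurable (R^[l]) :=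
  h.measurable_rest.iterate l

variable [IsProbabilityMeasure q]

/-- The successive blocks are i.i.d. -/
lemma measurePreserving_blocks (h : IsRegeneration q Φ R) :
    have := Measure.isProbabilityMeasure_map (μ := q) h.measurable_block.aemeasurable
    MeasurePreserving (fun w l => Φ (R^[l] w)) q (iidLaw (q.map Φ)) := by
  have := Measure.isProbabilityMeasure_map (μ := q) h.measurable_block.aemeasurable
  have hm : Measurable fun w l => Φ (R^[l] w) :=
    measurable_pi_iff.2 fun l => h.measurable_block.comp (h.measurable_iterate l)
  refine ⟨hm, eq_iidLaw _ fun n => ?_⟩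
  have hms : ∀ (n : ℕ) (t : ℕ → Set F), (∀ i, MeasurableSet (t i)) →
      MeasurableSet {z : ℕ → F | ∀ i < n, z i ∈ t i} := fun n t ht => by
    simp only [Set.ofPred_forall]
    exact MeasurableSet.iInter fun i => MeasurableSet.iInter fun _ => measurable_pi_apply i (ht i)
  induction n with
  | zero =>
    intro t ht
    rw [Measure.map_apply hm (hms 0 t ht)]
    simp
  | succ n ih =>
    intro t ht
    -- The later blocks of `w` are the blocks of `R w`. Independence splits off the first factor,
    -- and the induction hypothesis applies to the shifted sets.
    rw [Measure.map_apply hm (hms _ t ht), Finset.prod_range_succ', mul_comm,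
      ← ih (fun i => t (i + 1)) fun i => ht _, Measure.map_apply hm (hms _ _ fun i => ht _),
      Measure.map_apply h.measurable_block (ht 0), ← h.indep _ _ (ht 0) (hm (hms _ _ fun i => ht _))]
    congr 1
    ext w
    simp only [Set.mem_preimage, Set.mem_ofPred_eq, Set.mem_inter_iff]
    constructor
    · intro hw
      exact ⟨hw 0 (by omega), fun i hi => by
        have := hw (i + 1) (by omega)
        rwa [Function.iterate_succ_apply] at this⟩
    · rintro ⟨h0, hw⟩ i hi
      cases i with
      | zero => exact h0
      | succ i => rw [Function.iterate_succ_apply]; exact hw i (by omega)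

end IsRegeneration

/-- A regeneration can be checked separately for every value of the first input. -/
lemma IsRegeneration.of_cons {F : Type*} [MeasurableSpace F] {Φ : (ℕ → E) → F}
    {R : (ℕ → E) → ℕ → E} (hΦ : Measurable Φ) (hR : Measurable R)
    (h : ∀ᵐ e ∂ρ, ∀ (s : Set F) (t : Set (ℕ → E)), MeasurableSet s → MeasurableSet t →
      iidLaw ρ {w | Φ (cons e w) ∈ s ∧ R (cons e w) ∈ t} =
        iidLaw ρ {w | Φ (cons e w) ∈ s} * iidLaw ρ t) :
    IsRegeneration (iidLaw ρ) Φ R where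
  measurable_block := hΦ
  measurable_rest := hR
  indep s t hs ht := by
    rw [iidLaw_apply ρ ((hΦ hs).inter (hR ht)), iidLaw_apply ρ (hΦ hs), ← lintegral_mul_const]
    · refine lintegral_congr_ae ?_
      filter_upwards [h] with e he
      exact he s t hs ht
    · exact measurable_measure_prodMk_left (measurable_cons (hΦ hs))

/-- Every pattern of three consecutive terms with positive probability occurs. -/
lemma ae_exists_mem_of_pos {A : Set (E × E × E)} (hA : MeasurableSet A)
    (hpos : 0 < iidLaw ρ {w | (w 0, w 1, w 2) ∈ A}) :
    ∀ᵐ w ∂iidLaw ρ, ∃ k, (w k, w (k + 1), w (k + 2)) ∈ A := by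
  have hm : Measurable fun w : ℕ → E => (w 0, w 1, w 2) := by fun_prop
  have hF : Measurable (A.indicator fun _ => (1 : ℝ)) := measurable_const.indicator hA
  have hi : Integrable (fun w : ℕ → E => A.indicator (fun _ => (1 : ℝ)) (w 0, w 1, w 2))
      (iidLaw ρ) := by
    refine Integrable.mono' (integrable_const 1) (hF.comp hm).aestronglyMeasurable
      (Eventually.of_forall fun w => ?_)
    rw [Real.norm_eq_abs]
    by_cases hw : (w 0, w 1, w 2) ∈ A <;> simp [hw]
  have hint : ∫ w, A.indicator (fun _ => (1 : ℝ)) (w 0, w 1, w 2) ∂iidLaw ρ =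
      (iidLaw ρ).real {w | (w 0, w 1, w 2) ∈ A} :=
    (integral_indicator_one (hm hA)).symm ▸ rfl
  -- The frequency of the pattern converges to its probability, whereas a pattern that never occurs
  -- has frequency zero.
  filter_upwards [tendsto_sum_div_of_three ρ hF hi] with w hw
  by_contra hcon
  push Not at hcon
  have h0 : ∀ n : ℕ, (∑ l ∈ Finset.range n,
      A.indicator (fun _ => (1 : ℝ)) (w l, w (l + 1), w (l + 2))) / n = 0 := fun n => by
    rw [Finset.sum_eq_zero fun l _ => Set.indicator_of_notMem (hcon l) _, zero_div]
  simp only [h0] at hw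
  have := tendsto_nhds_unique hw tendsto_const_nhds
  rw [hint] at this
  rw [Measure.real, ENNReal.toReal_eq_zero_iff] at this
  rcases this with h | h
  · exact hpos.ne' h
  · exact measure_ne_top _ _ h

end Regeneration

/-! ### The exponential distribution -/

section Exponential

variable {lam : ℝ}

lemma expMeasure_eq (lam : ℝ) : expMeasure lam = volume.withDensity (exponentialPDF lam) := rfl

lemma measurable_exponentialPDF (lam : ℝ) : Measurable (exponentialPDF lam) :=
  (measurable_exponentialPDFReal lam).ennreal_ofReal

lemma lintegral_expMeasure (lam : ℝ) (f : ℝ → ℝ≥0∞) (hf : Measurable f) :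
    ∫⁻ t, f t ∂expMeasure lam = ∫⁻ t, exponentialPDF lam t * f t := by
  rw [expMeasure_eq, lintegral_withDensity_eq_lintegral_mul _ (measurable_exponentialPDF lam) hf]
  rfl

/-- The exponential distribution is memoryless. -/
lemma lintegral_expMeasure_sub (lam : ℝ) {x : ℝ} (hx : 0 ≤ x) {g : ℝ → ℝ≥0∞}
    (hg : Measurable g) :
    ∫⁻ t, (Set.Ici x).indicator (fun t => g (t - x)) t ∂expMeasure lam =
      ENNReal.ofReal (Real.exp (-(lam * x))) * ∫⁻ t, g t ∂expMeasure lam := by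
  have hm : Measurable ((Set.Ici x).indicator fun t => g (t - x)) :=
    (hg.comp (measurable_id.sub_const x)).indicator measurableSet_Ici
  rw [lintegral_expMeasure lam _ hm, lintegral_expMeasure lam _ hg,
    ← lintegral_add_right_eq_self _ x, ← lintegral_const_mul _
    ((measurable_exponentialPDF lam).fun_mul hg)]
  refine lintegral_congr fun t => ?_
  by_cases ht : 0 ≤ t
  · have h1 : t + x ∈ Set.Ici x := by simp [ht]
    rw [Set.indicator_of_mem h1, exponentialPDF_of_nonneg (by positivity),
      exponentialPDF_of_nonneg ht, add_sub_cancel_right, ← mul_assoc,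
      ← ENNReal.ofReal_mul (Real.exp_pos _).le]
    congr 2
    rw [mul_left_comm, ← Real.exp_add]
    congr 2
    ring
  · have h1 : t + x ∉ Set.Ici x := by simpa using ht
    rw [Set.indicator_of_notMem h1, exponentialPDF_of_neg (not_le.1 ht)]
    simp

lemma expMeasure_Ici (hlam : 0 < lam) {x : ℝ} (hx : 0 ≤ x) :
    expMeasure lam (Set.Ici x) = ENNReal.ofReal (Real.exp (-(lam * x))) := by
  have := isProbabilityMeasure_expMeasure hlam
  have h := lintegral_expMeasure_sub lam hx (g := fun _ => 1) measurable_const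
  rw [lintegral_indicator_const measurableSet_Ici, lintegral_const] at h
  simpa using h

lemma expMeasure_Iic_zero (lam : ℝ) : expMeasure lam (Set.Iic 0) = 0 := by
  rw [expMeasure_eq, withDensity_apply _ measurableSet_Iic]
  rw [setLIntegral_congr Iio_ae_eq_Iic.symm]
  exact lintegral_exponentialPDF_of_nonpos le_rfl

lemma ae_pos_expMeasure (lam : ℝ) : ∀ᵐ t ∂expMeasure lam, 0 < t := by
  rw [ae_iff]
  convert expMeasure_Iic_zero lam using 2
  ext t
  simp

end Exponential

/-! ### Races of inter-arrival times against a threshold -/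

section Race

variable {C : Type*} (x : C → ℝ) (step : C → ℝ × ℝ → C)

/-- The state after `n` lost races, when it changes according to `step`. -/
def stateAt (c : C) (w : ℕ → ℝ × ℝ) : ℕ → C
  | 0 => c
  | n + 1 => step (stateAt c w n) (w n)

/-- The race `n` is the first one that is won: the inter-arrival time is at least the threshold. -/
def StopsAt (c : C) (w : ℕ → ℝ × ℝ) (n : ℕ) : Prop :=
  (∀ k < n, (w k).1 < x (stateAt step c w k)) ∧ x (stateAt step c w n) ≤ (w n).1

/-- The index of the first race that is won. -/
noncomputable def stopIndex (c : C) (w : ℕ → ℝ × ℝ) : ℕ :=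
  sInf {n | x (stateAt step c w n) ≤ (w n).1}

/-- The state at the first race that is won. -/
noncomputable def finalState (c : C) (w : ℕ → ℝ × ℝ) : C :=
  stateAt step c w (stopIndex x step c w)

/-- The input after race `n`, the inter-arrival time being reduced by the threshold. -/
def restAt (c : C) (w : ℕ → ℝ × ℝ) (n : ℕ) : ℕ → ℝ × ℝ :=
  cons ((w n).1 - x (stateAt step c w n), (w n).2) fun k => w (n + 1 + k)

/-- The input after the first race that is won. -/
noncomputable def restInput (c : C) (w : ℕ → ℝ × ℝ) : ℕ → ℝ × ℝ :=
  restAt x step c w (stopIndex x step c w)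

variable {x step}

lemma stateAt_cons (c : C) (e : ℝ × ℝ) (w : ℕ → ℝ × ℝ) (n : ℕ) :
    stateAt step c (cons e w) (n + 1) = stateAt step (step c e) w n := by
  induction n with
  | zero => rfl
  | succ n ih => rw [stateAt, ih, cons_succ]; rfl

lemma stopsAt_cons_zero (c : C) (e : ℝ × ℝ) (w : ℕ → ℝ × ℝ) :
    StopsAt x step c (cons e w) 0 ↔ x c ≤ e.1 := by
  simp [StopsAt, stateAt]

lemma stopsAt_cons_succ (c : C) (e : ℝ × ℝ) (w : ℕ → ℝ × ℝ) (n : ℕ) :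
    StopsAt x step c (cons e w) (n + 1) ↔ e.1 < x c ∧ StopsAt x step (step c e) w n := by
  simp only [StopsAt, stateAt_cons, cons_succ]
  constructor
  · rintro ⟨h1, h2⟩
    refine ⟨h1 0 (by omega), fun k hk => ?_, h2⟩
    have := h1 (k + 1) (by omega)
    rwa [stateAt_cons] at this
  · rintro ⟨h0, h1, h2⟩
    refine ⟨fun k hk => ?_, h2⟩
    cases k with
    | zero => exact h0
    | succ k => rw [stateAt_cons]; exact h1 k (by omega)

lemma restAt_cons_zero (c : C) (e : ℝ × ℝ) (w : ℕ → ℝ × ℝ) :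
    restAt x step c (cons e w) 0 = cons (e.1 - x c, e.2) w := by
  ext k : 1
  cases k with
  | zero => rfl
  | succ k => simp only [restAt, cons_succ, show 0 + 1 + k = k + 1 by omega]

lemma restAt_cons_succ (c : C) (e : ℝ × ℝ) (w : ℕ → ℝ × ℝ) (n : ℕ) :
    restAt x step c (cons e w) (n + 1) = restAt x step (step c e) w n := by
  ext k : 1
  cases k with
  | zero => simp only [restAt, cons_zero, cons_succ, stateAt_cons]
  | succ k => simp only [restAt, cons_succ, show n + 1 + 1 + k = n + 1 + k + 1 by omega]

lemma StopsAt.stopIndex_eq {c : C} {w : ℕ → ℝ × ℝ} {n : ℕ} (h : StopsAt x step c w n) :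
    stopIndex x step c w = n := by
  refine le_antisymm (Nat.sInf_le h.2) ?_
  by_contra hlt
  have hne : {n | x (stateAt step c w n) ≤ (w n).1}.Nonempty := ⟨n, h.2⟩
  exact absurd (Nat.sInf_mem hne) (not_le.2 (h.1 _ (not_le.1 hlt)))

lemma exists_stopsAt {c : C} {w : ℕ → ℝ × ℝ} (h : ∃ n, x (stateAt step c w n) ≤ (w n).1) :
    StopsAt x step c w (stopIndex x step c w) :=
  ⟨fun _ hk => not_le.1 fun hle => Nat.notMem_of_lt_sInf hk hle, Nat.sInf_mem h⟩

variable [MeasurableSpace C]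

lemma measurable_stateAt (hstep : Measurable fun y : C × (ℝ × ℝ) => step y.1 y.2) (n : ℕ) :
    Measurable fun y : C × (ℕ → ℝ × ℝ) => stateAt step y.1 y.2 n := by
  induction n with
  | zero => exact measurable_fst
  | succ n ih => exact hstep.comp (ih.prodMk ((measurable_pi_apply n).comp measurable_snd))

lemma measurable_restAt (hx : Measurable x)
    (hstep : Measurable fun y : C × (ℝ × ℝ) => step y.1 y.2) (n : ℕ) :
    Measurable fun y : C × (ℕ → ℝ × ℝ) => restAt x step y.1 y.2 n := by
  have hs := measurable_stateAt hstep n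
  refine measurable_cons.comp (Measurable.prodMk ?_ ?_)
  · exact Measurable.prodMk (by fun_prop) (by fun_prop)
  · fun_prop

lemma measurableSet_stopsAt (hx : Measurable x)
    (hstep : Measurable fun y : C × (ℝ × ℝ) => step y.1 y.2) (n : ℕ) :
    MeasurableSet {y : C × (ℕ → ℝ × ℝ) | StopsAt x step y.1 y.2 n} := by
  have hs := measurable_stateAt hstep
  have : {y : C × (ℕ → ℝ × ℝ) | StopsAt x step y.1 y.2 n} =
      (⋂ k, ⋂ (_ : k < n), {y | (y.2 k).1 < x (stateAt step y.1 y.2 k)}) ∩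
        {y | x (stateAt step y.1 y.2 n) ≤ (y.2 n).1} := by
    ext y
    simp [StopsAt]
  rw [this]
  exact (MeasurableSet.iInter fun k => MeasurableSet.iInter fun _ =>
    measurableSet_lt (by fun_prop) (by fun_prop)).inter
      (measurableSet_le (by fun_prop) (by fun_prop))

/-- The index takes countably many values, so it suffices to treat its fibres. -/
lemma measurable_stopIndex (hx : Measurable x)
    (hstep : Measurable fun y : C × (ℝ × ℝ) => step y.1 y.2) :
    Measurable fun y : C × (ℕ → ℝ × ℝ) => stopIndex x step y.1 y.2 := by
  classical
  refine measurable_to_countable' fun n => ?_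
  -- When no race is won, `sInf ∅ = 0` puts the input into the fibre over `0`, which explains the
  -- extra set for `n = 0`.
  have : (fun y : C × (ℕ → ℝ × ℝ) => stopIndex x step y.1 y.2) ⁻¹' {n} =
      {y | StopsAt x step y.1 y.2 n} ∪
        if n = 0 then {y | ∀ k, (y.2 k).1 < x (stateAt step y.1 y.2 k)} else ∅ := by
    ext y
    simp only [Set.mem_preimage, Set.mem_singleton_iff, Set.mem_union, Set.mem_ofPred_eq]
    by_cases hex : ∃ n, x (stateAt step y.1 y.2 n) ≤ (y.2 n).1
    · have h1 : ¬ ∀ k, (y.2 k).1 < x (stateAt step y.1 y.2 k) := by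
        push Not
        exact hex
      have h2 := exists_stopsAt hex
      constructor
      · rintro rfl
        exact Or.inl h2
      · rintro (h | h)
        · exact h.stopIndex_eq
        · split_ifs at h
          · exact absurd h h1
          · exact absurd h (Set.notMem_empty _)
    · have h0 : stopIndex x step y.1 y.2 = 0 := by
        rw [stopIndex, Nat.sInf_eq_zero]
        right
        ext k
        simp only [Set.mem_ofPred_eq, Set.mem_empty_iff_false, iff_false]
        exact fun h => hex ⟨k, h⟩
      push Not at hex
      rw [h0]
      constructor
      · rintro rfl
        right
        simpa using hex
      · rintro (h | h)
        · exact absurd h.2 (not_le.2 (hex n))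
        · split_ifs at h with hn
          · exact hn.symm
          · exact absurd h (Set.notMem_empty _)
  rw [this]
  refine (measurableSet_stopsAt hx hstep n).union ?_
  split_ifs
  · have hs := measurable_stateAt hstep
    simp only [Set.ofPred_forall]
    exact MeasurableSet.iInter fun k => measurableSet_lt (by fun_prop) (by fun_prop)
  · exact MeasurableSet.empty

/-- The state at a random index is a jointly measurable function of the input and the index, the
index set being countable, evaluated at the measurable stopping index. -/
lemma measurable_finalState (hx : Measurable x)
    (hstep : Measurable fun y : C × (ℝ × ℝ) => step y.1 y.2) :
    Measurable fun y : C × (ℕ → ℝ × ℝ) => finalState x step y.1 y.2 := by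
  have h : Measurable fun z : (C × (ℕ → ℝ × ℝ)) × ℕ => stateAt step z.1.1 z.1.2 z.2 :=
    measurable_from_prod_countable_left fun n => measurable_stateAt hstep n
  exact h.comp (measurable_id.prodMk (measurable_stopIndex hx hstep))

lemma measurable_restInput (hx : Measurable x)
    (hstep : Measurable fun y : C × (ℝ × ℝ) => step y.1 y.2) :
    Measurable fun y : C × (ℕ → ℝ × ℝ) => restInput x step y.1 y.2 := by
  have h : Measurable fun z : (C × (ℕ → ℝ × ℝ)) × ℕ => restAt x step z.1.1 z.1.2 z.2 :=
    measurable_from_prod_countable_left fun n => measurable_restAt hx hstep n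
  exact h.comp (measurable_id.prodMk (measurable_stopIndex hx hstep))

end Race

/-! ### Independence of the first won race from the remaining input. -/

section Race

variable {C : Type*} [MeasurableSpace C] {x : C → ℝ} {step : C → ℝ × ℝ → C}
  {lam : ℝ} {ν : Measure ℝ} [IsProbabilityMeasure ν]

/-- The law of the input: i.i.d. pairs of an exponential inter-arrival time and a service time. -/
noncomputable abbrev pairLaw (lam : ℝ) (ν : Measure ℝ) : Measure (ℝ × ℝ) :=
  (expMeasure lam).prod ν

variable [IsProbabilityMeasure (expMeasure lam)]

/-- Condition on the first input. A lost race only changes the state, which reduces `n + 1` to `n`.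
A race won at once leaves, by memorylessness, a fresh exponential time above the threshold. The
second component at the winning index has not entered the state, so it stays in the remaining input
with its original law. -/
lemma iidLaw_stopsAt (hlam : 0 < lam) (hx0 : ∀ c, 0 ≤ x c) (hx : Measurable x)
    (hstep : Measurable fun y : C × (ℝ × ℝ) => step y.1 y.2) (n : ℕ) (c : C) {s : Set C}
    {t : Set (ℕ → ℝ × ℝ)} (hs : MeasurableSet s) (ht : MeasurableSet t) :
    iidLaw (pairLaw lam ν) {w | StopsAt x step c w n ∧ stateAt step c w n ∈ s ∧
        restAt x step c w n ∈ t} =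
      iidLaw (pairLaw lam ν) {w | StopsAt x step c w n ∧ stateAt step c w n ∈ s} *
        iidLaw (pairLaw lam ν) t := by
  have hmc : ∀ c : C, Measurable fun w : ℕ → ℝ × ℝ => (c, w) := fun c => measurable_prodMk_left
  have hms : ∀ n c, MeasurableSet {w | StopsAt x step c w n ∧ stateAt step c w n ∈ s} :=
    fun n c => (hmc c (measurableSet_stopsAt hx hstep n)).inter
      ((measurable_stateAt hstep n).comp (hmc c) hs)
  have hms' : ∀ n c, MeasurableSet {w | StopsAt x step c w n ∧ stateAt step c w n ∈ s ∧
      restAt x step c w n ∈ t} := fun n c =>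
    (hmc c (measurableSet_stopsAt hx hstep n)).inter
      (((measurable_stateAt hstep n).comp (hmc c) hs).inter
        ((measurable_restAt hx hstep n).comp (hmc c) ht))
  induction n generalizing c with
  | zero =>
    by_cases hc : c ∈ s
    · have hG : Measurable fun e : ℝ × ℝ => iidLaw (pairLaw lam ν) {w | cons e w ∈ t} :=
        measurable_measure_prodMk_left (measurable_cons ht)
      rw [iidLaw_apply _ (hms' 0 c), iidLaw_apply _ (hms 0 c)]
      have h1 : ∀ e : ℝ × ℝ, iidLaw (pairLaw lam ν) {w | cons e w ∈
          {w | StopsAt x step c w 0 ∧ stateAt step c w 0 ∈ s ∧ restAt x step c w 0 ∈ t}} =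
          (Set.Ici (x c)).indicator (fun u =>
            iidLaw (pairLaw lam ν) {w | cons (u - x c, e.2) w ∈ t}) e.1 := by
        intro e
        simp only [Set.mem_ofPred_eq, stopsAt_cons_zero, restAt_cons_zero, stateAt, hc, true_and]
        by_cases he : x c ≤ e.1
        · simp [he]
        · simp [he]
      have h2 : ∀ e : ℝ × ℝ, iidLaw (pairLaw lam ν) {w | cons e w ∈
          {w | StopsAt x step c w 0 ∧ stateAt step c w 0 ∈ s}} =
          (Set.Ici (x c)).indicator (fun _ => 1) e.1 := by
        intro e
        simp only [Set.mem_ofPred_eq, stopsAt_cons_zero, stateAt, hc, and_true]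
        by_cases he : x c ≤ e.1
        · simp [he]
        · simp [he]
      simp only [h1, h2]
      have hm1 : Measurable fun e : ℝ × ℝ => (Set.Ici (x c)).indicator (fun u =>
            iidLaw (pairLaw lam ν) {w | cons (u - x c, e.2) w ∈ t}) e.1 := by
        have : (fun e : ℝ × ℝ => (Set.Ici (x c)).indicator (fun u =>
            iidLaw (pairLaw lam ν) {w | cons (u - x c, e.2) w ∈ t}) e.1) =
            (Prod.fst ⁻¹' Set.Ici (x c)).indicator fun e : ℝ × ℝ =>
              iidLaw (pairLaw lam ν) {w | cons (e.1 - x c, e.2) w ∈ t} := rfl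
        rw [this]
        refine Measurable.indicator ?_ (measurable_fst measurableSet_Ici)
        exact hG.comp (by fun_prop : Measurable fun e : ℝ × ℝ => (e.1 - x c, e.2))
      rw [lintegral_prod _ hm1.aemeasurable, lintegral_prod _ (by
        refine Measurable.aemeasurable ?_
        exact (measurable_const.indicator measurableSet_Ici).comp measurable_fst)]
      have h3 : ∀ u, ∫⁻ y, (Set.Ici (x c)).indicator (fun u =>
          iidLaw (pairLaw lam ν) {w | cons (u - x c, y) w ∈ t}) u ∂ν =
          (Set.Ici (x c)).indicator (fun u => (fun v => ∫⁻ y,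
            iidLaw (pairLaw lam ν) {w | cons (v, y) w ∈ t} ∂ν) (u - x c)) u := by
        intro u
        by_cases hu : u ∈ Set.Ici (x c)
        · simp only [Set.indicator_of_mem hu]
        · simp only [Set.indicator_of_notMem hu, lintegral_zero]
      simp only [h3, lintegral_const, measure_univ, mul_one]
      -- Memorylessness is applied after averaging over the service time of the winning input and
      -- over all later inputs.
      have hmem := lintegral_expMeasure_sub lam (hx0 c) (g := fun v => ∫⁻ y,
        iidLaw (pairLaw lam ν) {w | cons (v, y) w ∈ t} ∂ν) hG.lintegral_prod_right'
      beta_reduce at hmem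
      rw [hmem, lintegral_indicator_const measurableSet_Ici, one_mul, expMeasure_Ici hlam (hx0 c),
        iidLaw_apply _ ht, lintegral_prod _ hG.aemeasurable]
    · simp [stateAt, hc]
  | succ n ih =>
    rw [iidLaw_apply _ (hms' _ c), iidLaw_apply _ (hms _ c), ← lintegral_mul_const]
    · refine lintegral_congr fun e => ?_
      simp only [Set.mem_ofPred_eq, stopsAt_cons_succ, stateAt_cons, restAt_cons_succ]
      by_cases he : e.1 < x c
      · simp only [he, true_and]
        exact ih (step c e)
      · simp [he]
    · exact measurable_measure_prodMk_left (measurable_cons (hms _ c))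

/-- The state at the first race that is won is independent of the remaining input, which is as
fresh. -/
lemma iidLaw_finalState_restInput (hlam : 0 < lam) (hx0 : ∀ c, 0 ≤ x c) (hx : Measurable x)
    (hstep : Measurable fun y : C × (ℝ × ℝ) => step y.1 y.2) {c : C}
    (hwin : ∀ᵐ w ∂iidLaw (pairLaw lam ν), ∃ n, x (stateAt step c w n) ≤ (w n).1) {s : Set C}
    {t : Set (ℕ → ℝ × ℝ)} (hs : MeasurableSet s) (ht : MeasurableSet t) :
    iidLaw (pairLaw lam ν) {w | finalState x step c w ∈ s ∧ restInput x step c w ∈ t} =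
      iidLaw (pairLaw lam ν) {w | finalState x step c w ∈ s} * iidLaw (pairLaw lam ν) t := by
  have hmc : Measurable fun w : ℕ → ℝ × ℝ => (c, w) := measurable_prodMk_left
  -- Almost surely there is exactly one first win, so each event splits disjointly according to its
  -- index, and the claim can be summed from the fixed-index version.
  have hsum : ∀ A : Set (ℕ → ℝ × ℝ), MeasurableSet A → iidLaw (pairLaw lam ν) A =
      ∑' n, iidLaw (pairLaw lam ν) {w | StopsAt x step c w n ∧ w ∈ A} := by
    intro A hA
    have h1 : A =ᵐ[iidLaw (pairLaw lam ν)] ⋃ n, {w | StopsAt x step c w n ∧ w ∈ A} := by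
      filter_upwards [hwin] with w hw
      refine propext ⟨fun h => Set.mem_iUnion.2 ⟨_, exists_stopsAt hw, h⟩, fun h => ?_⟩
      obtain ⟨n, hn⟩ := Set.mem_iUnion.1 h
      exact hn.2
    rw [measure_congr h1, measure_iUnion]
    · intro a b hab
      refine Set.disjoint_left.2 fun w ha hb => hab ?_
      rw [← ha.1.stopIndex_eq, hb.1.stopIndex_eq]
    · exact fun n => (hmc (measurableSet_stopsAt hx hstep n)).inter hA
  have hmF := (measurable_finalState hx hstep).comp hmc
  have hmR := (measurable_restInput hx hstep).comp hmc
  rw [hsum {w | finalState x step c w ∈ s ∧ restInput x step c w ∈ t}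
    ((hmF hs).inter (hmR ht)), hsum {w | finalState x step c w ∈ s} (hmF hs), ← ENNReal.tsum_mul_right]
  refine tsum_congr fun n => ?_
  have e1 : {w | StopsAt x step c w n ∧ w ∈ {w | finalState x step c w ∈ s}} =
      {w | StopsAt x step c w n ∧ stateAt step c w n ∈ s} := by
    ext w
    simp only [Set.mem_ofPred_eq]
    refine and_congr_right fun h => ?_
    rw [finalState, h.stopIndex_eq]
  have e2 : {w | StopsAt x step c w n ∧ w ∈ {w | finalState x step c w ∈ s ∧
      restInput x step c w ∈ t}} =
      {w | StopsAt x step c w n ∧ stateAt step c w n ∈ s ∧ restAt x step c w n ∈ t} := by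
    ext w
    simp only [Set.mem_ofPred_eq]
    refine and_congr_right fun h => ?_
    rw [finalState, restInput, h.stopIndex_eq]
  have e3 := iidLaw_stopsAt (ν := ν) hlam hx0 hx hstep n c hs ht
  rw [← e1, ← e2] at e3
  exact e3

end Race

/-! ### Integrals against the exponential distribution -/

section Exponential

variable {lam : ℝ}

lemma integral_expMeasure (f : ℝ → ℝ) (hlam : 0 < lam) :
    ∫ x, f x ∂expMeasure lam = ∫ x in Set.Ioi 0, lam * Real.exp (-(lam * x)) * f x := by
  have h1 : ∀ᵐ x : ℝ, exponentialPDF lam x < ∞ := by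
    filter_upwards with x
    exact ENNReal.ofReal_lt_top
  rw [expMeasure_eq, integral_withDensity_eq_integral_toReal_smul₀
    (measurable_exponentialPDF lam).aemeasurable h1, ← integral_indicator measurableSet_Ioi]
  refine integral_congr_ae ?_
  filter_upwards [Measure.ae_ne volume (0 : ℝ)] with x hx
  rcases lt_or_gt_of_ne hx with h | h
  · rw [exponentialPDF_of_neg h, Set.indicator_of_notMem (by simp [h.le])]
    simp
  · rw [exponentialPDF_of_nonneg h.le, Set.indicator_of_mem (by simp [h]),
      ENNReal.toReal_ofReal (by positivity), smul_eq_mul]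

lemma exp_mul_pow_mul_exp (s : ℝ) (k : ℕ) (x : ℝ) :
    lam * Real.exp (-(lam * x)) * (x ^ k * Real.exp (-s * x)) =
      lam * (x ^ (((k : ℝ) + 1) - 1) * Real.exp (-((lam + s) * x))) := by
  rw [add_sub_cancel_right, Real.rpow_natCast, show -((lam + s) * x) = -(lam * x) + -s * x by ring,
    Real.exp_add]
  ring

lemma integral_pow_mul_exp_expMeasure (hlam : 0 < lam) {s : ℝ} (hs : 0 ≤ s) (k : ℕ) :
    ∫ x, x ^ k * Real.exp (-s * x) ∂expMeasure lam = k.factorial * lam / (lam + s) ^ (k + 1) := by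
  have hp : 0 < lam + s := by positivity
  rw [integral_expMeasure _ hlam]
  simp only [exp_mul_pow_mul_exp]
  rw [integral_const_mul, Real.integral_rpow_mul_exp_neg_mul_Ioi (by positivity) hp,
    Real.Gamma_nat_eq_factorial]
  norm_cast
  rw [one_div, inv_pow]
  field_simp

/-- The Bochner integral of a non-integrable function is `0`, while the integral computed above is
positive. -/
lemma integrable_pow_mul_exp_expMeasure (hlam : 0 < lam) {s : ℝ} (hs : 0 ≤ s) (k : ℕ) :
    Integrable (fun x : ℝ => x ^ k * Real.exp (-s * x)) (expMeasure lam) := by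
  by_contra h
  have h1 := integral_undef h
  rw [integral_pow_mul_exp_expMeasure hlam hs] at h1
  have : 0 < (k.factorial * lam / (lam + s) ^ (k + 1) : ℝ) := by positivity
  exact this.ne' h1

lemma integral_pow_expMeasure (hlam : 0 < lam) (k : ℕ) :
    ∫ x, x ^ k ∂expMeasure lam = k.factorial / lam ^ k := by
  have h := integral_pow_mul_exp_expMeasure hlam le_rfl k
  simp only [neg_zero, zero_mul, Real.exp_zero, mul_one, add_zero] at h
  rw [h, pow_succ]
  field_simp

lemma integrable_pow_expMeasure (hlam : 0 < lam) (k : ℕ) :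
    Integrable (fun x : ℝ => x ^ k) (expMeasure lam) := by
  simpa using integrable_pow_mul_exp_expMeasure hlam le_rfl k

lemma memLp_id_expMeasure (hlam : 0 < lam) : MemLp (fun x : ℝ => x) 2 (expMeasure lam) :=
  (memLp_two_iff_integrable_sq (by fun_prop)).2 (integrable_pow_expMeasure hlam 2)

lemma integral_id_expMeasure (hlam : 0 < lam) : ∫ x, x ∂expMeasure lam = 1 / lam := by
  simpa using integral_pow_expMeasure hlam 1

lemma integral_sq_expMeasure (hlam : 0 < lam) : ∫ x, x ^ 2 ∂expMeasure lam = 2 / lam ^ 2 := by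
  simpa [Nat.factorial] using integral_pow_expMeasure hlam 2

/-- The exponential distribution is memoryless. -/
lemma map_sub_restrict_expMeasure (lam : ℝ) {h : ℝ} (hh : 0 ≤ h) :
    ((expMeasure lam).restrict (Set.Ici h)).map (fun t => t - h) =
      ENNReal.ofReal (Real.exp (-(lam * h))) • expMeasure lam := by
  ext A hA
  have := lintegral_expMeasure_sub lam hh (g := A.indicator 1) (measurable_one.indicator hA)
  rw [lintegral_indicator_one hA] at this
  rw [Measure.map_apply (by fun_prop) hA, Measure.smul_apply, smul_eq_mul, ← this,
    Measure.restrict_apply ((by fun_prop : Measurable fun t : ℝ => t - h) hA),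
    ← lintegral_indicator_one]
  · refine lintegral_congr fun t => ?_
    by_cases h1 : t ∈ Set.Ici h <;> by_cases h2 : t - h ∈ A <;> simp [Set.indicator, h1, h2]
  · exact ((by fun_prop : Measurable fun t : ℝ => t - h) hA).inter measurableSet_Ici

lemma setIntegral_sub_expMeasure (lam : ℝ) {h : ℝ} (hh : 0 ≤ h) {g : ℝ → ℝ} (hg : Measurable g) :
    ∫ t in Set.Ici h, g (t - h) ∂expMeasure lam =
      Real.exp (-(lam * h)) * ∫ t, g t ∂expMeasure lam := by
  rw [← integral_map (φ := fun t => t - h) (by fun_prop) hg.aestronglyMeasurable,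
    map_sub_restrict_expMeasure lam hh, integral_smul_measure,
    ENNReal.toReal_ofReal (Real.exp_pos _).le, smul_eq_mul]

lemma integral_excess_expMeasure (hlam : 0 < lam) {h : ℝ} (hh : 0 ≤ h) {k : ℕ} (hk : k ≠ 0) :
    ∫ t, max (t - h) 0 ^ k ∂expMeasure lam =
      Real.exp (-(lam * h)) * (k.factorial / lam ^ k) := by
  rw [← integral_pow_expMeasure hlam k, ← setIntegral_sub_expMeasure lam hh (by fun_prop),
    ← integral_indicator measurableSet_Ici]
  refine integral_congr_ae (Eventually.of_forall fun t => ?_)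
  by_cases ht : h ≤ t
  · simp [Set.indicator, ht]
  · simp [Set.indicator, ht, (not_le.1 ht).le, hk]

lemma setIntegral_Ici_expMeasure (lam : ℝ) {h : ℝ} (hh : 0 ≤ h) {g : ℝ → ℝ} (hg : Measurable g) :
    ∫ t in Set.Ici h, g t ∂expMeasure lam =
      Real.exp (-(lam * h)) * ∫ t, g (t + h) ∂expMeasure lam := by
  rw [← setIntegral_sub_expMeasure lam hh (g := fun t => g (t + h)) (by fun_prop)]
  simp

/-- Subtract the part above `h` from the full mean; by memorylessness that part is `exp (-(lam *
h))` times the mean of `t + h`. -/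
lemma setIntegral_Iio_id_expMeasure (hlam : 0 < lam) {h : ℝ} (hh : 0 ≤ h) :
    ∫ t in Set.Iio h, t ∂expMeasure lam =
      1 / lam - Real.exp (-(lam * h)) * (1 / lam + h) := by
  have := isProbabilityMeasure_expMeasure hlam
  have hi : Integrable (fun x : ℝ => x) (expMeasure lam) :=
    (memLp_id_expMeasure hlam).integrable one_le_two
  have h1 := integral_add_compl (measurableSet_Iio (a := h)) hi
  rw [Set.compl_Iio, setIntegral_Ici_expMeasure lam hh (by fun_prop),
    integral_id_expMeasure hlam, integral_add hi (integrable_const _),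
    integral_id_expMeasure hlam] at h1
  simp only [integral_const, probReal_univ, one_smul] at h1
  linarith

lemma setIntegral_Iio_sq_expMeasure (hlam : 0 < lam) {h : ℝ} (hh : 0 ≤ h) :
    ∫ t in Set.Iio h, t ^ 2 ∂expMeasure lam =
      2 / lam ^ 2 - Real.exp (-(lam * h)) * (2 / lam ^ 2 + 2 * h / lam + h ^ 2) := by
  have := isProbabilityMeasure_expMeasure hlam
  have hi : Integrable (fun x : ℝ => x) (expMeasure lam) :=
    (memLp_id_expMeasure hlam).integrable one_le_two
  have hi2 := integrable_pow_expMeasure hlam 2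
  have h1 := integral_add_compl (measurableSet_Iio (a := h)) hi2
  have e : ∀ t : ℝ, (t + h) ^ 2 = t ^ 2 + 2 * h * t + h ^ 2 := fun t => by ring
  rw [Set.compl_Iio, setIntegral_Ici_expMeasure lam hh (by fun_prop)] at h1
  simp only [e] at h1
  rw [integral_sq_expMeasure hlam, integral_add (hi2.fun_add (hi.const_mul _)) (integrable_const _),
    integral_add hi2 (hi.const_mul _), integral_const_mul, integral_id_expMeasure hlam,
    integral_sq_expMeasure hlam] at h1
  simp only [integral_const, probReal_univ, one_smul] at h1
  rw [show 2 * h / lam = 2 * h * (1 / lam) by ring]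
  linarith

end Exponential

/-! ### The law of the input -/

namespace IsQueueInput

variable {Ω : Type*} [MeasurableSpace Ω] {P : Measure Ω} {lam : ℝ} {T H : ℕ → Ω → ℝ}

/-- The inter-arrival times and the service times together form an i.i.d. sequence of pairs, also
when the inter-arrival times are shifted. -/
lemma measurePreserving [IsProbabilityMeasure P] (hq : IsQueueInput P lam T H) {f : ℕ → ℕ}
    (hf : Function.Injective f) :
    have := Measure.isProbabilityMeasure_map (μ := P) (hq.measurable_service 0).aemeasurable
    have : IsProbabilityMeasure (expMeasure lam) := by
      rw [← hq.law_interarrival 0]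
      exact Measure.isProbabilityMeasure_map (hq.measurable_interarrival 0).aemeasurable
    MeasurePreserving (fun ω n => (T (f n) ω, H n ω)) P (iidLaw (pairLaw lam (P.map (H 0)))) := by
  have := Measure.isProbabilityMeasure_map (μ := P) (hq.measurable_service 0).aemeasurable
  have : IsProbabilityMeasure (expMeasure lam) := by
    rw [← hq.law_interarrival 0]
    exact Measure.isProbabilityMeasure_map (hq.measurable_interarrival 0).aemeasurable
  have hmT := hq.measurable_interarrival
  have hmH := hq.measurable_service
  have hm : Measurable fun ω n => (T (f n) ω, H n ω) := by fun_prop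
  refine ⟨hm, ?_⟩
  -- The flag `false` selects the reindexed inter-arrival time and `true` the service time. Currying
  -- the independent family over `ℕ × Bool` gives a sequence of independent pairs.
  let g : ℕ × Bool → ℕ ⊕ ℕ := fun p => cond p.2 (Sum.inr p.1) (Sum.inl (f p.1))
  have hg : Function.Injective g := by
    rintro ⟨a, _ | _⟩ ⟨b, _ | _⟩ hab <;> simp_all [g, hf.eq_iff]
  let μ : Bool → Measure ℝ := fun b => cond b (P.map (H 0)) (expMeasure lam)
  have hμ : ∀ b, IsProbabilityMeasure (μ b) := by
    rintro (_ | _) <;> assumption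
  have hmS : ∀ i : ℕ × Bool, Measurable (Sum.elim T H (g i)) := by
    rintro ⟨n, _ | _⟩
    exacts [hmT _, hmH _]
  have h1 := (hq.indep.precomp hg).map_fun_eq_infinitePi_map hmS
  have h2 : ∀ i : ℕ × Bool, P.map (Sum.elim T H (g i)) = μ i.2 := by
    rintro ⟨n, _ | _⟩
    exacts [hq.law_interarrival _, (hq.identDistrib_service n).map_eq]
  simp only [h2] at h1
  have h3 : (Measure.infinitePi fun i : ℕ × Bool => μ i.2).map
      (MeasurableEquiv.curry ℕ Bool ℝ) = Measure.infinitePi fun _ : ℕ => Measure.infinitePi μ :=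
    Measure.infinitePi_map_curry (fun (_ : ℕ) b => μ b)
  have h4 : (Measure.infinitePi μ).map (fun z => (z false, z true)) =
      pairLaw lam (P.map (H 0)) := Measure.infinitePi_map_eval_prod (by decide)
  have h5 := Measure.infinitePi_map_pi (μ := fun _ : ℕ => Measure.infinitePi μ)
    (f := fun _ z => (z false, z true)) (fun _ => by fun_prop)
  rw [h4, ← h3, ← h1, Measure.map_map (by fun_prop) (by fun_prop),
    Measure.map_map (by fun_prop) (by fun_prop)] at h5
  exact h5

/-- This is the Chernoff bound at `-lam`, where the exponential moment generating function equals
`lam / (lam + lam) = 1 / 2`. There are `k + 1` summands; one factor `1 / 2` is discarded. -/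
lemma measureReal_arrival_le (hq : IsQueueInput P lam T H) (hlam : 0 < lam) (k : ℕ) (τ : ℝ) :
    P.real {ω | arrival (fun n => T n ω) k ≤ τ} ≤ Real.exp (lam * τ) * (1 / 2) ^ k := by
  have : IsProbabilityMeasure P := hq.indep.isProbabilityMeasure
  have hmT := hq.measurable_interarrival
  have hind : iIndepFun T P := hq.indep.precomp (g := Sum.inl) Sum.inl_injective
  have hmgf : ∀ i, mgf (T i) P (-lam) = 1 / 2 := by
    intro i
    have h1 := integral_map (μ := P) (φ := T i) (f := fun x => Real.exp (-lam * x))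
      (hmT i).aemeasurable (by fun_prop)
    have h2 := integral_pow_mul_exp_expMeasure hlam hlam.le 0
    simp only [pow_zero, one_mul, Nat.factorial_zero, Nat.cast_one, zero_add, pow_one] at h2
    rw [hq.law_interarrival, h2] at h1
    rw [mgf, ← h1]
    field_simp
    norm_num
  have h1 := measure_le_le_exp_mul_mgf (μ := P) (X := ∑ i ∈ Finset.range (k + 1), T i) (t := -lam) τ
    (by linarith) (by
      have hpos : ∀ᵐ ω ∂P, ∀ n, 0 < T n ω := by
        rw [ae_all_iff]
        intro n
        have := ae_pos_expMeasure lam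
        rw [← hq.law_interarrival n] at this
        exact ae_of_ae_map (hmT n).aemeasurable this
      refine Integrable.mono' (integrable_const 1) (by fun_prop) ?_
      filter_upwards [hpos] with ω hω
      rw [Real.norm_eq_abs, Real.abs_exp, Real.exp_le_one_iff, Finset.sum_apply]
      have : 0 ≤ ∑ i ∈ Finset.range (k + 1), T i ω := Finset.sum_nonneg fun i _ => (hω i).le
      nlinarith)
  rw [hind.mgf_sum hmT] at h1
  simp only [hmgf, Finset.prod_const, Finset.card_range, neg_neg, Finset.sum_apply] at h1
  refine h1.trans (mul_le_mul_of_nonneg_left ?_ (Real.exp_pos _).le)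
  exact pow_le_pow_of_le_one (by norm_num) (by norm_num) (Nat.le_succ k)

end IsQueueInput

/-! ### Races are won almost surely -/

section Races

lemma expMeasure_Ici_pos {lam : ℝ} (hlam : 0 < lam) (x : ℝ) : 0 < expMeasure lam (Set.Ici x) := by
  refine lt_of_lt_of_le ?_ (measure_mono (Set.Ici_subset_Ici.2 (le_max_left x 0)))
  rw [expMeasure_Ici hlam (le_max_right _ _)]
  exact ENNReal.ofReal_pos.2 (Real.exp_pos _)

variable {lam : ℝ} {ν : Measure ℝ} [IsProbabilityMeasure ν] [IsProbabilityMeasure (expMeasure lam)]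

lemma ae_forall_of_ae {E : Type*} [MeasurableSpace E] {ρ : Measure E} [IsProbabilityMeasure ρ]
    {p : E → Prop} (h : ∀ᵐ e ∂ρ, p e) : ∀ᵐ w ∂iidLaw ρ, ∀ n, p (w n) := by
  rw [ae_all_iff]
  intro n
  exact (measurePreserving_eval_infinitePi (fun _ : ℕ => ρ) n).quasiMeasurePreserving.ae h

lemma ae_pos_iidLaw (hν : ∀ᵐ h ∂ν, 0 < h) :
    ∀ᵐ w ∂iidLaw (pairLaw lam ν), ∀ n, 0 < (w n).1 ∧ 0 < (w n).2 := by
  refine ae_forall_of_ae (ρ := pairLaw lam ν) (p := fun e => 0 < e.1 ∧ 0 < e.2) ?_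
  filter_upwards [Measure.quasiMeasurePreserving_fst.ae (ae_pos_expMeasure lam),
    Measure.quasiMeasurePreserving_snd.ae hν] with e h1 h2 using ⟨h1, h2⟩

lemma ae_exists_le_interarrival (hlam : 0 < lam) (x : ℝ) :
    ∀ᵐ w ∂iidLaw (pairLaw lam ν), ∃ n, x ≤ (w n).1 := by
  have hA : MeasurableSet {y : (ℝ × ℝ) × (ℝ × ℝ) × (ℝ × ℝ) | x ≤ y.1.1} :=
    measurableSet_le measurable_const (by fun_prop)
  refine ae_exists_mem_of_pos hA ?_
  have h := iidLaw_pi (pairLaw lam ν) 1 (t := fun _ => Set.Ici x ×ˢ Set.univ)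
    fun _ => measurableSet_Ici.prod MeasurableSet.univ
  simp only [Finset.prod_range_one, Measure.prod_prod, measure_univ, mul_one] at h
  have e : {w : ℕ → ℝ × ℝ | (w 0, w 1, w 2) ∈
      {y : (ℝ × ℝ) × (ℝ × ℝ) × (ℝ × ℝ) | x ≤ y.1.1}} =
      {z | ∀ i < 1, z i ∈ Set.Ici x ×ˢ (Set.univ : Set ℝ)} := by
    ext w
    simp
  rw [e, h]
  exact expMeasure_Ici_pos hlam x

lemma ae_exists_service_le_interarrival (hlam : 0 < lam) :
    ∀ᵐ w ∂iidLaw (pairLaw lam ν), ∃ n, max (w n).2 0 ≤ (w (n + 1)).1 := by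
  have hA : MeasurableSet {y : (ℝ × ℝ) × (ℝ × ℝ) × (ℝ × ℝ) | max y.1.2 0 ≤ y.2.1.1} :=
    measurableSet_le (by fun_prop) (by fun_prop)
  refine ae_exists_mem_of_pos hA ?_
  -- Some level `M` bounds the service time with positive probability, and an independent
  -- inter-arrival time exceeds `M` with positive probability.
  obtain ⟨M, hM⟩ : ∃ M : ℕ, 0 < ν (Set.Iic (M : ℝ)) := by
    by_contra hcon
    push Not at hcon
    have h0 : ν (⋃ M : ℕ, Set.Iic (M : ℝ)) = 0 :=
      measure_iUnion_null fun M => le_antisymm (hcon M) bot_le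
    have h1 : (⋃ M : ℕ, Set.Iic (M : ℝ)) = Set.univ := by
      ext x
      simpa using exists_nat_ge x
    rw [h1, measure_univ] at h0
    exact one_ne_zero h0
  have h := iidLaw_pi (pairLaw lam ν) 2
    (t := fun i => if i = 0 then Set.univ ×ˢ Set.Iic (M : ℝ) else Set.Ici (M : ℝ) ×ˢ Set.univ)
    fun i => by
      split_ifs
      exacts [MeasurableSet.univ.prod measurableSet_Iic, measurableSet_Ici.prod MeasurableSet.univ]
  simp only [Finset.prod_range_succ, Finset.prod_range_zero, one_mul, if_true, Measure.prod_prod,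
    measure_univ, one_ne_zero, if_false, mul_one] at h
  refine lt_of_lt_of_le ?_ (measure_mono (fun w hw => ?_ :
    {z : ℕ → ℝ × ℝ | ∀ i < 2, z i ∈ if i = 0 then Set.univ ×ˢ Set.Iic (M : ℝ)
      else Set.Ici (M : ℝ) ×ˢ Set.univ} ⊆ _))
  · rw [h]
    exact ENNReal.mul_pos hM.ne' (expMeasure_Ici_pos hlam _).ne'
  · have h0 := hw 0 (by norm_num)
    have h1 := hw 1 (by norm_num)
    simp only [if_true, one_ne_zero, if_false, Set.mem_prod, Set.mem_univ, true_and, and_true,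
      Set.mem_Iic, Set.mem_Ici] at h0 h1
    exact max_le (h0.trans h1) ((Nat.cast_nonneg M).trans h1)

end Races

/-! ### The race against a residual time -/

/-- The threshold is the residual time, which is used up by the inter-arrival times. -/
noncomputable abbrev resX (c : ℝ) : ℝ := max c 0

noncomputable abbrev resStep (c : ℝ) (e : ℝ × ℝ) : ℝ := c - e.1

/-- The threshold is the service time of the last packet; the state also records the time elapsed. -/
noncomputable abbrev preX (c : ℝ × ℝ) : ℝ := max c.2 0

noncomputable abbrev preStep (c : ℝ × ℝ) (e : ℝ × ℝ) : ℝ × ℝ := (c.1 + e.1, e.2)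

lemma measurable_resX : Measurable resX := by unfold resX; fun_prop

lemma measurable_resStep : Measurable fun y : ℝ × (ℝ × ℝ) => resStep y.1 y.2 := by
  unfold resStep; fun_prop

lemma measurable_preX : Measurable preX := by unfold preX; fun_prop

lemma measurable_preStep : Measurable fun y : (ℝ × ℝ) × (ℝ × ℝ) => preStep y.1 y.2 := by
  unfold preStep; fun_prop

lemma resStateAt_eq (c : ℝ) (w : ℕ → ℝ × ℝ) (n : ℕ) :
    stateAt resStep c w n = c - ∑ k ∈ Finset.range n, (w k).1 := by
  induction n with
  | zero => simp [stateAt]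
  | succ n ih => rw [stateAt, ih, Finset.sum_range_succ]; simp only [resStep]; ring

lemma preStateAt_eq (c : ℝ × ℝ) (w : ℕ → ℝ × ℝ) (n : ℕ) :
    stateAt preStep c w n = (c.1 + ∑ k ∈ Finset.range n, (w k).1, cons c w n |>.2) := by
  induction n with
  | zero => simp [stateAt]
  | succ n ih => rw [stateAt, ih, Finset.sum_range_succ, cons_succ]; simp only [preStep, add_assoc]

/-- Almost sure properties of the input: positivity, and every race is won. -/
structure IsGoodInput (w : ℕ → ℝ × ℝ) : Prop where
  fst_pos : ∀ n, 0 < (w n).1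
  snd_pos : ∀ n, 0 < (w n).2
  exists_ge : ∀ N m : ℕ, ∃ n, (m : ℝ) ≤ (w (N + n)).1
  exists_snd_le : ∀ N : ℕ, ∃ n, max (w (N + n)).2 0 ≤ (w (N + n + 1)).1

section Good

variable {lam : ℝ} {ν : Measure ℝ} [IsProbabilityMeasure ν] [IsProbabilityMeasure (expMeasure lam)]

lemma ae_isGoodInput (hlam : 0 < lam) (hν : ∀ᵐ h ∂ν, 0 < h) :
    ∀ᵐ w ∂iidLaw (pairLaw lam ν), IsGoodInput w := by
  have hs : ∀ N, MeasurePreserving (fun w : ℕ → ℝ × ℝ => fun k => w (N + k))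
      (iidLaw (pairLaw lam ν)) (iidLaw (pairLaw lam ν)) := fun N =>
    measurePreserving_reindex _ (add_right_injective N)
  filter_upwards [ae_pos_iidLaw (lam := lam) hν,
    ae_all_iff.2 fun N => ae_all_iff.2 fun m : ℕ => (hs N).quasiMeasurePreserving.ae
      (ae_exists_le_interarrival (ν := ν) hlam (m : ℝ)),
    ae_all_iff.2 fun N => (hs N).quasiMeasurePreserving.ae
      (ae_exists_service_le_interarrival (ν := ν) hlam)] with w h1 h2 h3
  exact ⟨fun n => (h1 n).1, fun n => (h1 n).2, h2, h3⟩

end Good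

namespace IsGoodInput

variable {w : ℕ → ℝ × ℝ}

lemma sum_nonneg (hw : IsGoodInput w) (n : ℕ) : 0 ≤ ∑ k ∈ Finset.range n, (w k).1 :=
  Finset.sum_nonneg fun k _ => (hw.fst_pos k).le

lemma shift (hw : IsGoodInput w) (N : ℕ) : IsGoodInput fun k => w (N + k) where
  fst_pos n := hw.fst_pos _
  snd_pos n := hw.snd_pos _
  exists_ge M m := by
    obtain ⟨n, hn⟩ := hw.exists_ge (N + M) m
    exact ⟨n, by rwa [← add_assoc]⟩
  exists_snd_le M := by
    obtain ⟨n, hn⟩ := hw.exists_snd_le (N + M)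
    exact ⟨n, by simpa only [← add_assoc] using hn⟩

lemma res_stops (hw : IsGoodInput w) (c : ℝ) : ∃ n, resX (stateAt resStep c w n) ≤ (w n).1 := by
  obtain ⟨m, hm⟩ := exists_nat_ge c
  obtain ⟨n, hn⟩ := hw.exists_ge 0 m
  rw [zero_add] at hn
  refine ⟨n, max_le ?_ (hw.fst_pos n).le⟩
  rw [resStateAt_eq]
  linarith [hw.sum_nonneg n]

lemma pre_stops (hw : IsGoodInput w) (c : ℝ × ℝ) :
    ∃ n, preX (stateAt preStep c w n) ≤ (w n).1 := by
  obtain ⟨n, hn⟩ := hw.exists_snd_le 0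
  rw [zero_add] at hn
  exact ⟨n + 1, hn⟩

/-- The race against a residual time ends when the time is used up. -/
lemma res_race (hw : IsGoodInput w) {c : ℝ} (hc : 0 < c) :
    (∀ k ≤ stopIndex resX resStep c w, ∑ j ∈ Finset.range k, (w j).1 < c) ∧
    c ≤ ∑ j ∈ Finset.range (stopIndex resX resStep c w + 1), (w j).1 ∧
    finalState resX resStep c w =
      c - ∑ j ∈ Finset.range (stopIndex resX resStep c w), (w j).1 ∧
    restInput resX resStep c w 0 =
      (∑ j ∈ Finset.range (stopIndex resX resStep c w + 1), (w j).1 - c,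
        (w (stopIndex resX resStep c w)).2) ∧
    ∀ k, restInput resX resStep c w (k + 1) = w (stopIndex resX resStep c w + 1 + k) := by
  have hwin := exists_stopsAt (hw.res_stops c)
  have h1 : ∀ k ≤ stopIndex resX resStep c w, ∑ j ∈ Finset.range k, (w j).1 < c := by
    intro k hk
    cases k with
    | zero => simpa using hc
    | succ k =>
      have := hwin.1 k hk
      rw [resX, resStateAt_eq, lt_max_iff] at this
      rw [Finset.sum_range_succ]
      rcases this with h | h
      · linarith
      · exact absurd h (hw.fst_pos k).le.not_gt
  have h2 := h1 _ le_rfl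
  have hmax : resX (stateAt resStep c w (stopIndex resX resStep c w)) =
      c - ∑ j ∈ Finset.range (stopIndex resX resStep c w), (w j).1 := by
    rw [resX, resStateAt_eq, max_eq_left (by linarith)]
  have h3 := hwin.2
  rw [hmax] at h3
  refine ⟨h1, ?_, resStateAt_eq _ _ _, ?_, fun k => rfl⟩
  · rw [Finset.sum_range_succ]
    linarith
  · rw [restInput, restAt, cons_zero, hmax, Finset.sum_range_succ]
    congr 1
    ring

end IsGoodInput

/-! ### Enumerations -/

/-- A strictly increasing index sequence is unbounded, so a missing index would have to lie before
the first term or inside a gap. -/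
lemma range_eq_of_gaps {I : ℕ → ℕ} {p : ℕ → Prop} (hI : StrictMono I) (h : ∀ l, p (I l))
    (h0 : ∀ n < I 0, ¬ p n) (hgap : ∀ l n, I l < n → n < I (l + 1) → ¬ p n) :
    Set.range I = {n | p n} := by
  ext n
  constructor
  · rintro ⟨l, rfl⟩
    exact h l
  · intro hn
    by_contra hne
    have hlt : ∀ l, I l < n := by
      intro l
      induction l with
      | zero =>
        refine lt_of_le_of_ne (not_lt.1 fun hlt => h0 n hlt hn) fun he => hne ⟨0, he⟩
      | succ l ih =>
        exact lt_of_le_of_ne (not_lt.1 fun hlt => hgap l n ih hlt hn) fun he => hne ⟨_, he⟩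
    exact absurd (hI.le_apply (x := n)) (not_le.2 (hlt n))

lemma arrival_add (T : ℕ → ℝ) (m k : ℕ) :
    arrival T (m + k) = arrival T m + ∑ j ∈ Finset.range k, T (m + 1 + j) := by
  induction k with
  | zero => simp
  | succ k ih =>
    rw [← add_assoc, arrival_succ, ih, Finset.sum_range_succ, add_assoc, add_right_comm m k 1]

/-! ### M/G/1/1 -/

section Blocking

/-- The input after the service of the first packet, which starts at the time of the next
accepted packet. -/
noncomputable def blockingRest (w : ℕ → ℝ × ℝ) : ℕ → ℝ × ℝ :=
  restInput resX resStep (w 0).2 (tail w)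

/-- The indices of the accepted packets. -/
noncomputable def blockingIndex (w : ℕ → ℝ × ℝ) : ℕ → ℕ
  | 0 => 0
  | l + 1 => blockingIndex w l + 1 +
    stopIndex resX resStep (blockingRest^[l] w 0).2 (tail (blockingRest^[l] w))

variable {T H : ℕ → ℝ}

/-- Packets arriving during the service of packet `m` correspond to lost races against the residual
service time; the first win is the next accepted packet. The invariant is that the input starts with
the idle time before an accepted packet and its service time, followed by the untouched original
input. -/
lemma blocking_step (hw : IsGoodInput fun n => (T n, H n)) {v : ℕ → ℝ × ℝ} {m m' : ℕ}
    (h0 : v 0 = (arrival T m - freeTimeBlocking T H m, H m))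
    (ht : tail v = fun k => (T (m + 1 + k), H (m + 1 + k)))
    (hF : freeTimeBlocking T H m ≤ arrival T m)
    (hm' : m' = m + 1 + stopIndex resX resStep (v 0).2 (tail v)) :
    blockingRest v 0 = (arrival T m' - freeTimeBlocking T H m', H m') ∧
      (tail (blockingRest v) = fun k => (T (m' + 1 + k), H (m' + 1 + k))) ∧
      freeTimeBlocking T H m' ≤ arrival T m' ∧
      freeTimeBlocking T H m' = arrival T m + H m ∧
      ∀ n, m < n → n < m' → arrival T n < freeTimeBlocking T H n := by
  have hg : IsGoodInput (tail v) := by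
    rw [ht]
    exact hw.shift (m + 1)
  have hc : 0 < (v 0).2 := by
    rw [h0]
    exact hw.snd_pos m
  obtain ⟨r1, r2, -, r4, r5⟩ := hg.res_race hc
  have hv2 : (v 0).2 = H m := by rw [h0]
  set N := stopIndex resX resStep (v 0).2 (tail v) with hN
  have hA : ∀ k, ∑ j ∈ Finset.range k, (tail v j).1 = arrival T (m + k) - arrival T m := by
    intro k
    rw [arrival_add, ht]
    ring
  simp only [hA, hv2] at r1 r2 r4
  have hfree : ∀ k ≤ N, freeTimeBlocking T H (m + 1 + k) = arrival T m + H m := by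
    intro k hk
    induction k with
    | zero => rw [add_zero, freeTimeBlocking, if_pos hF]
    | succ k ih =>
      have h1 := r1 (k + 1) hk
      rw [← add_assoc, freeTimeBlocking, ih (by omega), if_neg]
      rw [not_le, show m + 1 + k = m + (k + 1) by ring]
      linarith
  have hFm' : freeTimeBlocking T H m' = arrival T m + H m := by rw [hm']; exact hfree N le_rfl
  have harr : arrival T (m + (N + 1)) = arrival T m' := by rw [hm']; congr 1; ring
  refine ⟨?_, ?_, ?_, hFm', ?_⟩
  · rw [hFm', blockingRest, hv2, r4, harr, ht, hm']
    simp only [Prod.mk.injEq, and_true]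
    ring
  · funext k
    rw [tail_apply, blockingRest, r5, ht, hm']
    simp only [show m + 1 + (N + 1 + k) = m + 1 + N + 1 + k by ring]
  · rw [hFm', ← harr]
    linarith
  · intro n h1 h2
    obtain ⟨k, rfl⟩ := Nat.exists_eq_add_of_lt h1
    have h3 := r1 (k + 1) (by omega)
    rw [show m + k + 1 = m + 1 + k by ring, hfree k (by omega),
      show m + 1 + k = m + (k + 1) by ring]
    linarith

/-- The structure of a realization of M/G/1/1. -/
lemma blocking_path (hw : IsGoodInput fun n => (T n, H n)) :
    IsEnumeration .blocking T H (blockingIndex fun n => (T n, H n)) ∧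
      (∀ l, completion .blocking T H (blockingIndex (fun n => (T n, H n)) l) -
        arrival T (blockingIndex (fun n => (T n, H n)) l) =
          (blockingRest^[l] (fun n => (T n, H n)) 0).2) ∧
      ∀ l, completion .blocking T H (blockingIndex (fun n => (T n, H n)) (l + 1)) -
        completion .blocking T H (blockingIndex (fun n => (T n, H n)) l) =
          (blockingRest^[l + 1] (fun n => (T n, H n)) 0).1 +
            (blockingRest^[l + 1] (fun n => (T n, H n)) 0).2 := by
  set w : ℕ → ℝ × ℝ := fun n => (T n, H n) with hwdef
  set I := blockingIndex w with hI
  have key : ∀ l, blockingRest^[l] w 0 =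
        (arrival T (I l) - freeTimeBlocking T H (I l), H (I l)) ∧
      (tail (blockingRest^[l] w) = fun k => (T (I l + 1 + k), H (I l + 1 + k))) ∧
      freeTimeBlocking T H (I l) ≤ arrival T (I l) := by
    intro l
    induction l with
    | zero =>
      refine ⟨?_, ?_, ?_⟩
      · simp [hI, blockingIndex, freeTimeBlocking, arrival, hwdef]
      · funext k
        simp [hI, blockingIndex, tail_apply, hwdef, add_comm]
      · simpa [hI, blockingIndex, freeTimeBlocking] using (arrival_pos hw.fst_pos 0).le
    | succ l ih =>
      obtain ⟨h1, h2, h3, -, -⟩ := blocking_step hw ih.1 ih.2.1 ih.2.2 rfl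
      rw [Function.iterate_succ_apply']
      exact ⟨h1, h2, h3⟩
  have step : ∀ l, freeTimeBlocking T H (I (l + 1)) = arrival T (I l) + H (I l) ∧
      ∀ n, I l < n → n < I (l + 1) → arrival T n < freeTimeBlocking T H n := by
    intro l
    obtain ⟨k1, k2, k3⟩ := key l
    obtain ⟨-, -, -, h4, h5⟩ := blocking_step hw k1 k2 k3 rfl
    exact ⟨h4, h5⟩
  have hmono : StrictMono I := strictMono_nat_of_lt_succ fun l => by
    change I l < I l + 1 + _
    omega
  refine ⟨⟨hmono, ?_, hw.fst_pos, fun l => ?_, fun l => ?_⟩, fun l => ?_, fun l => ?_⟩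
  · refine range_eq_of_gaps hmono (fun l => (key l).2.2) (fun n hn => absurd hn (Nat.not_lt_zero n))
      fun l n h1 h2 => not_le.2 ((step l).2 n h1 h2)
  · have := hw.snd_pos (I l)
    simp only [hwdef] at this
    simp only [completion]
    linarith
  · have h1 := hw.snd_pos (I (l + 1))
    simp only [hwdef] at h1
    have h2 := (key (l + 1)).2.2
    rw [(step l).1] at h2
    simp only [completion]
    linarith
  · rw [(key l).1]
    simp [completion]
  · rw [(key (l + 1)).1, (step l).1]
    simp only [completion]
    ring

variable {lam : ℝ} {ν : Measure ℝ} [IsProbabilityMeasure ν] [IsProbabilityMeasure (expMeasure lam)]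

/-- The block is the first input itself, so it is enough that for each value of it the remaining
input is fresh. Truncating the threshold at `0` in `resX` supplies the nonnegativity that
memorylessness needs. -/
lemma isRegeneration_blocking (hlam : 0 < lam) (hν : ∀ᵐ h ∂ν, 0 < h) :
    IsRegeneration (iidLaw (pairLaw lam ν)) (fun w => w 0) blockingRest := by
  refine IsRegeneration.of_cons (measurable_pi_apply 0) ?_ (Eventually.of_forall fun e s t hs ht => ?_)
  · exact (measurable_restInput measurable_resX measurable_resStep).comp
      ((measurable_snd.comp (measurable_pi_apply 0)).prodMk measurable_tail)
  · have h := iidLaw_finalState_restInput (ν := ν) hlam (fun c => le_max_right c 0) measurable_resX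
      measurable_resStep (c := e.2)
      ((ae_isGoodInput hlam hν).mono fun w hw => hw.res_stops e.2) MeasurableSet.univ ht
    simp only [Set.mem_univ, true_and, Set.ofPred_true, measure_univ, one_mul] at h
    simp only [cons_zero, blockingRest, tail_cons]
    by_cases he : e ∈ s
    · simp [he, h]
    · simp [he]

end Blocking

/-! ### M/G/1/1/preemptive -/

section Preemptive

/-- The time until the arrival of the first packet that is not preempted, and its service time. -/
noncomputable def preemptiveBlock (w : ℕ → ℝ × ℝ) : ℝ × ℝ :=
  finalState preX preStep (w 0) (tail w)

/-- The input after the service of the first packet that is not preempted. -/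
noncomputable def preemptiveRest (w : ℕ → ℝ × ℝ) : ℕ → ℝ × ℝ :=
  restInput preX preStep (w 0) (tail w)

/-- The indices of the packets that start a new block. -/
noncomputable def preemptiveStart (w : ℕ → ℝ × ℝ) : ℕ → ℕ
  | 0 => 0
  | l + 1 => preemptiveStart w l +
    stopIndex preX preStep (preemptiveRest^[l] w 0) (tail (preemptiveRest^[l] w)) + 1

/-- The indices of the packets that are not preempted. -/
noncomputable def preemptiveIndex (w : ℕ → ℝ × ℝ) (l : ℕ) : ℕ :=
  preemptiveStart w l +
    stopIndex preX preStep (preemptiveRest^[l] w 0) (tail (preemptiveRest^[l] w))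

variable {T H : ℕ → ℝ}

/-- A race is lost exactly when the next packet arrives before the current service ends, so the
first win is the first packet not preempted. The time `c` is a free origin; along the path it is the
previous completion time. -/
lemma preemptive_step (hw : IsGoodInput fun n => (T n, H n)) {v : ℕ → ℝ × ℝ} {m m' : ℕ} {c : ℝ}
    (h0 : v 0 = (arrival T m - c, H m))
    (ht : tail v = fun k => (T (m + 1 + k), H (m + 1 + k)))
    (hm' : m' = m + stopIndex preX preStep (v 0) (tail v)) :
    preemptiveRest v 0 = (arrival T (m' + 1) - (arrival T m' + H m'), H (m' + 1)) ∧
      (tail (preemptiveRest v) = fun k => (T (m' + 1 + 1 + k), H (m' + 1 + 1 + k))) ∧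
      preemptiveBlock v = (arrival T m' - c, H m') ∧
      arrival T m' + H m' ≤ arrival T (m' + 1) ∧
      ∀ n, m ≤ n → n < m' → arrival T (n + 1) < arrival T n + H n := by
  have hg : IsGoodInput (tail v) := by
    rw [ht]
    exact hw.shift (m + 1)
  have hwin := exists_stopsAt (hg.pre_stops (v 0))
  set N := stopIndex preX preStep (v 0) (tail v) with hN
  have hst : ∀ n, stateAt preStep (v 0) (tail v) n = (arrival T (m + n) - c, H (m + n)) := by
    intro n
    rw [preStateAt_eq, arrival_add, ht, h0]
    refine Prod.ext ?_ ?_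
    · simp only
      ring
    · cases n with
      | zero => rfl
      | succ n => simp only [cons_succ, show m + 1 + n = m + (n + 1) by ring]
  have hx : ∀ n, preX (stateAt preStep (v 0) (tail v) n) = H (m + n) := by
    intro n
    rw [hst]
    exact max_eq_left (hw.snd_pos (m + n)).le
  have htl : ∀ n, (tail v n).1 = arrival T (m + n + 1) - arrival T (m + n) := by
    intro n
    rw [ht, arrival_succ]
    simp only [show m + 1 + n = m + n + 1 by ring]
    ring
  have h1 := hwin.1
  have h2 := hwin.2
  simp only [hx, htl] at h1 h2
  rw [← hm'] at h2
  refine ⟨?_, ?_, ?_, by linarith, ?_⟩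
  · rw [preemptiveRest, restInput, restAt, cons_zero, ← hN, hx, htl, ht, hm']
    simp only [Prod.mk.injEq, show m + 1 + N = m + N + 1 by ring, and_true]
    ring
  · funext k
    rw [tail_apply, preemptiveRest, restInput, restAt, cons_succ, ← hN, ht, hm']
    simp only [show m + 1 + (N + 1 + k) = m + N + 1 + 1 + k by ring]
  · rw [preemptiveBlock, finalState, hst, hm']
  · intro n hn1 hn2
    obtain ⟨k, rfl⟩ := Nat.exists_eq_add_of_le hn1
    have := h1 k (by omega)
    linarith

/-- The structure of a realization of M/G/1/1/preemptive. -/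
lemma preemptive_path (hw : IsGoodInput fun n => (T n, H n)) :
    IsEnumeration .preemptive T H (preemptiveIndex fun n => (T n, H n)) ∧
      completion .preemptive T H (preemptiveIndex (fun n => (T n, H n)) 0) =
        (preemptiveBlock fun n => (T n, H n)).1 + (preemptiveBlock fun n => (T n, H n)).2 ∧
      (∀ l, completion .preemptive T H (preemptiveIndex (fun n => (T n, H n)) l) -
        arrival T (preemptiveIndex (fun n => (T n, H n)) l) =
          (preemptiveBlock (preemptiveRest^[l] fun n => (T n, H n))).2) ∧
      ∀ l, completion .preemptive T H (preemptiveIndex (fun n => (T n, H n)) (l + 1)) -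
        completion .preemptive T H (preemptiveIndex (fun n => (T n, H n)) l) =
          (preemptiveBlock (preemptiveRest^[l + 1] fun n => (T n, H n))).1 +
            (preemptiveBlock (preemptiveRest^[l + 1] fun n => (T n, H n))).2 := by
  set w : ℕ → ℝ × ℝ := fun n => (T n, H n) with hwdef
  set I := preemptiveIndex w with hI
  set J := preemptiveStart w with hJ
  have hJI : ∀ l, J (l + 1) = I l + 1 := fun l => rfl
  have hJ0 : J 0 = 0 := rfl
  -- `C l` is the completion time that opens block `l`, with time `0` for the first block.
  let C : ℕ → ℝ := fun l => Nat.casesOn l 0 fun l => arrival T (I l) + H (I l)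
  have key : ∀ l, preemptiveRest^[l] w 0 = (arrival T (J l) - C l, H (J l)) ∧
      tail (preemptiveRest^[l] w) = fun k => (T (J l + 1 + k), H (J l + 1 + k)) := by
    intro l
    induction l with
    | zero =>
      refine ⟨?_, ?_⟩
      · simp [hJ0, arrival, hwdef, C]
      · funext k
        simp [hJ0, tail_apply, hwdef, add_comm]
    | succ l ih =>
      obtain ⟨h1, h2, -, -, -⟩ := preemptive_step (m' := I l) hw ih.1 ih.2 rfl
      rw [Function.iterate_succ_apply', hJI]
      exact ⟨h1, h2⟩
  have step : ∀ l, preemptiveBlock (preemptiveRest^[l] w) = (arrival T (I l) - C l, H (I l)) ∧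
      arrival T (I l) + H (I l) ≤ arrival T (I l + 1) ∧
      ∀ n, J l ≤ n → n < I l → arrival T (n + 1) < arrival T n + H n := by
    intro l
    obtain ⟨k1, k2⟩ := key l
    obtain ⟨-, -, h3, h4, h5⟩ := preemptive_step (m' := I l) hw k1 k2 rfl
    exact ⟨h3, h4, h5⟩
  have hlt : ∀ l, I l < I (l + 1) := fun l => by
    change I l < J (l + 1) + _
    rw [hJI]
    omega
  have hmono : StrictMono I := strictMono_nat_of_lt_succ hlt
  have hpos : ∀ n, 0 < H n := fun n => hw.snd_pos n
  refine ⟨⟨hmono, ?_, hw.fst_pos, fun l => ?_, fun l => ?_⟩, ?_, fun l => ?_, fun l => ?_⟩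
  · refine range_eq_of_gaps hmono (fun l => (step l).2.1) (fun n hn => ?_) fun l n h1 h2 => ?_
    · exact not_le.2 ((step 0).2.2 n (by rw [hJ0]; omega) hn)
    · exact not_le.2 ((step (l + 1)).2.2 n (by rw [hJI]; omega) h2)
  · simp only [completion]
    linarith [hpos (I l)]
  · simp only [completion]
    have h1 := (arrival_strictMono hw.fst_pos).monotone (hlt l)
    simp only [hwdef] at h1
    linarith [(step l).2.1, hpos (I (l + 1)), show arrival T (I l + 1) ≤ arrival T (I (l + 1)) from h1]
  · have h := (step 0).1
    simp only [Function.iterate_zero, id_eq] at h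
    rw [h]
    simp [completion, C]
  · rw [(step l).1]
    simp [completion]
  · rw [(step (l + 1)).1]
    simp only [completion, C]
    ring

variable {lam : ℝ} {ν : Measure ℝ} [IsProbabilityMeasure ν] [IsProbabilityMeasure (expMeasure lam)]

/-- For each first input, the block is the final state of the race and the remaining input is that
of the race, so the independence of the two is the general race result. -/
lemma isRegeneration_preemptive (hlam : 0 < lam) (hν : ∀ᵐ h ∂ν, 0 < h) :
    IsRegeneration (iidLaw (pairLaw lam ν)) preemptiveBlock preemptiveRest := by
  refine IsRegeneration.of_cons ?_ ?_ (Eventually.of_forall fun e s t hs ht => ?_)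
  · exact (measurable_finalState measurable_preX measurable_preStep).comp
      ((measurable_pi_apply 0).prodMk measurable_tail)
  · exact (measurable_restInput measurable_preX measurable_preStep).comp
      ((measurable_pi_apply 0).prodMk measurable_tail)
  · simp only [preemptiveBlock, cons_zero, preemptiveRest, tail_cons]
    exact iidLaw_finalState_restInput (ν := ν) hlam (fun c => le_max_right _ 0) measurable_preX
      measurable_preStep (c := e)
      ((ae_isGoodInput hlam hν).mono fun w hw => hw.pre_stops e) hs ht

end Preemptive

/-! ### M/G/1/2* -/

section Replacement

/-- The service time of the first packet, the idle time that follows its service, and the waiting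
time of the next served packet. -/
noncomputable def replacementBlock (v : ℕ → ℝ × ℝ) : ℝ × ℝ × ℝ :=
  if (v 0).2 ≤ (v 0).1 then ((v 0).2, (v 0).1 - (v 0).2, 0)
  else ((v 0).2, 0, finalState resX resStep ((v 0).2 - (v 0).1) (tail v))

/-- The input after the service of the first packet. -/
noncomputable def replacementRest (v : ℕ → ℝ × ℝ) : ℕ → ℝ × ℝ :=
  if (v 0).2 ≤ (v 0).1 then tail v else restInput resX resStep ((v 0).2 - (v 0).1) (tail v)

/-- The number of packets that are replaced in the waiting place during the first service. -/
noncomputable def replacementCount (v : ℕ → ℝ × ℝ) : ℕ :=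
  if (v 0).2 ≤ (v 0).1 then 0 else stopIndex resX resStep ((v 0).2 - (v 0).1) (tail v)

/-- The indices of the packets that are served. -/
noncomputable def replacementIndex (v : ℕ → ℝ × ℝ) : ℕ → ℕ
  | 0 => 0
  | l + 1 => replacementIndex v l + 1 + replacementCount (replacementRest^[l] v)

variable {T H : ℕ → ℝ}

/-- The start of the service of packet `n`, if it is served. -/
noncomputable def startTime (T H : ℕ → ℝ) (n : ℕ) : ℝ :=
  max (arrival T n) (freeTimeReplacement T H n)

/-- The invariant is that the input starts with the time from the start of service `m` to the next
arrival, paired with the service time of `m`. If the next arrival comes during the service, a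
further race against the residual service time finds the last arrival before its end, and this
packet is served next. -/
lemma replacement_step (hw : IsGoodInput fun n => (T (n + 1), H n)) {v : ℕ → ℝ × ℝ} {m m' : ℕ}
    (h0 : v 0 = (arrival T (m + 1) - startTime T H m, H m))
    (ht : tail v = fun k => (T (m + 1 + k + 1), H (m + 1 + k)))
    (hF : freeTimeReplacement T H m ≤ arrival T (m + 1))
    (hm' : m' = m + 1 + replacementCount v) :
    replacementRest v 0 = (arrival T (m' + 1) - startTime T H m', H m') ∧
      (tail (replacementRest v) = fun k => (T (m' + 1 + k + 1), H (m' + 1 + k))) ∧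
      freeTimeReplacement T H m' ≤ arrival T (m' + 1) ∧
      (∀ n, m < n → n < m' → arrival T (n + 1) < freeTimeReplacement T H n) ∧
      startTime T H m' - arrival T m' = (replacementBlock v).2.2 ∧
      startTime T H m' - (startTime T H m + H m) = (replacementBlock v).2.1 := by
  have hfree : freeTimeReplacement T H (m + 1) = startTime T H m + H m := by
    rw [freeTimeReplacement, if_pos hF, startTime]
  have hpos : ∀ n, 0 < T (n + 1) := hw.fst_pos
  by_cases hc : (v 0).2 ≤ (v 0).1
  · have hc' := hc
    rw [h0] at hc'
    simp only at hc'
    rw [replacementCount, if_pos hc, add_zero] at hm'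
    subst hm'
    have h1 : startTime T H (m + 1) = arrival T (m + 1) := by
      rw [startTime, hfree, max_eq_left]
      linarith
    have h2 : arrival T (m + 1 + 1) = arrival T (m + 1) + T (m + 1 + 1) := arrival_succ _ _
    rw [h1, hfree, replacementRest, if_pos hc, replacementBlock, if_pos hc, h2, h0, ht]
    refine ⟨?_, ?_, ?_, fun n h3 h4 => by omega, by simp, by simp only; ring⟩
    · simp only [add_zero, Prod.mk.injEq, and_true]
      ring
    · funext k
      rw [tail_apply]
      simp only [show m + 1 + (k + 1) = m + 1 + 1 + k by ring]
    · linarith [hpos (m + 1)]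
  · have hg : IsGoodInput (tail v) := by
      rw [ht]
      exact hw.shift (m + 1)
    obtain ⟨r1, r2, r3, r4, r5⟩ := hg.res_race (c := (v 0).2 - (v 0).1) (by linarith)
    rw [replacementCount, if_neg hc] at hm'
    rw [replacementRest, if_neg hc, replacementBlock, if_neg hc, r3, r4]
    have hv : (v 0).2 - (v 0).1 = startTime T H m + H m - arrival T (m + 1) := by
      rw [h0]
      ring
    set N := stopIndex resX resStep ((v 0).2 - (v 0).1) (tail v) with hN
    have hA : ∀ k, ∑ j ∈ Finset.range k, (tail v j).1 =
        arrival T (m + 1 + k) - arrival T (m + 1) := by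
      intro k
      rw [arrival_add, ht]
      simp only [show ∀ j, m + 1 + 1 + j = m + 1 + j + 1 from fun j => by ring]
      ring
    simp only [hA, hv] at r1 r2 ⊢
    have hfr : ∀ k ≤ N, freeTimeReplacement T H (m + 1 + k) = startTime T H m + H m := by
      intro k hk
      induction k with
      | zero => rw [add_zero, hfree]
      | succ k ih =>
        have h1 := r1 (k + 1) hk
        rw [← add_assoc, freeTimeReplacement, ih (by omega), if_neg]
        rw [not_le, show m + 1 + k + 1 = m + 1 + (k + 1) by ring]
        linarith
    have hfm : freeTimeReplacement T H m' = startTime T H m + H m := by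
      rw [hm']
      exact hfr N le_rfl
    have h3 := r1 N le_rfl
    rw [← hm'] at h3 ⊢
    rw [show m + 1 + (N + 1) = m' + 1 by omega] at r2 ⊢
    have hst : startTime T H m' = startTime T H m + H m := by
      rw [startTime, hfm, max_eq_right]
      linarith
    rw [hst, hfm]
    refine ⟨?_, ?_, by linarith, ?_, by ring, by ring⟩
    · rw [ht, hm']
      simp only [Prod.mk.injEq, and_true]
      ring
    · funext k
      rw [tail_apply, ← hv, r5, ht, hm']
      simp only [show m + 1 + (N + 1 + k) = m + 1 + N + 1 + k by ring]
    · intro n h4 h5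
      obtain ⟨k, rfl⟩ := Nat.exists_eq_add_of_lt h4
      have h6 := r1 (k + 1) (by omega)
      rw [show m + k + 1 = m + 1 + k by ring, hfr k (by omega),
        show m + 1 + k + 1 = m + 1 + (k + 1) by ring]
      linarith

/-- The structure of a realization of M/G/1/2*. -/
lemma replacement_path (hT0 : 0 < T 0) (hw : IsGoodInput fun n => (T (n + 1), H n)) :
    IsEnumeration .replacement T H (replacementIndex fun n => (T (n + 1), H n)) ∧
      completion .replacement T H (replacementIndex (fun n => (T (n + 1), H n)) 0) = T 0 + H 0 ∧
      completion .replacement T H (replacementIndex (fun n => (T (n + 1), H n)) 0) -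
        arrival T (replacementIndex (fun n => (T (n + 1), H n)) 0) = H 0 ∧
      ∀ l, completion .replacement T H (replacementIndex (fun n => (T (n + 1), H n)) (l + 1)) -
          arrival T (replacementIndex (fun n => (T (n + 1), H n)) (l + 1)) =
            (replacementBlock (replacementRest^[l] fun n => (T (n + 1), H n))).2.2 +
            (replacementBlock (replacementRest^[l + 1] fun n => (T (n + 1), H n))).1 ∧
        completion .replacement T H (replacementIndex (fun n => (T (n + 1), H n)) (l + 1)) -
          completion .replacement T H (replacementIndex (fun n => (T (n + 1), H n)) l) =
            (replacementBlock (replacementRest^[l] fun n => (T (n + 1), H n))).2.1 +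
            (replacementBlock (replacementRest^[l + 1] fun n => (T (n + 1), H n))).1 := by
  set w : ℕ → ℝ × ℝ := fun n => (T (n + 1), H n) with hwdef
  set I := replacementIndex w with hI
  have hTpos : ∀ n, 0 < T n := by
    intro n
    cases n with
    | zero => exact hT0
    | succ n => exact hw.fst_pos n
  have hHpos : ∀ n, 0 < H n := fun n => hw.snd_pos n
  have hI0 : I 0 = 0 := rfl
  have hs0 : startTime T H 0 = T 0 := by
    simp [startTime, freeTimeReplacement, arrival, hT0.le]
  have hcomp : ∀ n, completion .replacement T H n = startTime T H n + H n := fun n => rfl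
  have key : ∀ l, replacementRest^[l] w 0 =
        (arrival T (I l + 1) - startTime T H (I l), H (I l)) ∧
      (tail (replacementRest^[l] w) = fun k => (T (I l + 1 + k + 1), H (I l + 1 + k))) ∧
      freeTimeReplacement T H (I l) ≤ arrival T (I l + 1) := by
    intro l
    induction l with
    | zero =>
      rw [hI0, hs0]
      refine ⟨?_, ?_, ?_⟩
      · simp [hwdef, arrival, Finset.sum_range_succ]
      · funext k
        simp [tail_apply, hwdef, add_comm]
      · simpa [freeTimeReplacement] using (arrival_pos hTpos _).le
    | succ l ih =>
      obtain ⟨h1, h2, h3, -⟩ := replacement_step hw ih.1 ih.2.1 ih.2.2 rfl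
      rw [Function.iterate_succ_apply']
      exact ⟨h1, h2, h3⟩
  have step : ∀ l, (∀ n, I l < n → n < I (l + 1) →
        arrival T (n + 1) < freeTimeReplacement T H n) ∧
      startTime T H (I (l + 1)) - arrival T (I (l + 1)) =
        (replacementBlock (replacementRest^[l] w)).2.2 ∧
      startTime T H (I (l + 1)) - (startTime T H (I l) + H (I l)) =
        (replacementBlock (replacementRest^[l] w)).2.1 := by
    intro l
    obtain ⟨k1, k2, k3⟩ := key l
    obtain ⟨-, -, -, h⟩ := replacement_step hw k1 k2 k3 rfl
    exact h
  have hfst : ∀ l, (replacementBlock (replacementRest^[l] w)).1 = H (I l) := by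
    intro l
    rw [replacementBlock]
    split_ifs <;> rw [(key l).1]
  have hidle : ∀ v : ℕ → ℝ × ℝ, 0 ≤ (replacementBlock v).2.1 := by
    intro v
    rw [replacementBlock]
    split_ifs with h
    · exact sub_nonneg.2 h
    · exact le_rfl
  have hmono : StrictMono I := strictMono_nat_of_lt_succ fun l => by
    change I l < I l + 1 + _
    omega
  refine ⟨⟨hmono, ?_, hTpos, fun l => ?_, fun l => ?_⟩, ?_, ?_, fun l => ⟨?_, ?_⟩⟩
  · exact range_eq_of_gaps hmono (fun l => (key l).2.2) (fun n hn => absurd hn (Nat.not_lt_zero n))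
      fun l n h1 h2 => not_le.2 ((step l).1 n h1 h2)
  · rw [hcomp]
    linarith [hHpos (I l), show arrival T (I l) ≤ startTime T H (I l) from le_max_left _ _]
  · rw [hcomp, hcomp]
    linarith [hHpos (I (l + 1)), hidle (replacementRest^[l] w), (step l).2.2]
  · rw [hcomp, hI0, hs0]
  · rw [hcomp, hI0, hs0]
    simp [arrival]
  · rw [hcomp, hfst, ← (step l).2.1]
    ring
  · rw [hcomp, hcomp, hfst, ← (step l).2.2]
    ring

variable {lam : ℝ} {ν : Measure ℝ} [IsProbabilityMeasure ν] [IsProbabilityMeasure (expMeasure lam)]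

lemma measurable_replacementBlock : Measurable replacementBlock := by
  have h : Measurable fun v : ℕ → ℝ × ℝ =>
      finalState resX resStep ((v 0).2 - (v 0).1) (tail v) :=
    (measurable_finalState measurable_resX measurable_resStep).comp
      (Measurable.prodMk (by fun_prop) measurable_tail)
  refine Measurable.ite (measurableSet_le (by fun_prop) (by fun_prop)) (by fun_prop) ?_
  exact Measurable.prodMk (by fun_prop) (measurable_const.prodMk h)

lemma measurable_replacementRest : Measurable replacementRest := by
  refine Measurable.ite (measurableSet_le (by fun_prop) (by fun_prop)) measurable_tail ?_
  exact (measurable_restInput measurable_resX measurable_resStep).comp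
      (Measurable.prodMk (by fun_prop) measurable_tail)

/-- Fix the first pair. If its service ends first, the block is deterministic and the rest is simply
the later input; otherwise the race against the residual service time `e.2 - e.1` gives the
independence. -/
lemma isRegeneration_replacement (hlam : 0 < lam) (hν : ∀ᵐ h ∂ν, 0 < h) :
    IsRegeneration (iidLaw (pairLaw lam ν)) replacementBlock replacementRest := by
  refine IsRegeneration.of_cons measurable_replacementBlock measurable_replacementRest
    (Eventually.of_forall fun e s t hs ht => ?_)
  simp only [replacementBlock, cons_zero, replacementRest, tail_cons]
  by_cases he : e.2 ≤ e.1
  · simp only [he, if_true]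
    by_cases h : (e.2, e.1 - e.2, (0 : ℝ)) ∈ s <;> simp [h]
  · simp only [he, if_false]
    have hm : Measurable fun d : ℝ => (e.2, (0 : ℝ), d) := by fun_prop
    exact iidLaw_finalState_restInput (ν := ν) hlam (fun c => le_max_right c 0) measurable_resX
      measurable_resStep (c := e.2 - e.1)
      ((ae_isGoodInput hlam hν).mono fun w hw => hw.res_stops _) (hm hs) ht

end Replacement

/-! ### Moments of one inter-arrival time and one service time -/

/-- `E[X ^ k * exp (-s X)]` for `X` with law `ν`. -/
noncomputable def expMoment (ν : Measure ℝ) (s : ℝ) (k : ℕ) : ℝ :=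
  ∫ h, h ^ k * Real.exp (-(s * h)) ∂ν

section Moments

variable {lam : ℝ} {ν : Measure ℝ} [IsProbabilityMeasure ν]

/-- The inequality `x ^ k / k! ≤ exp x` bounds the integrand by `k! / lam ^ k`, so no moment
assumption is needed. -/
lemma integrable_pow_mul_exp (hlam : 0 < lam) (hν : ∀ᵐ h ∂ν, 0 < h) (k : ℕ) :
    Integrable (fun h : ℝ => h ^ k * Real.exp (-(lam * h))) ν := by
  refine Integrable.mono' (integrable_const ((k.factorial : ℝ) / lam ^ k)) (by fun_prop) ?_
  filter_upwards [hν] with h hh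
  rw [Real.norm_eq_abs, abs_of_pos (by positivity), Real.exp_neg, ← div_eq_mul_inv,
    div_le_div_iff₀ (Real.exp_pos _) (by positivity)]
  have := Real.pow_div_factorial_le_exp (lam * h) (by positivity) k
  rw [div_le_iff₀ (by positivity), mul_pow] at this
  linarith

lemma expMoment_zero_pos (hlam : 0 < lam) (hν : ∀ᵐ h ∂ν, 0 < h) : 0 < expMoment ν lam 0 := by
  have h := integrable_pow_mul_exp hlam hν 0
  simp only [pow_zero, one_mul] at h
  simp only [expMoment, pow_zero, one_mul]
  exact integral_exp_pos h

variable [IsProbabilityMeasure (expMeasure lam)]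

lemma integral_pairLaw (hν : ∀ᵐ h ∂ν, 0 < h) {f : ℝ × ℝ → ℝ} (hf : Integrable f (pairLaw lam ν))
    {g : ℝ → ℝ} (hg : ∀ h, 0 < h → ∫ t, f (t, h) ∂expMeasure lam = g h) :
    ∫ e, f e ∂pairLaw lam ν = ∫ h, g h ∂ν := by
  rw [integral_prod_symm _ hf]
  refine integral_congr_ae ?_
  filter_upwards [hν] with h hh using hg h hh

lemma integrable_comp_fst {f : ℝ → ℝ} (hf : Integrable f (expMeasure lam)) :
    Integrable (fun e : ℝ × ℝ => f e.1) (pairLaw lam ν) :=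
  hf.comp_fst ν

lemma integral_comp_fst {f : ℝ → ℝ} (hf : Measurable f) :
    ∫ e, f e.1 ∂pairLaw lam ν = ∫ t, f t ∂expMeasure lam :=
  integral_comp_of_measurable measurePreserving_fst hf

lemma integral_comp_snd {f : ℝ → ℝ} (hf : Measurable f) :
    ∫ e, f e.2 ∂pairLaw lam ν = ∫ h, f h ∂ν :=
  integral_comp_of_measurable measurePreserving_snd hf

lemma integrable_interarrival_lt (hlam : 0 < lam) (k : ℕ) :
    Integrable (fun e : ℝ × ℝ => if e.1 < e.2 then e.1 ^ k else 0) (pairLaw lam ν) := by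
  refine (integrable_comp_fst (integrable_pow_expMeasure hlam k)).mono
    (Measurable.aestronglyMeasurable ?_) (Eventually.of_forall fun e => ?_)
  · exact Measurable.ite (measurableSet_lt (by fun_prop) (by fun_prop)) (by fun_prop) (by fun_prop)
  · split_ifs <;> simp

lemma integral_ite_lt (h : ℝ) (f : ℝ → ℝ) :
    ∫ t, (if t < h then f t else 0) ∂expMeasure lam = ∫ t in Set.Iio h, f t ∂expMeasure lam := by
  rw [← integral_indicator measurableSet_Iio]
  rfl

lemma integral_one_interarrival_lt (hlam : 0 < lam) (hν : ∀ᵐ h ∂ν, 0 < h) :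
    ∫ e : ℝ × ℝ, (if e.1 < e.2 then 1 else 0) ∂pairLaw lam ν = 1 - expMoment ν lam 0 := by
  have hi := integrable_interarrival_lt (ν := ν) hlam 0
  simp only [pow_zero] at hi
  have he := integrable_pow_mul_exp hlam hν 0
  rw [integral_pairLaw hν hi (g := fun h => 1 - h ^ 0 * Real.exp (-(lam * h)))]
  · rw [integral_sub (integrable_const _) he]
    simp [expMoment]
  · intro h hh
    simp only
    rw [integral_ite_lt h fun _ => 1, setIntegral_const, smul_eq_mul, mul_one,
      ← Set.compl_Ici, probReal_compl_eq_one_sub measurableSet_Ici, Measure.real,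
      expMeasure_Ici hlam hh.le, ENNReal.toReal_ofReal (Real.exp_pos _).le, pow_zero, one_mul]

lemma integral_interarrival_lt (hlam : 0 < lam) (hν : ∀ᵐ h ∂ν, 0 < h) :
    ∫ e : ℝ × ℝ, (if e.1 < e.2 then e.1 else 0) ∂pairLaw lam ν =
      1 / lam - expMoment ν lam 0 / lam - expMoment ν lam 1 := by
  have hi := integrable_interarrival_lt (ν := ν) hlam 1
  simp only [pow_one] at hi
  have h0 := integrable_pow_mul_exp hlam hν 0
  have h1 := integrable_pow_mul_exp hlam hν 1
  have hc : ∀ c : ℝ, Integrable (fun _ : ℝ => c) ν := fun c => integrable_const c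
  have hd : ∀ c b : ℝ, Integrable (fun h : ℝ => c - b * (h ^ 0 * Real.exp (-(lam * h)))) ν :=
    fun c b => (hc c).sub (h0.const_mul b)
  rw [integral_pairLaw hν hi (g := fun h => 1 / lam - 1 / lam * (h ^ 0 * Real.exp (-(lam * h))) -
    h ^ 1 * Real.exp (-(lam * h)))]
  · rw [integral_sub (hd _ _) h1,
      integral_sub (integrable_const _) (h0.const_mul _), integral_const_mul, expMoment, expMoment]
    simp only [integral_const, probReal_univ, one_smul]
    ring
  · intro h hh
    rw [integral_ite_lt h fun t => t, setIntegral_Iio_id_expMeasure hlam hh.le]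
    ring

lemma integral_sq_interarrival_lt (hlam : 0 < lam) (hν : ∀ᵐ h ∂ν, 0 < h) :
    ∫ e : ℝ × ℝ, (if e.1 < e.2 then e.1 ^ 2 else 0) ∂pairLaw lam ν =
      2 / lam ^ 2 - 2 * expMoment ν lam 0 / lam ^ 2 - 2 * expMoment ν lam 1 / lam -
        expMoment ν lam 2 := by
  have hi := integrable_interarrival_lt (ν := ν) hlam 2
  have h0 := integrable_pow_mul_exp hlam hν 0
  have h1 := integrable_pow_mul_exp hlam hν 1
  have hc : ∀ c : ℝ, Integrable (fun _ : ℝ => c) ν := fun c => integrable_const c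
  have hd : ∀ c b : ℝ, Integrable (fun h : ℝ => c - b * (h ^ 0 * Real.exp (-(lam * h)))) ν :=
    fun c b => (hc c).sub (h0.const_mul b)
  have h2 := integrable_pow_mul_exp hlam hν 2
  have hd2 : ∀ c b a : ℝ, Integrable (fun h : ℝ => c - b * (h ^ 0 * Real.exp (-(lam * h))) -
      a * (h ^ 1 * Real.exp (-(lam * h)))) ν := fun c b a => (hd c b).sub (h1.const_mul a)
  rw [integral_pairLaw hν hi (g := fun h => 2 / lam ^ 2 -
    2 / lam ^ 2 * (h ^ 0 * Real.exp (-(lam * h))) - 2 / lam * (h ^ 1 * Real.exp (-(lam * h))) -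
    h ^ 2 * Real.exp (-(lam * h)))]
  · rw [integral_sub (hd2 _ _ _) h2,
      integral_sub (hd _ _) (h1.const_mul _),
      integral_sub (integrable_const _) (h0.const_mul _), integral_const_mul, integral_const_mul,
      expMoment, expMoment, expMoment]
    simp only [integral_const, probReal_univ, one_smul]
    ring
  · intro h hh
    rw [integral_ite_lt h fun t => t ^ 2, setIntegral_Iio_sq_expMeasure hlam hh.le]
    ring

lemma integral_const_le_interarrival (hlam : 0 < lam) {h : ℝ} (hh : 0 < h) (c : ℝ) :
    ∫ t, (if h ≤ t then c else 0) ∂expMeasure lam = c * Real.exp (-(lam * h)) := by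
  have := integral_indicator_const (μ := expMeasure lam) c (measurableSet_Ici (a := h))
  rw [Measure.real, expMeasure_Ici hlam hh.le, ENNReal.toReal_ofReal (Real.exp_pos _).le,
    smul_eq_mul, mul_comm] at this
  rw [← this]
  rfl

/-- Integrating over the inter-arrival time first leaves `h ^ k * exp (-(lam * h))`. The event that
the service finishes in time tames heavy service tails, which is why the preemptive system needs no
moments. -/
lemma integrable_service_le (hlam : 0 < lam) (hν : ∀ᵐ h ∂ν, 0 < h) (k : ℕ) :
    Integrable (fun e : ℝ × ℝ => if e.2 ≤ e.1 then e.2 ^ k else 0) (pairLaw lam ν) := by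
  have hm : Measurable fun e : ℝ × ℝ => if e.2 ≤ e.1 then e.2 ^ k else 0 :=
    Measurable.ite (measurableSet_le (by fun_prop) (by fun_prop)) (by fun_prop) (by fun_prop)
  refine (integrable_prod_iff' hm.aestronglyMeasurable).2 ⟨Eventually.of_forall fun h => ?_, ?_⟩
  · refine Integrable.mono' (integrable_const (|h| ^ k))
      (hm.comp measurable_prodMk_right).aestronglyMeasurable (Eventually.of_forall fun t => ?_)
    simp only
    split_ifs <;> simp
  · refine (integrable_pow_mul_exp hlam hν k).congr ?_
    filter_upwards [hν] with h hh
    rw [← integral_const_le_interarrival hlam hh]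
    refine integral_congr_ae (Eventually.of_forall fun t => ?_)
    simp only
    split_ifs
    · rw [Real.norm_eq_abs, abs_of_pos (by positivity)]
    · simp

lemma integral_service_le (hlam : 0 < lam) (hν : ∀ᵐ h ∂ν, 0 < h) (k : ℕ) :
    ∫ e : ℝ × ℝ, (if e.2 ≤ e.1 then e.2 ^ k else 0) ∂pairLaw lam ν = expMoment ν lam k :=
  integral_pairLaw hν (integrable_service_le hlam hν k) fun h hh =>
    integral_const_le_interarrival hlam hh (h ^ k)

lemma memLp_excess (hlam : 0 < lam) (hν : ∀ᵐ h ∂ν, 0 < h) :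
    MemLp (fun e : ℝ × ℝ => max (e.1 - e.2) 0) 2 (pairLaw lam ν) := by
  have h1 : MemLp (fun e : ℝ × ℝ => e.1) 2 (pairLaw lam ν) :=
    (memLp_id_expMeasure hlam).comp_measurePreserving measurePreserving_fst
  refine h1.mono (by fun_prop) ?_
  filter_upwards [Measure.quasiMeasurePreserving_fst.ae (ae_pos_expMeasure lam),
    Measure.quasiMeasurePreserving_snd.ae hν] with e h2 h3
  rw [Real.norm_eq_abs, Real.norm_eq_abs, abs_of_nonneg (le_max_right _ _), abs_of_pos h2]
  exact max_le (by linarith) h2.le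

lemma integral_excess (hlam : 0 < lam) (hν : ∀ᵐ h ∂ν, 0 < h) :
    ∫ e : ℝ × ℝ, max (e.1 - e.2) 0 ∂pairLaw lam ν = expMoment ν lam 0 / lam := by
  rw [integral_pairLaw hν ((memLp_excess hlam hν).integrable one_le_two)
    (g := fun h => 1 / lam * (h ^ 0 * Real.exp (-(lam * h)))), integral_const_mul, expMoment]
  · ring
  · intro h hh
    have := integral_excess_expMeasure hlam hh.le one_ne_zero
    simp only [pow_one, Nat.factorial_one, Nat.cast_one] at this
    rw [this]
    ring

lemma integral_sq_excess (hlam : 0 < lam) (hν : ∀ᵐ h ∂ν, 0 < h) :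
    ∫ e : ℝ × ℝ, max (e.1 - e.2) 0 ^ 2 ∂pairLaw lam ν = 2 * expMoment ν lam 0 / lam ^ 2 := by
  rw [integral_pairLaw hν (memLp_excess hlam hν).integrable_sq
    (g := fun h => 2 / lam ^ 2 * (h ^ 0 * Real.exp (-(lam * h)))), integral_const_mul, expMoment]
  · ring
  · intro h hh
    rw [integral_excess_expMeasure hlam hh.le two_ne_zero]
    norm_num [Nat.factorial]
    ring

lemma memLp_service (h2 : MemLp (fun x : ℝ => x) 2 ν) :
    MemLp (fun e : ℝ × ℝ => e.2) 2 (pairLaw lam ν) :=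
  h2.comp_measurePreserving measurePreserving_snd

lemma memLp_interarrival (hlam : 0 < lam) :
    MemLp (fun e : ℝ × ℝ => e.1) 2 (pairLaw lam ν) :=
  (memLp_id_expMeasure hlam).comp_measurePreserving measurePreserving_fst

lemma integral_service_mul_excess (hlam : 0 < lam) (hν : ∀ᵐ h ∂ν, 0 < h)
    (h2 : MemLp (fun x : ℝ => x) 2 ν) :
    ∫ e : ℝ × ℝ, e.2 * max (e.1 - e.2) 0 ∂pairLaw lam ν = expMoment ν lam 1 / lam := by
  have hi : Integrable (fun e : ℝ × ℝ => e.2 * max (e.1 - e.2) 0) (pairLaw lam ν) :=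
    (memLp_service h2).integrable_mul (memLp_excess hlam hν)
  rw [integral_pairLaw hν hi
    (g := fun h => 1 / lam * (h ^ 1 * Real.exp (-(lam * h)))), integral_const_mul, expMoment]
  · ring
  · intro h hh
    have := integral_excess_expMeasure hlam hh.le one_ne_zero
    simp only [pow_one, Nat.factorial_one, Nat.cast_one] at this
    rw [integral_const_mul, this]
    ring

lemma integral_interarrival_add_service (hlam : 0 < lam) (h2 : MemLp (fun x : ℝ => x) 2 ν) :
    ∫ e : ℝ × ℝ, (e.1 + e.2) ∂pairLaw lam ν = 1 / lam + ∫ h, h ∂ν := by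
  rw [integral_add ((memLp_interarrival hlam).integrable one_le_two)
    ((memLp_service h2).integrable one_le_two), integral_comp_fst (f := fun x => x) (by fun_prop),
    integral_comp_snd (f := fun x => x) (by fun_prop), integral_id_expMeasure hlam]

lemma integral_interarrival_mul {f : ℝ → ℝ} (hlam : 0 < lam) :
    ∫ e : ℝ × ℝ, e.1 * f e.2 ∂pairLaw lam ν = 1 / lam * ∫ h, f h ∂ν := by
  rw [integral_prod_mul (fun x : ℝ => x) f, integral_id_expMeasure hlam]

lemma integral_sq_interarrival_add_service (hlam : 0 < lam) (h2 : MemLp (fun x : ℝ => x) 2 ν) :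
    ∫ e : ℝ × ℝ, (e.1 + e.2) ^ 2 ∂pairLaw lam ν =
      2 / lam ^ 2 + 2 * (1 / lam) * ∫ h, h ∂ν + ∫ h, h ^ 2 ∂ν := by
  have e1 : ∀ e : ℝ × ℝ, (e.1 + e.2) ^ 2 = e.1 ^ 2 + 2 * (e.1 * e.2) + e.2 ^ 2 := fun e => by ring
  have hT := memLp_interarrival (ν := ν) hlam
  have hH := memLp_service (lam := lam) h2
  have hTH : Integrable (fun e : ℝ × ℝ => e.1 * e.2) (pairLaw lam ν) := hT.integrable_mul hH
  simp only [e1]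
  rw [integral_add (hT.integrable_sq.fun_add (hTH.const_mul 2)) hH.integrable_sq,
    integral_add hT.integrable_sq (hTH.const_mul 2), integral_const_mul,
    integral_interarrival_mul (f := fun h => h) hlam, integral_comp_fst (f := fun x => x ^ 2)
    (by fun_prop), integral_comp_snd (f := fun x => x ^ 2) (by fun_prop),
    integral_sq_expMeasure hlam]
  ring

end Moments

/-! ### Time since the last arrival, and the waiting time in M/G/1/2*. -/

lemma finalState_cons {C : Type*} {x : C → ℝ} {step : C → ℝ × ℝ → C} (c : C) (e : ℝ × ℝ)
    {w : ℕ → ℝ × ℝ} (h : ∃ n, x (stateAt step (step c e) w n) ≤ (w n).1) :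
    finalState x step c (cons e w) =
      if x c ≤ e.1 then c else finalState x step (step c e) w := by
  split_ifs with hc
  · have := ((stopsAt_cons_zero (step := step) c e w).2 hc).stopIndex_eq
    rw [finalState, this, stateAt]
  · have := ((stopsAt_cons_succ c e w _).2 ⟨not_le.1 hc, exists_stopsAt h⟩).stopIndex_eq
    rw [finalState, this, stateAt_cons, finalState]

lemma IsGoodInput.finalState_res_pos {w : ℕ → ℝ × ℝ} (hw : IsGoodInput w) {c : ℝ} (hc : 0 < c) :
    0 < finalState resX resStep c w := by
  obtain ⟨r1, -, r3, -⟩ := hw.res_race hc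
  rw [r3]
  linarith [r1 _ le_rfl]

lemma IsGoodInput.finalState_res_le {w : ℕ → ℝ × ℝ} (hw : IsGoodInput w) {c : ℝ} (hc : 0 < c) :
    finalState resX resStep c w ≤ c := by
  obtain ⟨-, -, r3, -⟩ := hw.res_race hc
  rw [r3]
  linarith [hw.sum_nonneg (stopIndex resX resStep c w)]

/-- The last arrival before time `h` is before `h - d` if and only if the first arrival after
`h - d` is not before `h`. -/
lemma IsGoodInput.lt_finalState_res_iff {w : ℕ → ℝ × ℝ} (hw : IsGoodInput w) {h d : ℝ}
    (hd : 0 ≤ d) (hh : d < h) :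
    d < finalState resX resStep h w ↔ d ≤ (restInput resX resStep (h - d) w 0).1 := by
  obtain ⟨r1, r2, r3, -⟩ := hw.res_race (hd.trans_lt hh)
  obtain ⟨s1, s2, -, s4, -⟩ := hw.res_race (sub_pos.2 hh)
  set N := stopIndex resX resStep h w
  set M := stopIndex resX resStep (h - d) w
  have hmono : Monotone fun n => ∑ j ∈ Finset.range n, (w j).1 :=
    monotone_nat_of_le_succ fun n => by
      rw [Finset.sum_range_succ]
      linarith [hw.fst_pos n]
  rw [r3, s4]
  simp only
  constructor
  · intro h1
    by_contra h2
    have h3 : M + 1 ≤ N := by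
      by_contra h4
      have : ∑ j ∈ Finset.range (N + 1), (w j).1 ≤ ∑ j ∈ Finset.range (M + 1), (w j).1 :=
        hmono (by omega)
      linarith
    have : ∑ j ∈ Finset.range (M + 1), (w j).1 ≤ ∑ j ∈ Finset.range N, (w j).1 := hmono h3
    linarith
  · intro h1
    have h3 : N ≤ M := by
      by_contra h4
      have : ∑ j ∈ Finset.range (M + 1), (w j).1 ≤ ∑ j ∈ Finset.range N, (w j).1 :=
        hmono (by omega)
      linarith [r1 N le_rfl]
    have : ∑ j ∈ Finset.range N, (w j).1 ≤ ∑ j ∈ Finset.range M, (w j).1 := hmono h3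
    linarith [s1 M le_rfl]

section Laws

variable {lam : ℝ} {ν : Measure ℝ} [IsProbabilityMeasure ν] [IsProbabilityMeasure (expMeasure lam)]

/-- The time since the last arrival before `h`. -/
lemma map_finalState_res (hlam : 0 < lam) (hν : ∀ᵐ h ∂ν, 0 < h) {h : ℝ} (hh : 0 < h) :
    (iidLaw (pairLaw lam ν)).map (finalState resX resStep h) =
      (expMeasure lam).map fun x => min x h := by
  have hmF : Measurable fun w : ℕ → ℝ × ℝ => finalState resX resStep h w :=
    (measurable_finalState measurable_resX measurable_resStep).comp measurable_prodMk_left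
  have hgood := ae_isGoodInput (ν := ν) hlam hν
  -- The exponential law has no atoms, which reconciles the strict tail on one side with the weak
  -- one produced by the race.
  have hna : ∀ d : ℝ, Set.Ioi d =ᵐ[expMeasure lam] Set.Ici d := fun d =>
    (withDensity_absolutelyContinuous volume (exponentialPDF lam)).ae_eq Ioi_ae_eq_Ici
  have hm : Measurable fun x : ℝ => min x h := by fun_prop
  have := Measure.isProbabilityMeasure_map (μ := iidLaw (pairLaw lam ν)) hmF.aemeasurable
  have := Measure.isProbabilityMeasure_map (μ := expMeasure lam) hm.aemeasurable
  refine Measure.ext_of_Iic _ _ fun d => ?_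
  rw [← Set.compl_Ioi, prob_compl_eq_one_sub measurableSet_Ioi,
    prob_compl_eq_one_sub measurableSet_Ioi, Measure.map_apply hmF measurableSet_Ioi,
    Measure.map_apply hm measurableSet_Ioi]
  congr 1
  rcases lt_or_ge d 0 with hd | hd
  · have h1 : finalState resX resStep h ⁻¹' Set.Ioi d =ᵐ[iidLaw (pairLaw lam ν)]
        (Set.univ : Set (ℕ → ℝ × ℝ)) := by
      filter_upwards [hgood] with w hw
      exact propext ⟨fun _ => trivial, fun _ => hd.trans (hw.finalState_res_pos hh)⟩
    have h3 : (fun x => min x h) ⁻¹' Set.Ioi d =ᵐ[expMeasure lam] (Set.univ : Set ℝ) := by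
      filter_upwards [ae_pos_expMeasure lam] with x hx
      exact propext ⟨fun _ => trivial, fun _ => hd.trans (lt_min hx hh)⟩
    rw [measure_congr h1, measure_congr h3, measure_univ, measure_univ]
  · rcases lt_or_ge d h with hdh | hdh
    · have hmR : Measurable fun w : ℕ → ℝ × ℝ => restInput resX resStep (h - d) w :=
        (measurable_restInput measurable_resX measurable_resStep).comp measurable_prodMk_left
      have hA : MeasurableSet {w : ℕ → ℝ × ℝ | d ≤ (w 0).1} :=
        measurableSet_le (by fun_prop) (by fun_prop)
      have h1 := iidLaw_finalState_restInput (ν := ν) hlam (fun c => le_max_right c 0)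
        measurable_resX measurable_resStep (c := h - d)
        (hgood.mono fun w hw => hw.res_stops _) MeasurableSet.univ hA
      simp only [Set.mem_univ, true_and, Set.ofPred_true, measure_univ, one_mul] at h1
      have h2 : finalState resX resStep h ⁻¹' Set.Ioi d =ᵐ[iidLaw (pairLaw lam ν)]
          {w | restInput resX resStep (h - d) w ∈ {w : ℕ → ℝ × ℝ | d ≤ (w 0).1}} := by
        filter_upwards [hgood] with w hw
        exact propext (hw.lt_finalState_res_iff hd hdh)
      have h3 : (fun x => min x h) ⁻¹' Set.Ioi d = Set.Ioi d := by
        ext x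
        simp [hdh]
      rw [measure_congr h2, h3, measure_congr (hna d)]
      refine h1.trans ?_
      have h4 := iidLaw_pi (pairLaw lam ν) 1 (t := fun _ => Set.Ici d ×ˢ Set.univ)
        fun _ => measurableSet_Ici.prod MeasurableSet.univ
      simp only [Finset.prod_range_one, Measure.prod_prod, measure_univ, mul_one] at h4
      rw [← h4]
      congr 1
      ext w
      simp
    · have h1 : finalState resX resStep h ⁻¹' Set.Ioi d =ᵐ[iidLaw (pairLaw lam ν)]
          (∅ : Set (ℕ → ℝ × ℝ)) := by
        filter_upwards [hgood] with w hw
        refine propext ⟨fun h2 => ?_, fun h2 => h2.elim⟩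
        exact absurd (hw.finalState_res_le hh) (not_le.2 (hdh.trans_lt h2))
      have h3 : (fun x => min x h) ⁻¹' Set.Ioi d = ∅ := by
        ext x
        simp [hdh]
      rw [measure_congr h1, h3, measure_empty, measure_empty]

/-- The law of the waiting time of a served packet. -/
lemma map_replacementBlock_wait (hlam : 0 < lam) (hν : ∀ᵐ h ∂ν, 0 < h) :
    (iidLaw (pairLaw lam ν)).map (fun v => (replacementBlock v).2.2) =
      (pairLaw lam ν).map fun e => if e.1 < e.2 then e.1 else 0 := by
  have hmD : Measurable fun v => (replacementBlock v).2.2 :=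
    measurable_snd.comp (measurable_snd.comp measurable_replacementBlock)
  have hmg : Measurable fun e : ℝ × ℝ => if e.1 < e.2 then e.1 else 0 :=
    Measurable.ite (measurableSet_lt (by fun_prop) (by fun_prop)) (by fun_prop) (by fun_prop)
  have hgood := ae_isGoodInput (ν := ν) hlam hν
  refine Measure.ext_of_lintegral _ fun f hf => ?_
  have hmfD : Measurable fun v => f (replacementBlock v).2.2 := hf.comp hmD
  rw [lintegral_map hf hmD, lintegral_map hf hmg, lintegral_iidLaw _ hmfD]
  have hmfg : Measurable fun e : ℝ × ℝ => f (if e.1 < e.2 then e.1 else 0) := hf.comp hmg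
  have hm1 : Measurable fun e : ℝ × ℝ =>
      ∫⁻ w, f (replacementBlock (cons e w)).2.2 ∂iidLaw (pairLaw lam ν) :=
    (hmfD.comp measurable_cons).lintegral_prod_right'
  rw [lintegral_prod_symm _ hm1.aemeasurable, lintegral_prod_symm _ hmfg.aemeasurable]
  refine lintegral_congr_ae ?_
  filter_upwards [hν] with h hh
  have hmh : Measurable fun x : ℝ => if x < h then x else 0 :=
    Measurable.ite measurableSet_Iio (by fun_prop) (by fun_prop)
  have hmF : Measurable fun w : ℕ → ℝ × ℝ => finalState resX resStep h w :=
    (measurable_finalState measurable_resX measurable_resStep).comp measurable_prodMk_left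
  have hmfF : Measurable fun w : ℕ → ℝ × ℝ =>
      f (if finalState resX resStep h w < h then finalState resX resStep h w else 0) :=
    hf.comp (hmh.comp hmF)
  have hlaw : ∫⁻ w, f (if finalState resX resStep h w < h then finalState resX resStep h w else 0)
      ∂iidLaw (pairLaw lam ν) = ∫⁻ x, f (if x < h then x else 0) ∂expMeasure lam := by
    have h1 := lintegral_map (μ := iidLaw (pairLaw lam ν)) (hf.comp hmh) hmF
    rw [map_finalState_res hlam hν hh, lintegral_map (hf.comp hmh) (by fun_prop)] at h1
    refine h1.symm.trans (lintegral_congr fun x => ?_)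
    simp only [Function.comp_apply]
    by_cases hx : x < h
    · rw [min_eq_left hx.le]
    · rw [min_eq_right (not_lt.1 hx), if_neg (lt_irrefl h), if_neg hx]
  rw [← hlaw, lintegral_iidLaw _ hmfF]
  have hm2 : Measurable fun e : ℝ × ℝ => ∫⁻ w, f (if finalState resX resStep h (cons e w) < h
      then finalState resX resStep h (cons e w) else 0) ∂iidLaw (pairLaw lam ν) :=
    (hmfF.comp measurable_cons).lintegral_prod_right'
  rw [lintegral_prod _ hm2.aemeasurable]
  refine lintegral_congr_ae ?_
  filter_upwards [ae_pos_expMeasure lam] with t ht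
  -- The race against a residual time ignores service times, so `h'` is a dummy. For `t < h` the
  -- residual is at most `h - t < h`, so the exceptional value is not hit.
  have h2 : ∀ h', ∫⁻ w, f (if finalState resX resStep h (cons (t, h') w) < h
      then finalState resX resStep h (cons (t, h') w) else 0) ∂iidLaw (pairLaw lam ν) =
      ∫⁻ w, f (replacementBlock (cons (t, h) w)).2.2 ∂iidLaw (pairLaw lam ν) := by
    intro h'
    refine lintegral_congr_ae ?_
    filter_upwards [hgood] with w hw
    rw [finalState_cons h (t, h') (hw.res_stops _), replacementBlock, cons_zero, tail_cons]
    simp only [resX, resStep, max_eq_left hh.le]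
    by_cases hc : h ≤ t
    · simp [hc]
    · have h3 := hw.finalState_res_le (c := h - t) (by linarith)
      simp only [hc, if_false]
      rw [if_pos (by linarith)]
  simp only [h2, lintegral_const, measure_univ, mul_one]

end Laws

/-! ### Metrics of M/G/1/1 and M/G/1/2*. -/

section Systems

variable {Ω : Type*} [MeasurableSpace Ω] {P : Measure Ω} {lam : ℝ}
  {T H : ℕ → Ω → ℝ}

lemma IsQueueInput.ae_pos_service (hq : IsQueueInput P lam T H) : ∀ᵐ h ∂P.map (H 0), 0 < h :=
  (ae_map_iff (hq.measurable_service 0).aemeasurable measurableSet_Ioi).2 hq.service_pos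

lemma IsQueueInput.memLp_service (hq : IsQueueInput P lam T H) (h2 : MemLp (H 0) 2 P) :
    MemLp (fun x : ℝ => x) 2 (P.map (H 0)) :=
  (memLp_map_measure_iff (by fun_prop) (hq.measurable_service 0).aemeasurable).2 h2

lemma IsQueueInput.memLp_interarrival (hq : IsQueueInput P lam T H) (hlam : 0 < lam) (n : ℕ) :
    MemLp (T n) 2 P := by
  have h := memLp_id_expMeasure hlam
  rw [← hq.law_interarrival n] at h
  exact (memLp_map_measure_iff (by fun_prop) (hq.measurable_interarrival n).aemeasurable).1 h

lemma integral_id_pos {ν : Measure ℝ} [IsProbabilityMeasure ν] (hν : ∀ᵐ h ∂ν, 0 < h)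
    (hi : Integrable (fun h : ℝ => h) ν) : 0 < ∫ h, h ∂ν := by
  rw [integral_pos_iff_support_of_nonneg_ae (hν.mono fun h hh => hh.le) hi]
  have h1 : Function.support (fun h : ℝ => h) =ᵐ[ν] (Set.univ : Set ℝ) := by
    filter_upwards [hν] with h hh
    exact propext ⟨fun _ => trivial, fun _ => hh.ne'⟩
  rw [measure_congr h1, measure_univ]
  exact one_pos

variable [IsProbabilityMeasure P]

/-- The metrics of M/G/1/1 in terms of the moments of the service time. -/
theorem systemHasMetrics_blocking (hq : IsQueueInput P lam T H) (hlam : 0 < lam)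
    (h2 : MemLp (H 0) 2 P) {m₁ m₂ : ℝ} (hm₁ : ∫ h, h ∂P.map (H 0) = m₁)
    (hm₂ : ∫ h, h ^ 2 ∂P.map (H 0) = m₂) :
    SystemHasMetrics P T H .blocking
      ((2 / lam ^ 2 + 2 / lam * m₁ + m₂) / (2 * (1 / lam + m₁)) + m₁) (1 / lam + 2 * m₁)
      (1 / lam ^ 2 + 2 * m₂ - 2 * m₁ ^ 2) := by
  have := Measure.isProbabilityMeasure_map (μ := P) (hq.measurable_service 0).aemeasurable
  have := isProbabilityMeasure_expMeasure hlam
  have hν := hq.ae_pos_service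
  have hν2 := hq.memLp_service h2
  have hmT := hq.measurable_interarrival
  have hmH := hq.measurable_service
  have hin := hq.measurePreserving (f := fun n => n) (fun _ _ h => h)
  have hreg := isRegeneration_blocking (ν := P.map (H 0)) hlam hν
  have hρ : (iidLaw (pairLaw lam (P.map (H 0)))).map (fun w => w 0) = pairLaw lam (P.map (H 0)) :=
    (measurePreserving_eval_infinitePi (fun _ : ℕ => pairLaw lam (P.map (H 0))) 0).map_eq
  have := Measure.isProbabilityMeasure_map (μ := iidLaw (pairLaw lam (P.map (H 0))))
    hreg.measurable_block.aemeasurable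
  have hs : MemLp (fun e : ℝ × ℝ => e.2) 2 (pairLaw lam (P.map (H 0))) := memLp_service hν2
  have hj : MemLp (fun e : ℝ × ℝ => e.1 + e.2) 2 (pairLaw lam (P.map (H 0))) :=
    (memLp_interarrival hlam).add hs
  have hB : IsBlockSystem P T H .blocking
      ((iidLaw (pairLaw lam (P.map (H 0)))).map (fun w => w 0))
      (fun ω l => blockingRest^[l] (fun n => (T n ω, H n ω)) 0) (fun _ => 0) (fun e => e.2)
      (fun _ => 0) (fun e => e.1 + e.2) (fun ω => H 0 ω) (fun ω => T 0 ω + H 0 ω) :=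
    { measurePreserving := hreg.measurePreserving_blocks.comp hin
      measurable_d := measurable_const
      measurable_s := measurable_snd
      measurable_i := measurable_const
      measurable_j := by fun_prop
      measurable_B₀ := hmH 0
      measurable_C₀ := (hmT 0).add (hmH 0)
      memLp_d := memLp_const 0
      memLp_s := by rw [hρ]; exact hs
      memLp_i := memLp_const 0
      memLp_j := by rw [hρ]; exact hj
      memLp_B₀ := h2
      memLp_C₀ := (hq.memLp_interarrival hlam 0).add h2
      path := by
        filter_upwards [hin.quasiMeasurePreserving.ae
          (ae_isGoodInput (ν := P.map (H 0)) hlam hν)] with ω hω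
        obtain ⟨p1, p2, p3⟩ := blocking_path hω
        refine ⟨_, p1, ?_, ?_, fun l => ⟨?_, ?_⟩⟩
        · simp [blockingIndex, completion, arrival]
        · exact p2 0
        · rw [p2 (l + 1), zero_add]
        · rw [p3 l, zero_add] }
  have hmain := hB.systemHasMetrics_of_moments hlam (hq.measureReal_arrival_le hlam)
    (d₁ := 0) (d₂ := 0) (s₁ := m₁) (s₂ := m₂) (si := 0) (i₁ := 0) (i₂ := 0) (j₁ := 1 / lam + m₁)
    (j₂ := 2 / lam ^ 2 + 2 * (1 / lam) * m₁ + m₂) (by simp) (by simp)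
    (by rw [hρ, integral_comp_snd (f := fun x => x) (by fun_prop), hm₁])
    (by rw [hρ, integral_comp_snd (f := fun x => x ^ 2) (by fun_prop), hm₂])
    (by simp) (by simp) (by simp)
    (by rw [hρ, integral_interarrival_add_service hlam hν2, hm₁])
    (by rw [hρ, integral_sq_interarrival_add_service hlam hν2, hm₁, hm₂])
  have hpos : 0 < m₁ := hm₁ ▸ integral_id_pos hν (hν2.integrable one_le_two)
  have hpos' : 0 < 1 + lam * m₁ := by positivity
  convert hmain using 1
  · field_simp
    ring
  · ring
  · field_simp
    ring

/-- The metrics of M/G/1/2* in terms of the moments of the service time. -/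
theorem systemHasMetrics_replacement (hq : IsQueueInput P lam T H) (hlam : 0 < lam)
    (h2 : MemLp (H 0) 2 P) {m₁ m₂ e₀ e₁ e₂ : ℝ} (hm₁ : ∫ h, h ∂P.map (H 0) = m₁)
    (hm₂ : ∫ h, h ^ 2 ∂P.map (H 0) = m₂) (he₀ : expMoment (P.map (H 0)) lam 0 = e₀)
    (he₁ : expMoment (P.map (H 0)) lam 1 = e₁) (he₂ : expMoment (P.map (H 0)) lam 2 = e₂) :
    SystemHasMetrics P T H .replacement
      ((1 / 2 * m₂ + 1 / lam ^ 2 * e₀ + 1 / lam * e₁) / (m₁ + e₀ / lam) +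
        1 / lam - 1 / lam * e₀ - e₁ + m₁)
      (2 * m₁ + 1 / lam - e₁)
      (2 * m₂ - 2 * m₁ ^ 2 + 2 * e₀ * (1 - e₀) / lam ^ 2 - 2 * e₀ / lam * (m₁ + e₁) +
        1 / lam ^ 2 - e₂ + 2 / lam * e₁ - e₁ ^ 2) := by
  have := Measure.isProbabilityMeasure_map (μ := P) (hq.measurable_service 0).aemeasurable
  have := isProbabilityMeasure_expMeasure hlam
  have hν := hq.ae_pos_service
  have hν2 := hq.memLp_service h2
  have hmT := hq.measurable_interarrival
  have hmH := hq.measurable_service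
  -- Here a service time is paired with the inter-arrival time after the packet, because the race to
  -- be run is between that service and the next arrival.
  have hin := hq.measurePreserving (f := fun n => n + 1) (fun a b h => Nat.succ_injective h)
  have hreg := isRegeneration_replacement (ν := P.map (H 0)) hlam hν
  set q := iidLaw (pairLaw lam (P.map (H 0))) with hq'
  have hΦ : MeasurePreserving replacementBlock q (q.map replacementBlock) :=
    measurable_replacementBlock.measurePreserving q
  have hev : MeasurePreserving (fun w : ℕ → ℝ × ℝ => w 0) q (pairLaw lam (P.map (H 0))) :=
    measurePreserving_eval_infinitePi (fun _ : ℕ => pairLaw lam (P.map (H 0))) 0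
  have := Measure.isProbabilityMeasure_map (μ := q) hreg.measurable_block.aemeasurable
  have hfst : ∀ v, (replacementBlock v).1 = (v 0).2 := fun v => by
    rw [replacementBlock]
    split_ifs <;> rfl
  have hidle : ∀ v, (replacementBlock v).2.1 = max ((v 0).1 - (v 0).2) 0 := fun v => by
    rw [replacementBlock]
    split_ifs with h
    · exact (max_eq_left (by linarith)).symm
    · exact (max_eq_right (by linarith)).symm
  have hwait := map_replacementBlock_wait (ν := P.map (H 0)) hlam hν
  have hmD : Measurable fun v => (replacementBlock v).2.2 :=
    measurable_snd.comp (measurable_snd.comp measurable_replacementBlock)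
  have hmg : Measurable fun e : ℝ × ℝ => if e.1 < e.2 then e.1 else 0 :=
    Measurable.ite (measurableSet_lt (by fun_prop) (by fun_prop)) (by fun_prop) (by fun_prop)
  have memLp_block : ∀ {f : ℝ × ℝ × ℝ → ℝ} {g : ℝ × ℝ → ℝ}, Measurable f →
      MemLp g 2 (pairLaw lam (P.map (H 0))) → (∀ v, f (replacementBlock v) = g (v 0)) →
      MemLp f 2 (q.map replacementBlock) := by
    intro f g hf hg hfg
    rw [memLp_map_measure_iff hf.aestronglyMeasurable hΦ.measurable.aemeasurable]
    have : f ∘ replacementBlock = g ∘ fun w => w 0 := funext hfg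
    rw [this]
    exact hg.comp_measurePreserving hev
  have integral_block : ∀ {f : ℝ × ℝ × ℝ → ℝ} {g : ℝ × ℝ → ℝ}, Measurable f → Measurable g →
      (∀ v, f (replacementBlock v) = g (v 0)) →
      ∫ x, f x ∂q.map replacementBlock = ∫ e, g e ∂pairLaw lam (P.map (H 0)) := by
    intro f g hf hg hfg
    rw [← integral_comp_of_measurable hΦ hf, ← integral_comp_of_measurable hev hg]
    simp only [hfg]
  have integral_wait : ∀ {f : ℝ → ℝ}, Measurable f →
      ∫ x : ℝ × ℝ × ℝ, f x.2.2 ∂q.map replacementBlock =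
        ∫ e : ℝ × ℝ, f (if e.1 < e.2 then e.1 else 0) ∂pairLaw lam (P.map (H 0)) := by
    intro f hf
    rw [← integral_comp_of_measurable hΦ (g := fun x : ℝ × ℝ × ℝ => f x.2.2) (by fun_prop),
      ← integral_map hmg.aemeasurable hf.aestronglyMeasurable, ← hwait,
      integral_map hmD.aemeasurable hf.aestronglyMeasurable]
  have hmemg : MemLp (fun e : ℝ × ℝ => if e.1 < e.2 then e.1 else 0) 2
      (pairLaw lam (P.map (H 0))) := by
    refine (memLp_interarrival hlam).mono hmg.aestronglyMeasurable (Eventually.of_forall fun e => ?_)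
    split_ifs <;> simp
  have hmemD : MemLp (fun x : ℝ × ℝ × ℝ => x.2.2) 2 (q.map replacementBlock) := by
    rw [memLp_map_measure_iff (by fun_prop) hΦ.measurable.aemeasurable]
    have h1 : MemLp (fun x : ℝ => x) 2 (q.map fun v => (replacementBlock v).2.2) := by
      rw [hwait]
      exact (memLp_map_measure_iff (by fun_prop) hmg.aemeasurable).2 hmemg
    exact (memLp_map_measure_iff (by fun_prop) hmD.aemeasurable).1 h1
  have hB : IsBlockSystem P T H .replacement (q.map replacementBlock)
      (fun ω l => replacementBlock (replacementRest^[l] fun n => (T (n + 1) ω, H n ω)))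
      (fun x => x.2.2) (fun x => x.1) (fun x => x.2.1) (fun x => x.1) (fun ω => H 0 ω)
      (fun ω => T 0 ω + H 0 ω) :=
    { measurePreserving := hreg.measurePreserving_blocks.comp hin
      measurable_d := by fun_prop
      measurable_s := by fun_prop
      measurable_i := by fun_prop
      measurable_j := by fun_prop
      measurable_B₀ := hmH 0
      measurable_C₀ := (hmT 0).add (hmH 0)
      memLp_d := hmemD
      memLp_s := memLp_block (by fun_prop) (memLp_service hν2) hfst
      memLp_i := memLp_block (by fun_prop) (memLp_excess hlam hν) hidle
      memLp_j := memLp_block (by fun_prop) (memLp_service hν2) hfst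
      memLp_B₀ := h2
      memLp_C₀ := (hq.memLp_interarrival hlam 0).add h2
      path := by
        have h0 : ∀ᵐ ω ∂P, 0 < T 0 ω := by
          have := ae_pos_expMeasure lam
          rw [← hq.law_interarrival 0] at this
          exact ae_of_ae_map (hmT 0).aemeasurable this
        filter_upwards [h0, hin.quasiMeasurePreserving.ae
          (ae_isGoodInput (ν := P.map (H 0)) hlam hν)] with ω hω0 hω
        obtain ⟨p1, p2, p3, p4⟩ := replacement_path (T := fun n => T n ω) hω0 hω
        exact ⟨_, p1, p2, p3, p4⟩ }
  have hsi : ∫ x : ℝ × ℝ × ℝ, x.1 * x.2.1 ∂q.map replacementBlock = e₁ / lam := by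
    rw [integral_block (g := fun e => e.2 * max (e.1 - e.2) 0) (by fun_prop) (by fun_prop)
      (fun v => by rw [hfst, hidle]), integral_service_mul_excess hlam hν hν2, he₁]
  have hs₁ : ∫ x : ℝ × ℝ × ℝ, x.1 ∂q.map replacementBlock = m₁ := by
    rw [integral_block (g := fun e => e.2) (by fun_prop) (by fun_prop) hfst,
      integral_comp_snd (f := fun x => x) (by fun_prop), hm₁]
  have hs₂ : ∫ x : ℝ × ℝ × ℝ, x.1 ^ 2 ∂q.map replacementBlock = m₂ := by
    rw [integral_block (g := fun e => e.2 ^ 2) (by fun_prop) (by fun_prop)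
      (fun v => by rw [hfst]), integral_comp_snd (f := fun x => x ^ 2) (by fun_prop), hm₂]
  have hd₂ : ∫ x : ℝ × ℝ × ℝ, x.2.2 ^ 2 ∂q.map replacementBlock =
      2 / lam ^ 2 - 2 * e₀ / lam ^ 2 - 2 * e₁ / lam - e₂ := by
    rw [integral_wait (f := fun x => x ^ 2) (by fun_prop), ← he₀, ← he₁, ← he₂,
      ← integral_sq_interarrival_lt hlam hν]
    refine integral_congr_ae (Eventually.of_forall fun e => ?_)
    simp only
    split_ifs <;> simp
  have hmain := hB.systemHasMetrics_of_moments hlam (hq.measureReal_arrival_le hlam)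
    (d₁ := 1 / lam - e₀ / lam - e₁) (i₁ := e₀ / lam) (i₂ := 2 * e₀ / lam ^ 2)
    (by rw [integral_wait (f := fun x => x) (by fun_prop), integral_interarrival_lt hlam hν, he₀, he₁])
    hd₂ hs₁ hs₂ hsi
    (by rw [integral_block (g := fun e => max (e.1 - e.2) 0) (by fun_prop) (by fun_prop) hidle,
      integral_excess hlam hν, he₀])
    (by rw [integral_block (g := fun e => max (e.1 - e.2) 0 ^ 2) (by fun_prop) (by fun_prop)
      (fun v => by rw [hidle]), integral_sq_excess hlam hν, he₀]) hs₁ hs₂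
  have hpos : 0 < m₁ := hm₁ ▸ integral_id_pos hν (hν2.integrable one_le_two)
  have hpos0 : 0 < e₀ := he₀ ▸ expMoment_zero_pos hlam hν
  have hpos' : 0 < m₁ * lam + e₀ := by positivity
  convert hmain using 1
  · field_simp
    ring
  · ring
  · field_simp
    ring

end Systems

/-! ### Law of a run of preemptions, and its renewal equation. -/

lemma finalState_pre_translate (t h : ℝ) (w : ℕ → ℝ × ℝ) :
    finalState preX preStep (t, h) w =
      (t + (finalState preX preStep (0, h) w).1, (finalState preX preStep (0, h) w).2) := by
  have h1 : ∀ n, stateAt preStep (t, h) w n =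
      (t + (stateAt preStep (0, h) w n).1, (stateAt preStep (0, h) w n).2) := by
    intro n
    rw [preStateAt_eq, preStateAt_eq]
    cases n <;> simp
  have h2 : stopIndex preX preStep (t, h) w = stopIndex preX preStep (0, h) w := by
    simp only [stopIndex, h1]
  rw [finalState, finalState, h2, h1]

/-- The law of the time between the arrival of a packet and the arrival of the next packet that is
not preempted (the same one, maybe), and of the service time of the latter. -/
noncomputable def preemptionLaw (lam : ℝ) (ν : Measure ℝ) [IsProbabilityMeasure ν]
    [IsProbabilityMeasure (expMeasure lam)] : Measure (ℝ × ℝ) :=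
  (ν.prod (iidLaw (pairLaw lam ν))).map fun y => finalState preX preStep (0, y.1) y.2

/-- A packet is either served, or preempted by the next one. -/
noncomputable def preemptionStep (z : (ℝ × ℝ) × (ℝ × ℝ)) : ℝ × ℝ :=
  if z.1.2 ≤ z.1.1 then (0, z.1.2) else (z.1.1 + z.2.1, z.2.2)

section Laws

variable {lam : ℝ} {ν : Measure ℝ} [IsProbabilityMeasure ν] [IsProbabilityMeasure (expMeasure lam)]

lemma measurable_finalState_pre :
    Measurable fun y : ℝ × (ℕ → ℝ × ℝ) => finalState preX preStep (0, y.1) y.2 := by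
  have h : Measurable fun y : ℝ × (ℕ → ℝ × ℝ) => (((0 : ℝ), y.1), y.2) := by fun_prop
  exact (measurable_finalState measurable_preX measurable_preStep).comp h

instance : IsProbabilityMeasure (preemptionLaw lam ν) :=
  Measure.isProbabilityMeasure_map measurable_finalState_pre.aemeasurable

lemma lintegral_preemptionLaw {f : ℝ × ℝ → ℝ≥0∞} (hf : Measurable f) :
    ∫⁻ y, f y ∂preemptionLaw lam ν =
      ∫⁻ h, ∫⁻ w, f (finalState preX preStep (0, h) w) ∂iidLaw (pairLaw lam ν) ∂ν := by
  have hm : Measurable fun y : ℝ × (ℕ → ℝ × ℝ) => f (finalState preX preStep (0, y.1) y.2) :=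
    hf.comp measurable_finalState_pre
  rw [preemptionLaw, lintegral_map hf measurable_finalState_pre, lintegral_prod _ hm.aemeasurable]

lemma measurable_preemptionStep : Measurable preemptionStep :=
  Measurable.ite (measurableSet_le (by fun_prop) (by fun_prop)) (by fun_prop) (by fun_prop)

/-- First-step analysis: a packet with service time `h` is served without delay if the next arrival
takes `t ≥ h`; otherwise the same experiment restarts with the next packet, delayed by `t`. The law
is therefore a fixed point of `preemptionStep`. -/
lemma measurePreserving_preemptionStep (hlam : 0 < lam) (hν : ∀ᵐ h ∂ν, 0 < h) :
    MeasurePreserving preemptionStep ((pairLaw lam ν).prod (preemptionLaw lam ν))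
      (preemptionLaw lam ν) := by
  have hgood := ae_isGoodInput (ν := ν) hlam hν
  refine ⟨measurable_preemptionStep, Measure.ext_of_lintegral _ fun f hf => ?_⟩
  have hm1 : Measurable fun z => f (preemptionStep z) := hf.comp measurable_preemptionStep
  have hm2 : Measurable fun e : ℝ × ℝ => ∫⁻ y, f (preemptionStep (e, y)) ∂preemptionLaw lam ν :=
    hm1.lintegral_prod_right'
  rw [lintegral_map hf measurable_preemptionStep, lintegral_prod _ hm1.aemeasurable,
    lintegral_prod_symm _ hm2.aemeasurable, lintegral_preemptionLaw hf]
  refine lintegral_congr_ae ?_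
  filter_upwards [hν] with h hh
  have hm3 : Measurable fun w : ℕ → ℝ × ℝ => f (finalState preX preStep (0, h) w) :=
    (hf.comp measurable_finalState_pre).comp measurable_prodMk_left
  have hm4 : Measurable fun e : ℝ × ℝ => ∫⁻ w, f (finalState preX preStep (0, h) (cons e w))
      ∂iidLaw (pairLaw lam ν) := (hm3.comp measurable_cons).lintegral_prod_right'
  rw [lintegral_iidLaw _ hm3, lintegral_prod _ hm4.aemeasurable]
  refine lintegral_congr fun t => ?_
  have hcons : ∀ h', ∫⁻ w, f (finalState preX preStep (0, h) (cons (t, h') w))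
      ∂iidLaw (pairLaw lam ν) = ∫⁻ w, f (if h ≤ t then (0, h) else
        (t + (finalState preX preStep (0, h') w).1, (finalState preX preStep (0, h') w).2))
          ∂iidLaw (pairLaw lam ν) := by
    intro h'
    refine lintegral_congr_ae ?_
    filter_upwards [hgood] with w hw
    rw [finalState_cons (0, h) (t, h') (hw.pre_stops _)]
    simp only [preX, preStep, max_eq_left hh.le, zero_add]
    rw [← finalState_pre_translate]
  simp only [hcons, preemptionStep]
  by_cases hc : h ≤ t
  · simp [hc]
  · have hf' : Measurable fun y : ℝ × ℝ => f (t + y.1, y.2) := by fun_prop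
    simp only [hc, if_false]
    exact lintegral_preemptionLaw hf'

/-- The first inter-arrival time enters only as a shift of the elapsed time and is independent of
the preemptions that follow. -/
lemma map_preemptiveBlock :
    (iidLaw (pairLaw lam ν)).map preemptiveBlock =
      ((expMeasure lam).prod (preemptionLaw lam ν)).map fun z => (z.1 + z.2.1, z.2.2) := by
  have hmB : Measurable preemptiveBlock :=
    (measurable_finalState measurable_preX measurable_preStep).comp
      ((measurable_pi_apply 0).prodMk measurable_tail)
  have hmS : Measurable fun z : ℝ × ℝ × ℝ => (z.1 + z.2.1, z.2.2) := by fun_prop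
  refine Measure.ext_of_lintegral _ fun f hf => ?_
  have hm1 : Measurable fun w => f (preemptiveBlock w) := hf.comp hmB
  have hm2 : Measurable fun z : ℝ × ℝ × ℝ => f (z.1 + z.2.1, z.2.2) := hf.comp hmS
  have hm3 : Measurable fun e : ℝ × ℝ => ∫⁻ w, f (preemptiveBlock (cons e w))
      ∂iidLaw (pairLaw lam ν) := (hm1.comp measurable_cons).lintegral_prod_right'
  rw [lintegral_map hf hmB, lintegral_map hf hmS, lintegral_iidLaw _ hm1,
    lintegral_prod _ hm3.aemeasurable, lintegral_prod _ hm2.aemeasurable]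
  refine lintegral_congr fun t => ?_
  have hf' : Measurable fun y : ℝ × ℝ => f (t + y.1, y.2) := by fun_prop
  rw [lintegral_preemptionLaw hf']
  simp only [preemptiveBlock, cons_zero, tail_cons]
  refine lintegral_congr fun h => lintegral_congr fun w => ?_
  rw [← finalState_pre_translate]

/-- A function that satisfies a renewal equation is integrable, and its integral solves the
equation. -/
lemma integrable_preemptionLaw (hlam : 0 < lam) (hν : ∀ᵐ h ∂ν, 0 < h) {f : ℝ × ℝ → ℝ}
    {φ : (ℝ × ℝ) × (ℝ × ℝ) → ℝ} (hf : Measurable f)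
    (hφ : Integrable φ ((pairLaw lam ν).prod (preemptionLaw lam ν)))
    (h : ∀ z, f (preemptionStep z) = φ z + (if z.1.1 < z.1.2 then 1 else 0) * f z.2) :
    Integrable f (preemptionLaw lam ν) ∧
      expMoment ν lam 0 * ∫ y, f y ∂preemptionLaw lam ν =
        ∫ z, φ z ∂(pairLaw lam ν).prod (preemptionLaw lam ν) := by
  have hΘ := measurePreserving_preemptionStep (ν := ν) hlam hν
  have he0 := expMoment_zero_pos (ν := ν) hlam hν
  have hA : Integrable (fun e : ℝ × ℝ => if e.1 < e.2 then (1 : ℝ) else 0) (pairLaw lam ν) := by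
    simpa using integrable_interarrival_lt (ν := ν) hlam 0
  have hAint := integral_one_interarrival_lt (ν := ν) hlam hν
  have hintf : Integrable f (preemptionLaw lam ν) := by
    -- The fixed-point identity cannot be rearranged before integrability is known. For the
    -- truncation it gives `E[min |f| M] ≤ E[|φ|] + (1 - e) * E[min |f| M]`, where `e` is the
    -- positive probability `expMoment ν lam 0`; this is a bound uniform in `M`.
    have hb : ∀ M : ℕ, ∫ y, min |f y| M ∂preemptionLaw lam ν ≤
        (∫ z, |φ z| ∂(pairLaw lam ν).prod (preemptionLaw lam ν)) / expMoment ν lam 0 := by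
      intro M
      have hmM : Measurable fun y : ℝ × ℝ => min |f y| (M : ℝ) := by fun_prop
      have hbd : ∀ x : ℝ, ‖min |x| (M : ℝ)‖ ≤ M := fun x => by
        rw [Real.norm_eq_abs, abs_of_nonneg (le_min (abs_nonneg x) (Nat.cast_nonneg M))]
        exact min_le_right _ _
      have hiM : Integrable (fun y : ℝ × ℝ => min |f y| (M : ℝ)) (preemptionLaw lam ν) :=
        Integrable.mono' (integrable_const (M : ℝ)) hmM.aestronglyMeasurable
          (Eventually.of_forall fun y => hbd _)
      have hAM : Integrable (fun z : (ℝ × ℝ) × (ℝ × ℝ) =>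
          (if z.1.1 < z.1.2 then (1 : ℝ) else 0) * min |f z.2| (M : ℝ))
          ((pairLaw lam ν).prod (preemptionLaw lam ν)) := hA.mul_prod hiM
      have h1 : ∫ y, min |f y| (M : ℝ) ∂preemptionLaw lam ν ≤
          ∫ z, (|φ z| + (if z.1.1 < z.1.2 then (1 : ℝ) else 0) * min |f z.2| (M : ℝ))
            ∂(pairLaw lam ν).prod (preemptionLaw lam ν) := by
        rw [← integral_comp_of_measurable hΘ hmM]
        refine integral_mono (hΘ.integrable_comp_of_integrable hiM) (hφ.abs.add hAM) fun z => ?_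
        simp only [h]
        split_ifs
        · rw [one_mul, one_mul]
          have := abs_add_le (φ z) (f z.2)
          rcases le_total |f z.2| (M : ℝ) with hc | hc
          · rw [min_eq_left hc]
            exact (min_le_left _ _).trans this
          · rw [min_eq_right hc]
            exact (min_le_right _ _).trans (by linarith [abs_nonneg (φ z)])
        · rw [zero_mul, zero_mul, add_zero, add_zero]
          exact min_le_left _ _
      rw [integral_add hφ.abs hAM, integral_prod_mul
        (fun e : ℝ × ℝ => if e.1 < e.2 then (1 : ℝ) else 0) (fun y : ℝ × ℝ => min |f y| (M : ℝ)),
        hAint] at h1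
      rw [le_div_iff₀ he0]
      linarith
    refine ⟨hf.aestronglyMeasurable, ?_⟩
    set c := (∫ z, |φ z| ∂(pairLaw lam ν).prod (preemptionLaw lam ν)) / expMoment ν lam 0
    -- Each truncation is eventually exact, so Fatou's lemma transfers the uniform bound to `|f|`.
    have h2 : ∀ y, ‖f y‖ₑ = liminf (fun M : ℕ => ENNReal.ofReal (min |f y| M)) atTop := by
      intro y
      have : Tendsto (fun M : ℕ => ENNReal.ofReal (min |f y| M)) atTop (𝓝 ‖f y‖ₑ) := by
        refine tendsto_const_nhds.congr' ?_
        obtain ⟨M, hM⟩ := exists_nat_ge |f y|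
        filter_upwards [eventually_ge_atTop M] with n hn
        rw [min_eq_left (hM.trans (by exact_mod_cast hn)), ← Real.norm_eq_abs, ofReal_norm]
      exact this.liminf_eq.symm
    rw [hasFiniteIntegral_def]
    simp only [h2]
    refine lt_of_le_of_lt (lintegral_liminf_le fun M => by fun_prop) ?_
    refine lt_of_le_of_lt (b := ENNReal.ofReal c) ?_ ENNReal.ofReal_lt_top
    refine liminf_le_of_le (by isBoundedDefault) fun b hb' => ?_
    obtain ⟨M, hM⟩ := hb'.exists
    refine hM.trans ?_
    rw [← ofReal_integral_eq_lintegral_ofReal]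
    · exact ENNReal.ofReal_le_ofReal (hb M)
    · refine Integrable.mono' (integrable_const (M : ℝ)) (by fun_prop)
        (Eventually.of_forall fun y => ?_)
      rw [Real.norm_eq_abs, abs_of_nonneg (le_min (abs_nonneg _) (Nat.cast_nonneg M))]
      exact min_le_right _ _
    · exact Eventually.of_forall fun y => le_min (abs_nonneg _) (Nat.cast_nonneg M)
  refine ⟨hintf, ?_⟩
  have hAf : Integrable (fun z : (ℝ × ℝ) × (ℝ × ℝ) =>
      (if z.1.1 < z.1.2 then (1 : ℝ) else 0) * f z.2)
      ((pairLaw lam ν).prod (preemptionLaw lam ν)) := hA.mul_prod hintf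
  have h1 := integral_comp_of_measurable hΘ hf
  simp only [h] at h1
  rw [integral_add hφ hAf, integral_prod_mul (fun e : ℝ × ℝ => if e.1 < e.2 then (1 : ℝ) else 0) f,
    hAint] at h1
  linarith

end Laws

section

/-! ### Moments and metrics of M/G/1/1/preemptive. -/

section Moments

variable {lam : ℝ} {ν : Measure ℝ} [IsProbabilityMeasure ν] [IsProbabilityMeasure (expMeasure lam)]

/-- The served service time is `H` if `H ≤ T` and an independent copy of itself otherwise. The
inhomogeneous term for the `k`-th power is `H ^ k` on `H ≤ T`, of mean `E[H ^ k * exp (-(lam *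
H))]`. -/
lemma memLp_preemptionLaw_snd (hlam : 0 < lam) (hν : ∀ᵐ h ∂ν, 0 < h) :
    MemLp (fun y : ℝ × ℝ => y.2) 2 (preemptionLaw lam ν) ∧
      (expMoment ν lam 0 * ∫ y, y.2 ∂preemptionLaw lam ν = expMoment ν lam 1) ∧
      expMoment ν lam 0 * ∫ y, y.2 ^ 2 ∂preemptionLaw lam ν = expMoment ν lam 2 := by
  have key : ∀ k : ℕ, Integrable (fun y : ℝ × ℝ => y.2 ^ k) (preemptionLaw lam ν) ∧
      expMoment ν lam 0 * ∫ y, y.2 ^ k ∂preemptionLaw lam ν = expMoment ν lam k := by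
    intro k
    have hi := (integrable_service_le (ν := ν) hlam hν k).comp_fst (preemptionLaw lam ν)
    obtain ⟨h1, h2⟩ := integrable_preemptionLaw (ν := ν) hlam hν (f := fun y => y.2 ^ k)
      (by fun_prop) hi fun z => by
        simp only [preemptionStep]
        split_ifs with h1 h2 h2
        · exact absurd h2 (not_lt.2 h1)
        · simp
        · simp
        · exact absurd (not_le.1 h1) h2
    refine ⟨h1, h2.trans ?_⟩
    rw [← integral_service_le hlam hν k]
    exact integral_comp_of_measurable (g := fun e : ℝ × ℝ => if e.2 ≤ e.1 then e.2 ^ k else 0)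
      measurePreserving_fst
      (Measurable.ite (measurableSet_le (by fun_prop) (by fun_prop)) (by fun_prop) (by fun_prop))
  have h1 := key 1
  simp only [pow_one] at h1
  exact ⟨(memLp_two_iff_integrable_sq (by fun_prop)).2 (key 2).1, h1.2, (key 2).2⟩

/-- With delay `V` and served service time `S`, on `T < H` the step gives `V = T + V'` and `S = S'`
with `(V', S')` an independent copy, and `V = 0` otherwise. Squaring `V` or multiplying it by `S`
leaves the cross terms `2 * T * V'` and `T * S'`, which factor. The first moment must come first, as
it makes the cross term of the second integrable. -/
lemma memLp_preemptionLaw_fst (hlam : 0 < lam) (hν : ∀ᵐ h ∂ν, 0 < h) :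
    MemLp (fun y : ℝ × ℝ => y.1) 2 (preemptionLaw lam ν) ∧
      (expMoment ν lam 0 * ∫ y, y.1 ∂preemptionLaw lam ν =
        1 / lam - expMoment ν lam 0 / lam - expMoment ν lam 1) ∧
      (expMoment ν lam 0 * ∫ y, y.1 ^ 2 ∂preemptionLaw lam ν =
        2 / lam ^ 2 - 2 * expMoment ν lam 0 / lam ^ 2 - 2 * expMoment ν lam 1 / lam -
          expMoment ν lam 2 + 2 * ((1 / lam - expMoment ν lam 0 / lam - expMoment ν lam 1) *
            ∫ y, y.1 ∂preemptionLaw lam ν)) ∧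
      expMoment ν lam 0 * ∫ y, y.1 * y.2 ∂preemptionLaw lam ν =
        (1 / lam - expMoment ν lam 0 / lam - expMoment ν lam 1) *
            ∫ y, y.2 ∂preemptionLaw lam ν := by
  have hB1 : Integrable (fun e : ℝ × ℝ => if e.1 < e.2 then e.1 else 0) (pairLaw lam ν) := by
    simpa using integrable_interarrival_lt (ν := ν) hlam 1
  have hm : ∀ k : ℕ, Measurable fun e : ℝ × ℝ => if e.1 < e.2 then e.1 ^ k else 0 := fun k =>
    Measurable.ite (measurableSet_lt (by fun_prop) (by fun_prop)) (by fun_prop) (by fun_prop)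
  have hm1 : Measurable fun e : ℝ × ℝ => if e.1 < e.2 then e.1 else 0 := by simpa using hm 1
  have hB2 := integrable_interarrival_lt (ν := ν) hlam 2
  obtain ⟨i1, e1⟩ := integrable_preemptionLaw (ν := ν) hlam hν (f := fun y => y.1)
    (φ := fun z => if z.1.1 < z.1.2 then z.1.1 else 0)
    (by fun_prop) (hB1.comp_fst (preemptionLaw lam ν)) fun z => by
      simp only [preemptionStep]
      split_ifs with h1 h2 h2
      · exact absurd h2 (not_lt.2 h1)
      · simp
      · simp
      · exact absurd (not_le.1 h1) h2
  have hBv : Integrable (fun z : (ℝ × ℝ) × (ℝ × ℝ) => (if z.1.1 < z.1.2 then z.1.1 else 0) * z.2.1)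
      ((pairLaw lam ν).prod (preemptionLaw lam ν)) := hB1.mul_prod i1
  have is := (memLp_preemptionLaw_snd (ν := ν) hlam hν).1.integrable one_le_two
  have hBs : Integrable (fun z : (ℝ × ℝ) × (ℝ × ℝ) => (if z.1.1 < z.1.2 then z.1.1 else 0) * z.2.2)
      ((pairLaw lam ν).prod (preemptionLaw lam ν)) := hB1.mul_prod is
  have hB2' := hB2.comp_fst (preemptionLaw lam ν)
  obtain ⟨i2, e2⟩ := integrable_preemptionLaw (ν := ν) hlam hν (f := fun y => y.1 ^ 2)
    (φ := fun z => (if z.1.1 < z.1.2 then z.1.1 ^ 2 else 0) +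
      2 * ((if z.1.1 < z.1.2 then z.1.1 else 0) * z.2.1))
    (by fun_prop) (hB2'.fun_add (hBv.const_mul 2)) fun z => by
      simp only [preemptionStep]
      split_ifs with h1 h2 h2
      · exact absurd h2 (not_lt.2 h1)
      · simp
      · simp only
        ring
      · exact absurd (not_le.1 h1) h2
  obtain ⟨-, e3⟩ := integrable_preemptionLaw (ν := ν) hlam hν (f := fun y => y.1 * y.2)
    (φ := fun z => (if z.1.1 < z.1.2 then z.1.1 else 0) * z.2.2)
    (by fun_prop) hBs fun z => by
      simp only [preemptionStep]
      split_ifs with h1 h2 h2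
      · exact absurd h2 (not_lt.2 h1)
      · simp
      · simp only
        ring
      · exact absurd (not_le.1 h1) h2
  refine ⟨(memLp_two_iff_integrable_sq (by fun_prop)).2 i2, ?_, ?_, ?_⟩
  · rw [e1, ← integral_interarrival_lt hlam hν]
    exact integral_comp_of_measurable (g := fun e : ℝ × ℝ => if e.1 < e.2 then e.1 else 0)
      measurePreserving_fst hm1
  · rw [e2, integral_add hB2' (hBv.const_mul 2), integral_const_mul,
      integral_prod_mul (fun e : ℝ × ℝ => if e.1 < e.2 then e.1 else 0) (fun y : ℝ × ℝ => y.1),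
      integral_interarrival_lt hlam hν, ← integral_sq_interarrival_lt hlam hν]
    congr 1
    exact integral_comp_of_measurable (g := fun e : ℝ × ℝ => if e.1 < e.2 then e.1 ^ 2 else 0)
      measurePreserving_fst (hm 2)
  · rw [e3, integral_prod_mul (fun e : ℝ × ℝ => if e.1 < e.2 then e.1 else 0)
      (fun y : ℝ × ℝ => y.2), integral_interarrival_lt hlam hν]

end Moments

variable {Ω : Type*} [MeasurableSpace Ω] {P : Measure Ω} [IsProbabilityMeasure P] {lam : ℝ}
  {T H : ℕ → Ω → ℝ}

/-- The metrics of M/G/1/1/preemptive in terms of the moments of the service time. -/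
theorem systemHasMetrics_preemptive (hq : IsQueueInput P lam T H) (hlam : 0 < lam)
    {e₀ e₁ e₂ : ℝ} (he₀ : expMoment (P.map (H 0)) lam 0 = e₀)
    (he₁ : expMoment (P.map (H 0)) lam 1 = e₁) (he₂ : expMoment (P.map (H 0)) lam 2 = e₂) :
    SystemHasMetrics P T H .preemptive (1 / (lam * e₀)) (e₁ / e₀ + 1 / (lam * e₀))
      (e₂ / e₀ - e₁ ^ 2 / e₀ ^ 2 + 1 / (lam ^ 2 * e₀ ^ 2) - 2 * e₁ / (lam * e₀ ^ 2)) := by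
  have := Measure.isProbabilityMeasure_map (μ := P) (hq.measurable_service 0).aemeasurable
  have := isProbabilityMeasure_expMeasure hlam
  have hν := hq.ae_pos_service
  have hin := hq.measurePreserving (f := fun n => n) (fun _ _ h => h)
  have hreg := isRegeneration_preemptive (ν := P.map (H 0)) hlam hν
  set q := iidLaw (pairLaw lam (P.map (H 0))) with hq'
  set κ := preemptionLaw lam (P.map (H 0)) with hκ
  have hΦ : MeasurePreserving preemptiveBlock q (q.map preemptiveBlock) :=
    hreg.measurable_block.measurePreserving q
  have hΨ : MeasurePreserving (fun z : ℝ × ℝ × ℝ => (z.1 + z.2.1, z.2.2))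
      ((expMeasure lam).prod κ) (q.map preemptiveBlock) :=
    ⟨by fun_prop, map_preemptiveBlock.symm⟩
  have := Measure.isProbabilityMeasure_map (μ := q) hreg.measurable_block.aemeasurable
  have hpos0 : 0 < e₀ := he₀ ▸ expMoment_zero_pos hlam hν
  obtain ⟨ms, es₁, es₂⟩ := memLp_preemptionLaw_snd (ν := P.map (H 0)) hlam hν
  obtain ⟨mv, ev₁, ev₂, evs⟩ := memLp_preemptionLaw_fst (ν := P.map (H 0)) hlam hν
  rw [← hκ] at ms es₁ es₂ mv ev₁ ev₂ evs
  rw [he₀, he₁] at ev₁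
  rw [he₀, he₁] at evs
  rw [he₀, he₁, he₂] at ev₂
  rw [he₀, he₁] at es₁
  rw [he₀, he₂] at es₂
  have mt : MemLp (fun z : ℝ × ℝ × ℝ => z.1) 2 ((expMeasure lam).prod κ) :=
    (memLp_id_expMeasure hlam).comp_measurePreserving measurePreserving_fst
  have mv' : MemLp (fun z : ℝ × ℝ × ℝ => z.2.1) 2 ((expMeasure lam).prod κ) :=
    mv.comp_measurePreserving measurePreserving_snd
  have ms' : MemLp (fun z : ℝ × ℝ × ℝ => z.2.2) 2 ((expMeasure lam).prod κ) :=
    ms.comp_measurePreserving measurePreserving_snd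
  have mtv : MemLp (fun z : ℝ × ℝ × ℝ => z.1 + z.2.1) 2 ((expMeasure lam).prod κ) := mt.add mv'
  have mj' : MemLp (fun z : ℝ × ℝ × ℝ => z.1 + z.2.1 + z.2.2) 2 ((expMeasure lam).prod κ) :=
    mtv.add ms'
  have hs : MemLp (fun x : ℝ × ℝ => x.2) 2 (q.map preemptiveBlock) := by
    rw [← hΨ.map_eq, memLp_map_measure_iff (by fun_prop) hΨ.measurable.aemeasurable]
    exact ms'
  have hj : MemLp (fun x : ℝ × ℝ => x.1 + x.2) 2 (q.map preemptiveBlock) := by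
    rw [← hΨ.map_eq, memLp_map_measure_iff (by fun_prop) hΨ.measurable.aemeasurable]
    exact mj'
  have hB : IsBlockSystem P T H .preemptive (q.map preemptiveBlock)
      (fun ω l => preemptiveBlock (preemptiveRest^[l] fun n => (T n ω, H n ω))) (fun _ => 0)
      (fun x => x.2) (fun _ => 0) (fun x => x.1 + x.2)
      (fun ω => (preemptiveBlock fun n => (T n ω, H n ω)).2)
      (fun ω => (preemptiveBlock fun n => (T n ω, H n ω)).1 +
        (preemptiveBlock fun n => (T n ω, H n ω)).2) :=
    { measurePreserving := hreg.measurePreserving_blocks.comp hin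
      measurable_d := measurable_const
      measurable_s := measurable_snd
      measurable_i := measurable_const
      measurable_j := by fun_prop
      measurable_B₀ := measurable_snd.comp (hreg.measurable_block.comp hin.measurable)
      measurable_C₀ := (measurable_fst.comp (hreg.measurable_block.comp hin.measurable)).add
        (measurable_snd.comp (hreg.measurable_block.comp hin.measurable))
      memLp_d := memLp_const 0
      memLp_s := hs
      memLp_i := memLp_const 0
      memLp_j := hj
      memLp_B₀ := hs.comp_measurePreserving (hΦ.comp hin)
      memLp_C₀ := hj.comp_measurePreserving (hΦ.comp hin)
      path := by
        filter_upwards [hin.quasiMeasurePreserving.ae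
          (ae_isGoodInput (ν := P.map (H 0)) hlam hν)] with ω hω
        obtain ⟨p1, p2, p3, p4⟩ := preemptive_path hω
        refine ⟨_, p1, p2, p3 0, fun l => ⟨?_, ?_⟩⟩
        · rw [p3 (l + 1), zero_add]
        · rw [p4 l, zero_add] }
  set v₁ := ∫ y : ℝ × ℝ, y.1 ∂κ with hv₁
  set v₂ := ∫ y : ℝ × ℝ, y.1 ^ 2 ∂κ with hv₂
  set s₁ := ∫ y : ℝ × ℝ, y.2 ∂κ with hs₁
  set s₂ := ∫ y : ℝ × ℝ, y.2 ^ 2 ∂κ with hs₂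
  set vs := ∫ y : ℝ × ℝ, y.1 * y.2 ∂κ with hvs
  have hκsnd : ∀ {f : ℝ × ℝ → ℝ}, Measurable f →
      ∫ z : ℝ × ℝ × ℝ, f z.2 ∂(expMeasure lam).prod κ = ∫ y, f y ∂κ := fun hf =>
    integral_comp_of_measurable measurePreserving_snd hf
  have ij₁ : ∫ x : ℝ × ℝ, (x.1 + x.2) ∂q.map preemptiveBlock = 1 / lam + v₁ + s₁ := by
    rw [← integral_comp_of_measurable hΨ (by fun_prop)]
    simp only
    rw [integral_add (mtv.integrable one_le_two) (ms'.integrable one_le_two),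
      integral_add (mt.integrable one_le_two) (mv'.integrable one_le_two),
      hκsnd (f := fun y => y.1) (by fun_prop), hκsnd (f := fun y => y.2) (by fun_prop),
      integral_comp_of_measurable measurePreserving_fst (g := fun t : ℝ => t) (by fun_prop),
      integral_id_expMeasure hlam]
  have ij₂ : ∫ x : ℝ × ℝ, (x.1 + x.2) ^ 2 ∂q.map preemptiveBlock =
      2 / lam ^ 2 + 2 * (1 / lam * v₁) + 2 * (1 / lam * s₁) + 2 * vs + v₂ + s₂ := by
    have itv : Integrable (fun z : ℝ × ℝ × ℝ => z.1 * z.2.1) ((expMeasure lam).prod κ) :=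
      mt.integrable_mul mv'
    have its : Integrable (fun z : ℝ × ℝ × ℝ => z.1 * z.2.2) ((expMeasure lam).prod κ) :=
      mt.integrable_mul ms'
    have ivs : Integrable (fun z : ℝ × ℝ × ℝ => z.2.1 * z.2.2) ((expMeasure lam).prod κ) :=
      mv'.integrable_mul ms'
    have hexp : ∀ z : ℝ × ℝ × ℝ, (z.1 + z.2.1 + z.2.2) ^ 2 =
        z.1 ^ 2 + 2 * (z.1 * z.2.1) + 2 * (z.1 * z.2.2) + 2 * (z.2.1 * z.2.2) + z.2.1 ^ 2 +
          z.2.2 ^ 2 := fun z => by ring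
    rw [← integral_comp_of_measurable hΨ (by fun_prop)]
    simp only [hexp]
    have a1 := mt.integrable_sq.fun_add (itv.const_mul 2)
    have a2 := a1.fun_add (its.const_mul 2)
    have a3 := a2.fun_add (ivs.const_mul 2)
    have a4 := a3.fun_add mv'.integrable_sq
    rw [integral_add a4 ms'.integrable_sq, integral_add a3 mv'.integrable_sq,
      integral_add a2 (ivs.const_mul 2), integral_add a1 (its.const_mul 2),
      integral_add mt.integrable_sq (itv.const_mul 2), integral_const_mul, integral_const_mul,
      integral_const_mul, integral_prod_mul (fun t : ℝ => t) (fun y : ℝ × ℝ => y.1),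
      integral_prod_mul (fun t : ℝ => t) (fun y : ℝ × ℝ => y.2),
      hκsnd (f := fun y => y.1 * y.2) (by fun_prop), hκsnd (f := fun y => y.1 ^ 2) (by fun_prop),
      hκsnd (f := fun y => y.2 ^ 2) (by fun_prop),
      integral_comp_of_measurable measurePreserving_fst (g := fun t : ℝ => t ^ 2) (by fun_prop),
      integral_sq_expMeasure hlam, integral_id_expMeasure hlam]
  have is₁ : ∫ x : ℝ × ℝ, x.2 ∂q.map preemptiveBlock = s₁ := by
    rw [← integral_comp_of_measurable hΨ (by fun_prop)]
    exact hκsnd (f := fun y => y.2) (by fun_prop)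
  have is₂ : ∫ x : ℝ × ℝ, x.2 ^ 2 ∂q.map preemptiveBlock = s₂ := by
    rw [← integral_comp_of_measurable hΨ (by fun_prop)]
    exact hκsnd (f := fun y => y.2 ^ 2) (by fun_prop)
  have hmain := hB.systemHasMetrics_of_moments hlam (hq.measureReal_arrival_le hlam)
    (d₁ := 0) (d₂ := 0) (si := 0) (i₁ := 0) (i₂ := 0) (by simp) (by simp) is₁ is₂ (by simp)
    (by simp) (by simp) ij₁ ij₂
  have q1 : s₁ = e₁ / e₀ := by rw [eq_div_iff hpos0.ne']; linarith
  have q2 : s₂ = e₂ / e₀ := by rw [eq_div_iff hpos0.ne']; linarith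
  have q3 : v₁ = (1 / lam - e₀ / lam - e₁) / e₀ := by rw [eq_div_iff hpos0.ne']; linarith
  have q4 : vs = (1 / lam - e₀ / lam - e₁) * s₁ / e₀ := by rw [eq_div_iff hpos0.ne']; linarith
  have q5 : v₂ = (2 / lam ^ 2 - 2 * e₀ / lam ^ 2 - 2 * e₁ / lam - e₂ +
      2 * ((1 / lam - e₀ / lam - e₁) * v₁)) / e₀ := by rw [eq_div_iff hpos0.ne']; linarith
  have hj₁ : 1 / lam + v₁ + s₁ = 1 / (lam * e₀) := by
    rw [q1, q3]
    field_simp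
    ring
  have hj₂ : 2 / lam ^ 2 + 2 * (1 / lam * v₁) + 2 * (1 / lam * s₁) + 2 * vs + v₂ + s₂ =
      2 / (lam ^ 2 * e₀ ^ 2) - 2 * e₁ / (lam * e₀ ^ 2) := by
    rw [q5, q4, q3, q2, q1]
    field_simp
    ring
  rw [hj₁, hj₂, q1, q2] at hmain
  convert hmain using 1
  · field_simp
    ring
  · ring
  · field_simp
    ring

end

/-! ### Derivatives of the Laplace-Stieltjes transform -/

section Transform

variable {ν : Measure ℝ}

/-- The mean value inequality on `[ε, ∞)` yields this bound, which provides the domination for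
differentiating under the integral. -/
lemma abs_exp_sub_exp_le {ε s u h : ℝ} (hs : ε ≤ s) (hu : ε ≤ u) (hh : 0 ≤ h) :
    |Real.exp (-(u * h)) - Real.exp (-(s * h))| ≤ h * Real.exp (-(ε * h)) * |u - s| := by
  have hd : ∀ x ∈ Set.Ici ε, HasDerivWithinAt (fun x => Real.exp (-(x * h)))
      (Real.exp (-(x * h)) * -(1 * h)) (Set.Ici ε) x := fun x _ =>
    (((hasDerivAt_id x).mul_const h).fun_neg.exp).hasDerivWithinAt
  refine (convex_Ici ε).norm_image_sub_le_of_norm_hasDerivWithin_le hd (fun x hx => ?_) hs hu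
  rw [Real.norm_eq_abs, one_mul, mul_neg, abs_neg, abs_of_nonneg (by positivity), mul_comm]
  refine mul_le_mul_of_nonneg_left (Real.exp_le_exp.2 ?_) hh
  have := mul_le_mul_of_nonneg_right (Set.mem_Ici.1 hx) hh
  linarith

lemma integrable_pow_mul_exp_of_le (hν : ∀ᵐ h ∂ν, 0 < h) {ε s : ℝ} (hs : ε ≤ s) {k : ℕ}
    (hi : Integrable (fun h : ℝ => h ^ k * Real.exp (-(ε * h))) ν) :
    Integrable (fun h : ℝ => h ^ k * Real.exp (-(s * h))) ν := by
  refine hi.mono (by fun_prop) ?_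
  filter_upwards [hν] with h hh
  rw [Real.norm_eq_abs, Real.norm_eq_abs, abs_of_pos (by positivity), abs_of_pos (by positivity)]
  refine mul_le_mul_of_nonneg_left (Real.exp_le_exp.2 ?_) (by positivity)
  have := mul_le_mul_of_nonneg_right hs hh.le
  linarith

/-- The difference quotients are dominated by `h ^ (k + 1) * exp (-(ε * h))`. The base point `ε`
covers both uses: `ε = 0` for one-sided derivatives at zero, and a positive `ε` when no moments are
assumed. -/
lemma hasDerivWithinAt_expMoment (hν : ∀ᵐ h ∂ν, 0 < h) {ε s : ℝ} (hs : ε ≤ s) (k : ℕ)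
    (hi : Integrable (fun h : ℝ => h ^ k * Real.exp (-(ε * h))) ν)
    (hi' : Integrable (fun h : ℝ => h ^ (k + 1) * Real.exp (-(ε * h))) ν) :
    HasDerivWithinAt (fun u => expMoment ν u k) (-expMoment ν s (k + 1)) (Set.Ici ε) s := by
  rw [hasDerivWithinAt_iff_tendsto_slope]
  have h1 : ∀ᶠ u in 𝓝[Set.Ici ε \ {s}] s, ∫ h, (u - s)⁻¹ *
      (h ^ k * Real.exp (-(u * h)) - h ^ k * Real.exp (-(s * h))) ∂ν =
        slope (fun u => expMoment ν u k) s u := by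
    filter_upwards [self_mem_nhdsWithin] with u hu
    rw [integral_const_mul, integral_sub (integrable_pow_mul_exp_of_le hν hu.1 hi)
      (integrable_pow_mul_exp_of_le hν hs hi), slope_def_field, div_eq_inv_mul]
    rfl
  refine Tendsto.congr' h1 ?_
  rw [expMoment, ← integral_neg]
  refine tendsto_integral_filter_of_dominated_convergence
    (fun h => h ^ (k + 1) * Real.exp (-(ε * h))) (Eventually.of_forall fun u => by fun_prop) ?_ hi' ?_
  · filter_upwards [self_mem_nhdsWithin] with u hu
    filter_upwards [hν] with h hh
    have hne : 0 < |u - s| := abs_pos.2 (sub_ne_zero.2 hu.2)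
    have h2 := abs_exp_sub_exp_le hs hu.1 hh.le
    rw [← mul_sub, Real.norm_eq_abs, abs_mul, abs_mul, abs_inv, abs_of_pos (pow_pos hh k),
      inv_mul_le_iff₀ hne, pow_succ]
    calc h ^ k * |Real.exp (-(u * h)) - Real.exp (-(s * h))|
        ≤ h ^ k * (h * Real.exp (-(ε * h)) * |u - s|) :=
          mul_le_mul_of_nonneg_left h2 (by positivity)
      _ = _ := by ring
  · refine Eventually.of_forall fun h => ?_
    have hd : HasDerivAt (fun x => h ^ k * Real.exp (-(x * h)))
        (h ^ k * (Real.exp (-(s * h)) * -(1 * h))) s :=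
      ((hasDerivAt_id s).mul_const h).fun_neg.exp.const_mul (h ^ k)
    have h3 := (hasDerivWithinAt_iff_tendsto_slope.1 (hd.hasDerivWithinAt (s := Set.Ici ε)))
    rw [show -(h ^ (k + 1) * Real.exp (-(s * h))) = h ^ k * (Real.exp (-(s * h)) * -(1 * h)) by ring]
    refine h3.congr fun u => ?_
    rw [slope_def_field, div_eq_inv_mul]

variable [IsProbabilityMeasure ν]

/-- With base point `s / 2` every power is integrable against the exponential weight, and `[s / 2,
∞)` is a neighbourhood of `s`, so the one-sided result becomes a full derivative. -/
lemma hasDerivWithinAt_expMoment_of_pos (hν : ∀ᵐ h ∂ν, 0 < h) {s : ℝ} (hs : 0 < s) (k : ℕ) :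
    HasDerivWithinAt (fun u => expMoment ν u k) (-expMoment ν s (k + 1)) (Set.Ici 0) s := by
  have h := hasDerivWithinAt_expMoment hν (half_le_self hs.le) k
    (integrable_pow_mul_exp (half_pos hs) hν k) (integrable_pow_mul_exp (half_pos hs) hν (k + 1))
  exact (h.hasDerivAt (Ici_mem_nhds (half_lt_self hs))).hasDerivWithinAt

lemma iteratedDerivWithin_one_expMoment (hν : ∀ᵐ h ∂ν, 0 < h) {s : ℝ} (hs : 0 < s) :
    iteratedDerivWithin 1 (fun u => expMoment ν u 0) (Set.Ici 0) s = -expMoment ν s 1 := by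
  rw [iteratedDerivWithin_one]
  exact (hasDerivWithinAt_expMoment_of_pos hν hs 0).derivWithin (uniqueDiffOn_Ici 0 s hs.le)

lemma iteratedDerivWithin_two_expMoment (hν : ∀ᵐ h ∂ν, 0 < h) {s : ℝ} (hs : 0 < s) :
    iteratedDerivWithin 2 (fun u => expMoment ν u 0) (Set.Ici 0) s = expMoment ν s 2 := by
  rw [iteratedDerivWithin_succ]
  have h1 : iteratedDerivWithin 1 (fun u => expMoment ν u 0) (Set.Ici 0) =ᶠ[𝓝[Set.Ici 0] s]
      fun u => -expMoment ν u 1 := by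
    filter_upwards [mem_nhdsWithin_of_mem_nhds (Ioi_mem_nhds hs)] with u hu
    exact iteratedDerivWithin_one_expMoment hν hu
  rw [h1.derivWithin_eq (iteratedDerivWithin_one_expMoment hν hs)]
  have h2 := (hasDerivWithinAt_expMoment_of_pos hν hs 1).fun_neg
  rw [h2.derivWithin (uniqueDiffOn_Ici 0 s hs.le), neg_neg]

lemma hasDerivWithinAt_expMoment_of_memLp (hν : ∀ᵐ h ∂ν, 0 < h)
    (h2 : MemLp (fun h : ℝ => h) 2 ν) {s : ℝ} (hs : 0 ≤ s) {k : ℕ} (hk : k ≤ 1) :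
    HasDerivWithinAt (fun u => expMoment ν u k) (-expMoment ν s (k + 1)) (Set.Ici 0) s := by
  have hi : ∀ k ≤ 2, Integrable (fun h : ℝ => h ^ k * Real.exp (-(0 * h))) ν := by
    intro k hk
    simp only [zero_mul, neg_zero, Real.exp_zero, mul_one]
    interval_cases k
    · simp
    · simpa using h2.integrable one_le_two
    · exact h2.integrable_sq
  exact hasDerivWithinAt_expMoment hν hs k (hi k (by omega)) (hi (k + 1) (by omega))

lemma iteratedDerivWithin_one_expMoment_zero (hν : ∀ᵐ h ∂ν, 0 < h)
    (h2 : MemLp (fun h : ℝ => h) 2 ν) :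
    iteratedDerivWithin 1 (fun u => expMoment ν u 0) (Set.Ici 0) 0 = -∫ h, h ∂ν := by
  rw [iteratedDerivWithin_one, (hasDerivWithinAt_expMoment_of_memLp hν h2 le_rfl
    zero_le_one).derivWithin (uniqueDiffOn_Ici 0 0 Set.self_mem_Ici)]
  simp [expMoment]

lemma iteratedDerivWithin_two_expMoment_zero (hν : ∀ᵐ h ∂ν, 0 < h)
    (h2 : MemLp (fun h : ℝ => h) 2 ν) :
    iteratedDerivWithin 2 (fun u => expMoment ν u 0) (Set.Ici 0) 0 = ∫ h, h ^ 2 ∂ν := by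
  rw [iteratedDerivWithin_succ]
  have h1 : Set.EqOn (iteratedDerivWithin 1 (fun u => expMoment ν u 0) (Set.Ici 0))
      (fun u => -expMoment ν u 1) (Set.Ici 0) := fun u hu => by
    rw [iteratedDerivWithin_one]
    exact (hasDerivWithinAt_expMoment_of_memLp hν h2 hu zero_le_one).derivWithin
      (uniqueDiffOn_Ici 0 u hu)
  rw [derivWithin_congr h1 (h1 Set.self_mem_Ici)]
  have h2 := (hasDerivWithinAt_expMoment_of_memLp hν h2 le_rfl le_rfl).fun_neg
  rw [h2.derivWithin (uniqueDiffOn_Ici 0 0 Set.self_mem_Ici), neg_neg]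
  simp [expMoment]

lemma expMoment_expMeasure {mu s : ℝ} (hmu : 0 < mu) (hs : 0 ≤ s) (k : ℕ) :
    expMoment (expMeasure mu) s k = k.factorial * mu / (mu + s) ^ (k + 1) := by
  rw [← integral_pow_mul_exp_expMeasure hmu hs]
  simp only [expMoment, neg_mul]

end Transform

lemma lstDeriv_eq {Ω : Type*} [MeasurableSpace Ω] {P : Measure Ω} {X : Ω → ℝ} (hX : Measurable X)
    (n : ℕ) (s : ℝ) :
    lstDeriv P X n s =
      iteratedDerivWithin n (fun u => expMoment (P.map X) u 0) (Set.Ici 0) s := by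
  have h : ∀ u, ∫ ω, Real.exp (-u * X ω) ∂P = expMoment (P.map X) u 0 := by
    intro u
    rw [expMoment, integral_map hX.aemeasurable (by fun_prop)]
    simp only [pow_zero, one_mul, neg_mul]
  simp only [lstDeriv, h]

end AgeOfInformation

/-! ### The closed formulas, and their exponential special cases. -/

theorem mainTheorem8 {Ω : Type*} [MeasurableSpace Ω] (P : Measure Ω) [IsProbabilityMeasure P]
    (lam : ℝ) (hlam : 0 < lam) (T H : ℕ → Ω → ℝ)
    (hinput : AgeOfInformation.IsQueueInput P lam T H)
    (K : ℕ → ℝ → ℝ) (hK : ∀ n s, K n s = AgeOfInformation.lstDeriv P (H 0) n s) :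
    -- M/G/1/1 and M/G/1/2*
    (MemLp (H 0) 2 P →
      AgeOfInformation.SystemHasMetrics P T H .blocking
        ((2 / lam ^ 2 - 2 / lam * K 1 0 + K 2 0) / (2 * (1 / lam - K 1 0)) - K 1 0)
        (1 / lam - 2 * K 1 0)
        (1 / lam ^ 2 + 2 * K 2 0 - 2 * K 1 0 ^ 2) ∧
      AgeOfInformation.SystemHasMetrics P T H .replacement
        ((1 / 2 * K 2 0 + 1 / lam ^ 2 * K 0 lam - 1 / lam * K 1 lam) / (-K 1 0 + K 0 lam / lam)
          + 1 / lam - 1 / lam * K 0 lam + K 1 lam - K 1 0)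
        (-2 * K 1 0 + 1 / lam + K 1 lam)
        (2 * K 2 0 - 2 * K 1 0 ^ 2 + 2 * K 0 lam * (1 - K 0 lam) / lam ^ 2
          + 2 * K 0 lam / lam * (K 1 0 + K 1 lam) + 1 / lam ^ 2 - K 2 lam
          - 2 / lam * K 1 lam - K 1 lam ^ 2)) ∧
    -- M/G/1/1/preemptive
    AgeOfInformation.SystemHasMetrics P T H .preemptive
      (1 / (lam * K 0 lam))
      (-K 1 lam / K 0 lam + 1 / (lam * K 0 lam))
      (K 2 lam / K 0 lam - K 1 lam ^ 2 / K 0 lam ^ 2 + 1 / (lam ^ 2 * K 0 lam ^ 2)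
        + 2 * K 1 lam / (lam * K 0 lam ^ 2)) ∧
    -- exponential service times: M/M/1/1, M/M/1/2* and M/M/1/1/preemptive
    (∀ mu : ℝ, 0 < mu → P.map (H 0) = expMeasure mu →
      AgeOfInformation.SystemHasMetrics P T H .blocking
        (1 / lam + 2 / mu - 1 / (lam + mu))
        (1 / lam + 2 / mu)
        (1 / lam ^ 2 + 2 / mu ^ 2) ∧
      AgeOfInformation.SystemHasMetrics P T H .replacement
        (1 / lam + 2 / mu + lam / (lam + mu) ^ 2 + 1 / (lam + mu)
          - 2 * (lam + mu) / (lam ^ 2 + lam * mu + mu ^ 2))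
        (1 / mu + 1 / lam + lam / (mu + lam) ^ 2 + lam / (mu * (mu + lam)))
        (1 / lam ^ 2 + 2 / mu ^ 2
          - (2 * lam ^ 2 + 4 * lam * mu + 3 * mu ^ 2) / (lam + mu) ^ 4) ∧
      AgeOfInformation.SystemHasMetrics P T H .preemptive
        (1 / mu + 1 / lam)
        (1 / (mu + lam) + 1 / mu + 1 / lam)
        (1 / (lam + mu) ^ 2 + 1 / lam ^ 2 + 1 / mu ^ 2)) := by
  have := Measure.isProbabilityMeasure_map (μ := P) (hinput.measurable_service 0).aemeasurable
  have hν := hinput.ae_pos_service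
  have hmH := hinput.measurable_service 0
  have k0 : AgeOfInformation.expMoment (P.map (H 0)) lam 0 = K 0 lam := by
    rw [hK, AgeOfInformation.lstDeriv_eq hmH, iteratedDerivWithin_zero]
  have k1 : AgeOfInformation.expMoment (P.map (H 0)) lam 1 = -K 1 lam := by
    rw [hK, AgeOfInformation.lstDeriv_eq hmH,
      AgeOfInformation.iteratedDerivWithin_one_expMoment hν hlam, neg_neg]
  have k2 : AgeOfInformation.expMoment (P.map (H 0)) lam 2 = K 2 lam := by
    rw [hK, AgeOfInformation.lstDeriv_eq hmH,
      AgeOfInformation.iteratedDerivWithin_two_expMoment hν hlam]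
  refine ⟨fun h2 => ?_, ?_, fun mu hmu hexp => ?_⟩
  · have hν2 := hinput.memLp_service h2
    have m1 : ∫ h, h ∂P.map (H 0) = -K 1 0 := by
      rw [hK, AgeOfInformation.lstDeriv_eq hmH,
        AgeOfInformation.iteratedDerivWithin_one_expMoment_zero hν hν2, neg_neg]
    have m2 : ∫ h, h ^ 2 ∂P.map (H 0) = K 2 0 := by
      rw [hK, AgeOfInformation.lstDeriv_eq hmH,
        AgeOfInformation.iteratedDerivWithin_two_expMoment_zero hν hν2]
    constructor
    · convert AgeOfInformation.systemHasMetrics_blocking hinput hlam h2 m1 m2 using 1 <;> ring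
    · convert AgeOfInformation.systemHasMetrics_replacement hinput hlam h2 m1 m2 k0 k1 k2
        using 1 <;> ring
  · convert AgeOfInformation.systemHasMetrics_preemptive hinput hlam k0 k1 k2 using 1
    ring
  · have h2 : MemLp (H 0) 2 P := by
      have h := AgeOfInformation.memLp_id_expMeasure hmu
      rw [← hexp] at h
      exact (memLp_map_measure_iff (by fun_prop) hmH.aemeasurable).1 h
    have m1 : ∫ h, h ∂P.map (H 0) = 1 / mu := by
      rw [hexp, AgeOfInformation.integral_id_expMeasure hmu]
    have m2 : ∫ h, h ^ 2 ∂P.map (H 0) = 2 / mu ^ 2 := by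
      rw [hexp, AgeOfInformation.integral_sq_expMeasure hmu]
    have e0 : AgeOfInformation.expMoment (P.map (H 0)) lam 0 = mu / (mu + lam) := by
      rw [hexp, AgeOfInformation.expMoment_expMeasure hmu hlam.le]
      simp
    have e1 : AgeOfInformation.expMoment (P.map (H 0)) lam 1 = mu / (mu + lam) ^ 2 := by
      rw [hexp, AgeOfInformation.expMoment_expMeasure hmu hlam.le]
      simp
    have e2 : AgeOfInformation.expMoment (P.map (H 0)) lam 2 = 2 * mu / (mu + lam) ^ 3 := by
      rw [hexp, AgeOfInformation.expMoment_expMeasure hmu hlam.le]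
      simp [Nat.factorial]
    refine ⟨?_, ?_, ?_⟩
    · convert AgeOfInformation.systemHasMetrics_blocking hinput hlam h2 m1 m2 using 1 <;>
        field_simp <;> ring
    · convert AgeOfInformation.systemHasMetrics_replacement hinput hlam h2 m1 m2 e0 e1 e2
        using 1 <;> field_simp <;> ring
    · convert AgeOfInformation.systemHasMetrics_preemptive hinput hlam e0 e1 e2 using 1 <;>
        field_simp <;> ring
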